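/- Let $d\ge 2$ and $\lambda\in(0,1)$. Let $\Omega$ be the set of coefficient fields $a:\mathbb Z^d\to\mathbb R^{d\times d}$ such that every $a(x)$ is diagonal with all diagonal entries in $(\lambda,1)$, equipped with the product of the Borel $\sigma$-algebras. Write $\nabla_k u(x)=u(x+e_k)-u(x)$, $\nabla u=(\nabla_1u,\dots,\nabla_du)$ and $\nabla^*F(x)=\sum_{k=1}^d\big(F_k(x-e_k)-F_k(x)\big)$. Call $u:\mathbb Z^d\to\mathbb R$ sublinear if $$\lim_{R\to\infty}\frac1{R^2}\,\frac{1}{\#Q_R}\sum_{x\in Q_R}|u(x)|^2=0,\qquad Q_R=\mathbb Z^d\cap[-R,R]^d .$$ For $a\in\Omega$ and $i\in\{1,\dots,d\}$ let $\phi_i(a,\cdot)$ denote the unique sublinear function with $\phi_i(a,0)=0$ and $\nabla^*\big(a(\nabla\phi_i(a,\cdot)+e_i)\big)=0$ in $\mathbb Z^d$, whenever exactly one such function exists. By a Green's function of $\nabla^*(a\nabla)$ we mean a function $G(a;\cdot,\cdot)$ on $\mathbb Z^d\times\mathbb Z^d$ such that, for every $y$, $\nabla^*\big(a\nabla G(a;\cdot,y)\big)=\delta(\cdot-y)$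 in $\mathbb Z^d$ and $G(a;\cdot,y)$ is sublinear if $d=2$, bounded if $d>2$. Let $\nabla\nabla G(a;y,x)$ be the $d\times d$ matrix with entries $\nabla_{y,k}\nabla_{x,j}G(a;y,x)$, and let $|\cdot|$ be the Euclidean norm. For a function $f$ on $\Omega$ and $x\in\mathbb Z^d$ set $$|\partial_{\mathrm{lip},x}f(a)|=\sup\big\{|f(a')-f(a'')| : a',a''\in\Omega,\ a=a'=a''\text{ on }\mathbb Z^d\setminus\{x\}\big\}.$$ Then there is a constant $C=C(d,\lambda)>0$ with the following property. Let $\mathbb P$ be a probability measure on $\Omega$ that is invariant under all shifts $\tau_za=a(\cdot+z)$, $z\in\mathbb Z^d$, and ergodic with respect to them (every measurable shift-invariant set has probability $0$ or $1$). Then: (i) For every $i$ there is a random field $\varphi:\Omega\times\mathbb Z^d\to\mathbb R$ (measurable in $a$ for each site) such that $\nabla\varphi$ is stationary, $\mathbb E|\nabla\varphi|^2<\infty$, $\mathbb E\nabla\varphi=0$ and, $\mathbb P$-almost surely, $\nabla^*\big(a(\nabla\varphi+e_i)\big)=0$ in $\mathbb Z^d$ and $\varphi(a,0)=0$. Every such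 field satisfies $\varphi(a,\cdot)=\phi_i(a,\cdot)$ for $\mathbb P$-almost every $a$. (ii) There is a measurable set $\Omega'\subset\Omega$ with $\mathbb P(\Omega')=1$ such that for all $a\in\Omega'$: the function $\phi_i(a',\cdot)$ is well defined (exactly one such function exists) for every $i$ and every $a'\in\Omega$ that differs from $a$ in at most one site; a Green's function of $\nabla^*(a\nabla)$ exists; and for each such Green's function $G$, all $i=1,\dots,d$ and all $x,y\in\mathbb Z^d$, $$|\partial_{\mathrm{lip},x}\nabla\phi_i(a,y)|\le C\,|\nabla\nabla G(a;y,x)|\,|\nabla\phi_i(a,x)+e_i| .$$ -/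

import Mathlib

open MeasureTheory Filter Topology

noncomputable section

/-- The lattice `ℤ^d`. -/
abbrev Site (d : ℕ) : Type := Fin d → ℤ

/-- The coordinate unit vector of the lattice. -/
def unit {d : ℕ} (k : Fin d) : Site d := Pi.single k 1

/-- The configuration space `Ω` of coefficient fields on `ℤ^d` whose values are diagonal matrices
with all diagonal entries in `(lam, 1)`. A diagonal matrix is given by its diagonal: `a x k` is the
`k`-th diagonal entry of the matrix `a(x)`. It carries the product of the Borel `σ`-algebras. -/
abbrev CoeffField (d : ℕ) (lam : ℝ) : Type := Site d → Fin d → Set.Ioo lam 1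

/-- Forward difference gradient `∇u = (∇_1 u, …, ∇_d u)`, `∇_k u(x) = u(x + e_k) - u(x)`. -/
def grad {d : ℕ} (u : Site d → ℝ) (x : Site d) : EuclideanSpace ℝ (Fin d) :=
  WithLp.toLp 2 fun k => u (x + unit k) - u x

/-- `∇^* F = ∑_k ∇_k^* F_k`, where `∇_k^* f(x) = f(x - e_k) - f(x)`. -/
def gradStar {d : ℕ} (F : Site d → EuclideanSpace ℝ (Fin d)) (x : Site d) : ℝ :=
  ∑ k, (F (x - unit k) k - F x k)

/-- The vector field `aF`. -/
def mulField {d : ℕ} {lam : ℝ} (a : CoeffField d lam) (F : Site d → EuclideanSpace ℝ (Fin d))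
    (x : Site d) : EuclideanSpace ℝ (Fin d) :=
  WithLp.toLp 2 fun k => (a x k : ℝ) * F x k

/-- The lattice cube of all points with `|x_k| ≤ R`, for all `k`. -/
def latticeCube (d R : ℕ) : Finset (Site d) :=
  Fintype.piFinset fun _ => Finset.Icc (-(R : ℤ)) (R : ℤ)

/-- Sublinear growth: `R^{-2}` times the average of `|u|^2` over the cube of size `R` tends to
`0` as `R → ∞`. -/
def Sublinear {d : ℕ} (u : Site d → ℝ) : Prop :=
  Tendsto (fun R : ℕ => ((R : ℝ) ^ 2)⁻¹ *
    (((latticeCube d R).card : ℝ)⁻¹ * ∑ x ∈ latticeCube d R, u x ^ 2)) atTop (𝓝 0)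

/-- `φ` solves the corrector equation `∇^*(a(∇φ + e_i)) = 0` in `ℤ^d`. -/
def SolvesCorrectorEq {d : ℕ} {lam : ℝ} (a : CoeffField d lam) (i : Fin d)
    (φ : Site d → ℝ) : Prop :=
  ∀ x, gradStar (mulField a fun z => grad φ z + EuclideanSpace.single i (1 : ℝ)) x = 0

/-- `φ` is a sublinear solution of the corrector equation, anchored by `φ(0) = 0`. -/
def IsSublinearCorrector {d : ℕ} {lam : ℝ} (a : CoeffField d lam) (i : Fin d)
    (φ : Site d → ℝ) : Prop :=
  SolvesCorrectorEq a i φ ∧ Sublinear φ ∧ φ 0 = 0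

open Classical in
/-- The corrector `φ_i(a, ·)`: the unique anchored sublinear solution of the corrector equation,
for every `a` for which there is exactly one (and `0` otherwise). -/
def corrector {d : ℕ} {lam : ℝ} (a : CoeffField d lam) (i : Fin d) : Site d → ℝ :=
  if h : ∃! φ : Site d → ℝ, IsSublinearCorrector a i φ then h.choose else 0

/-- `G z y = G(a; z, y)` is a Green's function of `∇^*(a∇)`: for every `y`, `G(a; ·, y)` solves
`∇^*(a∇G(a; ·, y)) = δ(· - y)`, is sublinear if `d = 2`, and bounded if `d > 2`. -/
def IsGreenFunction {d : ℕ} {lam : ℝ} (a : CoeffField d lam) (G : Site d → Site d → ℝ) : Prop :=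
  ∀ y, (∀ z, gradStar (mulField a (grad fun w => G w y)) z = if z = y then 1 else 0) ∧
    (d = 2 → Sublinear fun z => G z y) ∧
    (2 < d → ∃ M : ℝ, ∀ z, |G z y| ≤ M)

/-- The mixed second derivative `∇∇G(y, x)`, with entries `∇_{y,k} ∇_{x,j} G(y, x)`; its norm is
the Euclidean norm of all entries. -/
def mixedGrad {d : ℕ} (G : Site d → Site d → ℝ) (y x : Site d) :
    EuclideanSpace ℝ (Fin d × Fin d) :=
  WithLp.toLp 2 fun p =>
    (G (y + unit p.1) (x + unit p.2) - G y (x + unit p.2)) - (G (y + unit p.1) x - G y x)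

/-- The shift `τ_z a = a(· + z)`. -/
def shift {d : ℕ} {lam : ℝ} (z : Site d) (a : CoeffField d lam) : CoeffField d lam :=
  fun x => a (x + z)

/-- Stationarity: every shift preserves `P`. -/
def IsStationaryMeasure {d : ℕ} {lam : ℝ} (P : Measure (CoeffField d lam)) : Prop :=
  ∀ z : Site d, MeasurePreserving (shift (lam := lam) z) P P

/-- Ergodicity: every measurable shift invariant set has probability `0` or `1`. -/
def IsErgodicMeasure {d : ℕ} {lam : ℝ} (P : Measure (CoeffField d lam)) : Prop :=
  ∀ A : Set (CoeffField d lam), MeasurableSet A → (∀ z : Site d, shift z ⁻¹' A = A) →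
    P A = 0 ∨ P A = 1

/-- The space `𝓗` of random fields whose gradient is stationary, square integrable, and of mean
zero. -/
structure MemH {d : ℕ} {lam : ℝ} (P : Measure (CoeffField d lam))
    (u : CoeffField d lam → Site d → ℝ) : Prop where
  measurable : ∀ x, Measurable fun a => u a x
  stationary : ∀ᵐ a ∂P, ∀ x, grad (u a) x = grad (u (shift x a)) 0
  sq_integrable : MemLp (fun a => grad (u a) 0) 2 P
  mean_zero : ∫ a, grad (u a) 0 ∂P = 0

/-- `φ` is the corrector in direction `e_i` as a random field: `φ ∈ 𝓗`, almost surely it solves the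
corrector equation, and it is anchored by `φ(a, 0) = 0`. -/
def IsRandomCorrector {d : ℕ} {lam : ℝ} (P : Measure (CoeffField d lam)) (i : Fin d)
    (φ : CoeffField d lam → Site d → ℝ) : Prop :=
  MemH P φ ∧ ∀ᵐ a ∂P, SolvesCorrectorEq a i (φ a) ∧ φ a 0 = 0

/-- `a` and `b` agree on `ℤ^d ∖ {x}`. -/
def AgreeOff {d : ℕ} {lam : ℝ} (x : Site d) (a b : CoeffField d lam) : Prop :=
  ∀ z, z ≠ x → a z = b z

/-- The Lipschitz vertical derivative `|∂_{lip,x} f(a)|`: the supremum of `|f(a') - f(a'')|` over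
all `a', a'' ∈ Ω` that agree with `a` on `ℤ^d ∖ {x}`, as an extended nonnegative number. -/
def lipDeriv {d : ℕ} {lam : ℝ} {E : Type*} [NormedAddCommGroup E] (x : Site d)
    (f : CoeffField d lam → E) (a : CoeffField d lam) : ENNReal :=
  ⨆ (a' : CoeffField d lam) (a'' : CoeffField d lam) (_ : AgreeOff x a a') (_ : AgreeOff x a a''),
    ENNReal.ofReal ‖f a' - f a''‖

end

/-! ### Lattice geometry and Poincaré type estimates -/

/-! The sensitivity estimate is a one-site perturbation argument. If `a'` differs from `a` only at
`x`, then w = φ_i(a') - φ_i(a) solves ∇*(a'∇w) = ∇*F, with F supported at `x` and F(x) = (a -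
a')(x)(∇φ_i(a,x) + e_i). Testing with w itself bounds ∇w(x) by the gradient of the corrector plus
e_i. Written with the operator of `a`, the source becomes f = (a - a')(x)(∇φ_i(a,x) + e_i + ∇w(x)),
still at `x`, and the Green representation ∇w(y) = ∇∇G(y,x) f finishes the proof
(`LiouvilleProperty.norm_grad_perturbation_le`, `LiouvilleProperty.lipDeriv_le`).

Each identification of two solutions rests on one deterministic property of `a`: sublinear
`a`-harmonic functions are constant. It survives one-site changes (`LiouvilleProperty.of_agreeOff`),
since such a change only adds a function of finite energy, and these are sublinear. Green's
functions exist for every `a`, as limits of dipoles whose far pole goes to infinity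
(`exists_greenFunction`).

That almost every `a` has the Liouville property is shown by entropy. For the lazy walk among the
conductances `a`, the mutual information I_n between the first step and the position after n + 1
steps satisfies |u(e) - u(0)|² ≤ C I_n E|u(X_{n+1})|² for harmonic u. On average I_n is at most of
order 1/n along a sequence of times, because the entropy is at most d log n + C, and the mean square
displacement is at most of order n by reversibility and laziness. De Giorgi's local boundedness
upgrades sublinearity to |u(x)|² ≤ ε|x|² + B, so the product tends to 0.

The random corrector is an orthogonal projection in L²(P) (`exists_isRandomCorrector`). Its
sublinearity (`MemH.ae_sublinear`) follows from three facts: by ergodicity, stationary mean-zero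
gradients are L² limits of gradients of stationary fields; a maximal inequality controls the error
on all cubes at once; and a Poincaré inequality turns small gradient averages into slow growth. -/

theorem site_induction {d : ℕ} {p : Site d → Prop} (h0 : p 0)
    (hadd : ∀ x k, p x → p (x + unit k)) (hsub : ∀ x k, p x → p (x - unit k)) (x : Site d) :
    p x := by
  have key : ∀ (s : Finset (Fin d)) (x : Site d), (∀ k ∉ s, x k = 0) → p x := by
    intro s
    induction s using Finset.induction_on with
    | empty =>
      intro x hx
      have : x = 0 := funext fun k => hx k (by simp)
      rwa [this]
    | insert k s hk ih =>
      intro x hx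
      have hstep : ∀ m : ℤ, p (Function.update x k m) := by
        intro m
        induction m using Int.induction_on with
        | zero =>
          apply ih
          intro j hj
          by_cases hjk : j = k
          · subst hjk; simp
          · rw [Function.update_of_ne hjk]
            exact hx j (by simp [hjk, hj])
        | succ i hi =>
          convert hadd _ k hi using 1
          ext j
          by_cases hjk : j = k
          · subst hjk; simp [unit]
          · simp [unit, hjk]
        | pred i hi =>
          convert hsub _ k hi using 1
          ext j
          by_cases hjk : j = k
          · subst hjk; simp [unit]
          · simp [unit, hjk]
      simpa using hstep (x k)
  exact key Finset.univ x (by simp)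

theorem mem_latticeCube {d R : ℕ} {x : Site d} :
    x ∈ latticeCube d R ↔ ∀ k, |x k| ≤ (R : ℤ) := by
  simp [latticeCube, Fintype.mem_piFinset, abs_le]

theorem card_latticeCube (d R : ℕ) : (latticeCube d R).card = (2 * R + 1) ^ d := by
  simp [latticeCube, Fintype.card_piFinset]
  congr 1
  omega

theorem card_latticeCube_pos (d R : ℕ) : (0 : ℝ) < (latticeCube d R).card := by
  rw [card_latticeCube]; positivity

theorem card_latticeCube_mul_le (d m R : ℕ) :
    ((latticeCube d ((m + 1) * R)).card : ℝ) ≤ ((m : ℝ) + 1) ^ d * (latticeCube d R).card := by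
  rw [card_latticeCube, card_latticeCube]
  push_cast
  rw [← mul_pow]
  gcongr
  have : (0 : ℝ) ≤ m := by positivity
  nlinarith

theorem latticeCube_mono {d R S : ℕ} (h : R ≤ S) : latticeCube d R ⊆ latticeCube d S := by
  intro x hx
  rw [mem_latticeCube] at *
  intro k
  exact (hx k).trans (by exact_mod_cast h)

theorem add_mem_latticeCube {d R S : ℕ} {x y : Site d} (hx : x ∈ latticeCube d R)
    (hy : y ∈ latticeCube d S) : x + y ∈ latticeCube d (R + S) := by
  rw [mem_latticeCube] at *
  intro k
  push_cast
  exact (abs_add_le _ _).trans (add_le_add (hx k) (hy k))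

theorem neg_mem_latticeCube {d R : ℕ} {x : Site d} (hx : x ∈ latticeCube d R) :
    -x ∈ latticeCube d R := by
  rw [mem_latticeCube] at *
  intro k
  simpa using hx k

theorem exists_mem_latticeCube {d : ℕ} (x : Site d) : ∃ R, x ∈ latticeCube d R := by
  refine ⟨∑ k, (x k).natAbs, mem_latticeCube.2 fun k => ?_⟩
  rw [Int.abs_eq_natAbs]
  exact_mod_cast Finset.single_le_sum (f := fun k => (x k).natAbs) (by simp) (Finset.mem_univ k)

theorem grad_apply {d : ℕ} (u : Site d → ℝ) (x : Site d) (k : Fin d) :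
    grad u x k = u (x + unit k) - u x := rfl

theorem norm_grad_sq {d : ℕ} (u : Site d → ℝ) (x : Site d) :
    ‖grad u x‖ ^ 2 = ∑ k, (u (x + unit k) - u x) ^ 2 := by
  simp [EuclideanSpace.norm_sq_eq, grad_apply]

theorem sum_comp_le_sum {ι κ : Type*} {s : Finset ι} {t : Finset κ} {e : ι → κ}
    (he : Function.Injective e) (hst : ∀ i ∈ s, e i ∈ t) {f : κ → ℝ} (hf : ∀ x, 0 ≤ f x) :
    ∑ i ∈ s, f (e i) ≤ ∑ x ∈ t, f x := by
  refine (Finset.sum_map s ⟨e, he⟩ f).symm.le.trans ?_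
  apply Finset.sum_le_sum_of_subset_of_nonneg
  · intro y hy
    obtain ⟨x, hx, rfl⟩ := Finset.mem_map.1 hy
    exact hst x hx
  · intros; exact hf _

theorem sum_latticeCube_add_le {d R S : ℕ} {h : Site d} (hh : h ∈ latticeCube d S)
    {f : Site d → ℝ} (hf : ∀ x, 0 ≤ f x) :
    ∑ x ∈ latticeCube d R, f (x + h) ≤ ∑ x ∈ latticeCube d (R + S), f x := by
  exact sum_comp_le_sum (add_left_injective h) (fun x hx => add_mem_latticeCube hx hh) hf

theorem sq_sub_le_sum_Icc (f : ℤ → ℝ) (S : ℕ) (m : ℤ) (hm : |m| ≤ S) :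
    (f m - f 0) ^ 2 ≤ S * ∑ i ∈ Finset.Icc (-(S : ℤ)) S, (f (i + 1) - f i) ^ 2 := by
  have hnat : ∀ (g : ℤ → ℝ) (n : ℕ), (g n - g 0) ^ 2 ≤
      n * ∑ i ∈ Finset.range n, (g (i + 1) - g i) ^ 2 := by
    intro g n
    have h1 : g n - g 0 = ∑ i ∈ Finset.range n, (g (i + 1) - g i) := by
      have := Finset.sum_range_sub (fun i : ℕ => g i) n
      push_cast at this
      rw [this]
    rw [h1]
    have := sq_sum_le_card_mul_sum_sq (s := Finset.range n) (f := fun i : ℕ => g (i + 1) - g i)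
    simpa using this
  rcases le_total 0 m with h0 | h0
  · lift m to ℕ using h0
    have hmS : m ≤ S := by simpa using hm
    refine (hnat f m).trans ?_
    gcongr
    refine sum_comp_le_sum (e := fun i : ℕ => (i : ℤ)) Nat.cast_injective ?_
      (f := fun i : ℤ => (f (i + 1) - f i) ^ 2) (fun _ => by positivity)
    intro i hi
    simp at hi ⊢; omega
  -- For negative `m` the path is traversed upwards from `m` to 0.
  · obtain ⟨n, hn⟩ := Int.eq_ofNat_of_zero_le (a := -m) (by omega)
    obtain rfl : m = -(n : ℤ) := by omega
    have hmS : n ≤ S := by simpa using hm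
    have h2 := hnat (fun i => f (-(n : ℤ) + i)) n
    simp only [neg_add_cancel, add_zero] at h2
    have h3 : (f (-(n : ℤ)) - f 0) ^ 2 = (f 0 - f (-(n : ℤ))) ^ 2 := by ring
    rw [h3]
    refine h2.trans ?_
    gcongr
    simp_rw [← add_assoc]
    refine sum_comp_le_sum (e := fun i : ℕ => -(n : ℤ) + i) ?_ ?_
      (f := fun i : ℤ => (f (i + 1) - f i) ^ 2) (fun _ => by positivity)
    · intro i j hij
      simpa using hij
    · intro i hi
      simp at hi ⊢; omega

/-- Shifted differences are controlled by the gradient on an enlarged cube. -/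
theorem sum_sq_shift_sub_le {d : ℕ} (u : Site d → ℝ) (R S : ℕ) {h : Site d}
    (hh : h ∈ latticeCube d S) :
    ∑ x ∈ latticeCube d R, (u (x + h) - u x) ^ 2 ≤
      d * (S * (2 * S + 1)) * ∑ x ∈ latticeCube d (R + S), ‖grad u x‖ ^ 2 := by
  -- The path from 0 to `h` changes one coordinate at a time: `trunc n` keeps the first n
  -- coordinates of `h`. It never leaves the cube of size `S`.
  set trunc : ℕ → Site d := fun n j => if j.val < n then h j else 0 with htrunc
  have h0 : trunc 0 = 0 := by ext j; simp [htrunc]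
  have hd : trunc d = h := by ext j; simp [htrunc]
  have hsucc : ∀ k : Fin d, trunc (k + 1) = trunc k + h k • unit k := by
    intro k; ext j
    rcases lt_trichotomy j k with hjk | hjk | hjk
    · have h1 : j.val < k.val := hjk
      simp [htrunc, unit, hjk.ne, h1.le]
      omega
    · subst hjk; simp [htrunc, unit]
    · have h1 : k.val < j.val := hjk
      simp [htrunc, unit, hjk.ne']
      simp [hjk.not_ge, hjk.not_gt]
  have hmem : ∀ (k : Fin d) (i : ℤ), i ∈ Finset.Icc (-(S : ℤ)) S →
      trunc k + i • unit k ∈ latticeCube d S := by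
    intro k i hi
    rw [mem_latticeCube] at hh ⊢
    intro j
    rw [Finset.mem_Icc] at hi
    by_cases hjk : j = k
    · subst hjk; simp [htrunc, unit, abs_le]; exact hi
    · simp only [htrunc, unit, Pi.add_apply, Pi.smul_apply, Pi.single_apply, hjk, if_false,
        smul_zero, add_zero]
      split_ifs
      · exact hh j
      · simp
  have hpt : ∀ x, (u (x + h) - u x) ^ 2 ≤ d * ∑ k : Fin d, S *
      ∑ i ∈ Finset.Icc (-(S : ℤ)) S,
        (u (x + (trunc k + i • unit k) + unit k) - u (x + (trunc k + i • unit k))) ^ 2 := by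
    intro x
    have h1 : u (x + h) - u x = ∑ k : Fin d, (u (x + trunc (k + 1)) - u (x + trunc k)) := by
      have := Finset.sum_range_sub (fun n => u (x + trunc n)) d
      rw [h0, hd, add_zero] at this
      rw [← this, Finset.sum_range]
    rw [h1]
    have h2 := sq_sum_le_card_mul_sum_sq (s := Finset.univ)
      (f := fun k : Fin d => u (x + trunc (k + 1)) - u (x + trunc k))
    rw [Finset.card_univ, Fintype.card_fin] at h2
    refine h2.trans ?_
    gcongr with k
    have h3 := sq_sub_le_sum_Icc (fun i => u (x + (trunc k + i • unit k))) S (h k)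
      (mem_latticeCube.1 hh k)
    simp only [zero_smul, add_zero] at h3
    rw [hsucc k]
    refine h3.trans (le_of_eq ?_)
    congr 1
    refine Finset.sum_congr rfl fun i _ => ?_
    rw [add_smul, one_smul, ← add_assoc, ← add_assoc, ← add_assoc]
  calc ∑ x ∈ latticeCube d R, (u (x + h) - u x) ^ 2
      ≤ ∑ x ∈ latticeCube d R, (d * ∑ k : Fin d, S * ∑ i ∈ Finset.Icc (-(S : ℤ)) S,
        (u (x + (trunc k + i • unit k) + unit k) - u (x + (trunc k + i • unit k))) ^ 2) :=
        Finset.sum_le_sum fun x _ => hpt x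
    _ = d * ∑ k : Fin d, S * ∑ i ∈ Finset.Icc (-(S : ℤ)) S, ∑ x ∈ latticeCube d R,
        (u (x + (trunc k + i • unit k) + unit k) - u (x + (trunc k + i • unit k))) ^ 2 := by
        rw [← Finset.mul_sum, Finset.sum_comm]
        congr 1
        refine Finset.sum_congr rfl fun k _ => ?_
        rw [← Finset.mul_sum, Finset.sum_comm]
    _ ≤ d * ∑ k : Fin d, S * ∑ i ∈ Finset.Icc (-(S : ℤ)) S, ∑ x ∈ latticeCube d (R + S),
        (u (x + unit k) - u x) ^ 2 := by
        gcongr with k _ i hi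
        exact sum_latticeCube_add_le (f := fun x => (u (x + unit k) - u x) ^ 2) (hmem k i hi)
          (fun x => by positivity)
    _ = d * (S * (2 * S + 1)) * ∑ x ∈ latticeCube d (R + S), ‖grad u x‖ ^ 2 := by
        simp_rw [norm_grad_sq]
        rw [Finset.sum_comm]
        simp only [Finset.sum_const, Int.card_Icc, nsmul_eq_mul]
        rw [← Finset.mul_sum, ← Finset.mul_sum]
        have : (((S : ℤ) + 1 - -(S : ℤ)).toNat : ℝ) = 2 * S + 1 := by
          have : ((S : ℤ) + 1 - -(S : ℤ)).toNat = 2 * S + 1 := by omega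
          rw [this]; push_cast; ring
        rw [this]; ring

/-- Poincaré inequality on cubes, in the form of a double sum. -/
theorem sum_sum_sq_sub_le {d : ℕ} (u : Site d → ℝ) (R : ℕ) :
    ∑ x ∈ latticeCube d R, ∑ y ∈ latticeCube d R, (u y - u x) ^ 2 ≤
      2 ^ d * (10 * d) * (R : ℝ) ^ 2 * (latticeCube d R).card *
        ∑ x ∈ latticeCube d (3 * R), ‖grad u x‖ ^ 2 := by
  set E := ∑ x ∈ latticeCube d (3 * R), ‖grad u x‖ ^ 2
  have hE : 0 ≤ E := Finset.sum_nonneg fun _ _ => by positivity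
  -- Differences of points of the cube of size `R` lie in the cube of size 2R, so the sum over pairs
  -- becomes a sum over shifts.
  have h1 : ∀ x ∈ latticeCube d R, ∑ y ∈ latticeCube d R, (u y - u x) ^ 2 ≤
      ∑ h ∈ latticeCube d (2 * R), (u (x + h) - u x) ^ 2 := by
    intro x hx
    have := sum_comp_le_sum (s := latticeCube d R) (t := latticeCube d (2 * R))
      (e := fun y => y - x) (sub_left_injective) (f := fun h => (u (x + h) - u x) ^ 2) ?_
      (fun _ => by positivity)
    · simpa using this
    · intro y hy
      have := add_mem_latticeCube hy (neg_mem_latticeCube hx)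
      rwa [← two_mul, ← sub_eq_add_neg] at this
  have h2 : ∀ h ∈ latticeCube d (2 * R), ∑ x ∈ latticeCube d R, (u (x + h) - u x) ^ 2 ≤
      10 * d * (R : ℝ) ^ 2 * E := by
    intro h hh
    have := sum_sq_shift_sub_le u R (2 * R) hh
    rw [show R + 2 * R = 3 * R by ring] at this
    refine this.trans ?_
    gcongr ?_ * _
    rcases Nat.eq_zero_or_pos R with h0 | h0
    · subst h0; simp
    · have h1 : (1 : ℝ) ≤ R := by exact_mod_cast h0
      have hd0 : (0 : ℝ) ≤ d := by positivity
      push_cast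
      have : 2 * (R : ℝ) * (2 * (2 * R) + 1) ≤ 10 * (R : ℝ) ^ 2 := by nlinarith
      nlinarith
  calc _ ≤ ∑ x ∈ latticeCube d R, ∑ h ∈ latticeCube d (2 * R), (u (x + h) - u x) ^ 2 :=
        Finset.sum_le_sum h1
    _ = ∑ h ∈ latticeCube d (2 * R), ∑ x ∈ latticeCube d R, (u (x + h) - u x) ^ 2 :=
        Finset.sum_comm
    _ ≤ ∑ h ∈ latticeCube d (2 * R), 10 * d * (R : ℝ) ^ 2 * E := Finset.sum_le_sum h2
    _ = (latticeCube d (2 * R)).card * (10 * d * (R : ℝ) ^ 2 * E) := by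
        rw [Finset.sum_const, nsmul_eq_mul]
    _ ≤ (2 ^ d * (latticeCube d R).card) * (10 * d * (R : ℝ) ^ 2 * E) := by
        gcongr
        have := card_latticeCube_mul_le d 1 R
        norm_num at this
        exact this
    _ = _ := by ring

/-- Compare u(y) in the large cube with u(x) in the small one by u(y)² ≤ 2u(x)² + 2(u(y) - u(x))²
and Poincaré. The factor 2 is harmless: the normalisation R² gains a factor 4 from one dyadic scale
to the next, so the scaled average is halved up to an error of order δ. -/
theorem avg_sq_two_mul_le {d : ℕ} (u : Site d → ℝ) (R : ℕ) (δ : ℝ)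
    (h : ∑ x ∈ latticeCube d (6 * R), ‖grad u x‖ ^ 2 ≤ δ * (latticeCube d (6 * R)).card) 
    (hδ : 0 ≤ δ) :
    ((latticeCube d (2 * R)).card : ℝ)⁻¹ * ∑ x ∈ latticeCube d (2 * R), u x ^ 2 ≤
      2 * (((latticeCube d R).card : ℝ)⁻¹ * ∑ x ∈ latticeCube d R, u x ^ 2) +
        80 * d * 12 ^ d * R ^ 2 * δ := by
  have hN1 := card_latticeCube_pos d R
  have hN2 := card_latticeCube_pos d (2 * R)
  have hN6 : ((latticeCube d (6 * R)).card : ℝ) ≤ 6 ^ d * (latticeCube d R).card := by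
    have := card_latticeCube_mul_le d 5 R
    norm_num at this; exact this
  set N1 : ℝ := ((latticeCube d R).card : ℝ)
  set N2 : ℝ := ((latticeCube d (2 * R)).card : ℝ)
  set A1 := ∑ x ∈ latticeCube d R, u x ^ 2
  set A2 := ∑ x ∈ latticeCube d (2 * R), u x ^ 2
  have h1 := sum_sum_sq_sub_le u (2 * R)
  rw [show 3 * (2 * R) = 6 * R by ring] at h1
  have h2 : ∑ x ∈ latticeCube d R, ∑ y ∈ latticeCube d (2 * R), (u y - u x) ^ 2 ≤
      2 ^ d * (10 * d) * ((2 * R : ℕ) : ℝ) ^ 2 * N2 * (δ * (6 ^ d * N1)) := by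
    refine (Finset.sum_le_sum_of_subset_of_nonneg (latticeCube_mono (by omega)) ?_).trans
      (h1.trans ?_)
    · intros; exact Finset.sum_nonneg fun _ _ => by positivity
    · gcongr
      exact h.trans (by gcongr)
  have h3 : N1 * A2 ≤ 2 * N2 * A1 + 2 * (2 ^ d * (10 * d) * ((2 * R : ℕ) : ℝ) ^ 2 * N2 *
      (δ * (6 ^ d * N1))) := by
    calc N1 * A2 = ∑ x ∈ latticeCube d R, ∑ y ∈ latticeCube d (2 * R), u y ^ 2 := by
          rw [Finset.sum_const, nsmul_eq_mul]
      _ ≤ ∑ x ∈ latticeCube d R, ∑ y ∈ latticeCube d (2 * R),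
          (2 * u x ^ 2 + 2 * (u y - u x) ^ 2) := by
          gcongr with x _ y _
          nlinarith [sq_nonneg (2 * u x - u y)]
      _ = 2 * N2 * A1 + 2 * ∑ x ∈ latticeCube d R, ∑ y ∈ latticeCube d (2 * R),
          (u y - u x) ^ 2 := by
          simp_rw [Finset.sum_add_distrib, Finset.sum_const, nsmul_eq_mul, ← Finset.mul_sum]
          ring
      _ ≤ _ := by gcongr
  have h4 : N2⁻¹ * A2 = (N1 * N2)⁻¹ * (N1 * A2) := by field_simp
  rw [h4]
  calc (N1 * N2)⁻¹ * (N1 * A2) ≤ (N1 * N2)⁻¹ * (2 * N2 * A1 +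
        2 * (2 ^ d * (10 * d) * ((2 * R : ℕ) : ℝ) ^ 2 * N2 * (δ * (6 ^ d * N1)))) := by gcongr
    _ = _ := by
      rw [show (12 : ℝ) ^ d = 2 ^ d * 6 ^ d by rw [← mul_pow]; norm_num]
      push_cast
      field_simp
      ring

/-- Iterating the contraction over dyadic scales forgets the initial value, so no mean has to be
subtracted. That `C` depends on neither `u` nor δ is essential later, where `u` is random and δ a
small parameter. -/
theorem exists_avg_sq_le (d : ℕ) : ∃ C : ℝ, 0 < C ∧ ∀ (u : Site d → ℝ) (δ : ℝ), 0 < δ →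
    (∀ᶠ R : ℕ in atTop, ∑ x ∈ latticeCube d R, ‖grad u x‖ ^ 2 ≤ δ * (latticeCube d R).card) →
    ∀ᶠ R : ℕ in atTop, ((R : ℝ) ^ 2)⁻¹ *
      (((latticeCube d R).card : ℝ)⁻¹ * ∑ x ∈ latticeCube d R, u x ^ 2) ≤ C * δ := by
  set K : ℝ := 80 * d * 12 ^ d + 1 with hK
  have hKpos : 0 < K := by positivity
  -- Rounding R up to a power of two costs 2^d in volume and 4 in the square of the size.
  refine ⟨2 ^ d * 4 * K, by positivity, fun u δ hδ hev => ?_⟩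
  obtain ⟨R0, hR0⟩ := eventually_atTop.1 hev
  set T : ℕ → ℝ := fun R => ((latticeCube d R).card : ℝ)⁻¹ * ∑ x ∈ latticeCube d R, u x ^ 2
    with hT
  have hTnn : ∀ R, 0 ≤ T R := fun R => mul_nonneg (inv_nonneg.2 (card_latticeCube_pos d R).le)
    (Finset.sum_nonneg fun _ _ => by positivity)
  set t : ℕ → ℝ := fun j => T (2 ^ j) / 4 ^ j with ht
  have hstep : ∀ j, R0 ≤ j → t (j + 1) ≤ t j / 2 + K / 4 * δ := by
    intro j hj
    have hj2 : R0 ≤ 6 * 2 ^ j := hj.trans (Nat.lt_two_pow_self.le.trans (by omega))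
    have h1 := avg_sq_two_mul_le u (2 ^ j) δ (hR0 _ hj2) hδ.le
    rw [show 2 * 2 ^ j = 2 ^ (j + 1) by ring] at h1
    have h2 : T (2 ^ (j + 1)) ≤ 2 * T (2 ^ j) + K * 4 ^ j * δ := by
      refine h1.trans ?_
      push_cast
      rw [← pow_mul, mul_comm j 2, pow_mul]
      norm_num
      gcongr
      linarith
    simp only [ht]
    rw [div_le_iff₀ (by positivity)]
    refine h2.trans (le_of_eq ?_)
    field_simp
    ring
  have hbound : ∀ i, t (R0 + i) ≤ K / 2 * δ + t R0 * (1 / 2) ^ i := by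
    intro i
    induction i with
    | zero => simp; positivity
    | succ i ih =>
      have := hstep (R0 + i) (by omega)
      rw [← add_assoc, pow_succ]
      linarith
  have hlim : ∀ᶠ i : ℕ in atTop, t R0 * (1 / 2) ^ i < K / 2 * δ := by
    have : Tendsto (fun i : ℕ => t R0 * (1 / 2 : ℝ) ^ i) atTop (𝓝 (t R0 * 0)) :=
      (tendsto_pow_atTop_nhds_zero_of_lt_one (by norm_num) (by norm_num)).const_mul _
    rw [mul_zero] at this
    exact this.eventually_lt_const (by positivity)
  obtain ⟨i0, hi0⟩ := eventually_atTop.1 hlim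
  have hdy : ∀ j, R0 + i0 ≤ j → t j ≤ K * δ := by
    intro j hj
    obtain ⟨i, rfl⟩ := Nat.exists_eq_add_of_le (show R0 ≤ j by omega)
    have := hbound i
    have := hi0 i (by omega)
    linarith
  filter_upwards [eventually_ge_atTop (2 ^ (R0 + i0) + 2)] with R hR
  have hR2 : 2 ≤ R := le_of_add_le_right hR
  set j := Nat.clog 2 R
  have hj1 : R ≤ 2 ^ j := Nat.le_pow_clog (by norm_num) R
  have hj2 : 2 ^ j ≤ 2 * R := by
    have h1 : 2 ^ (j - 1) < R := Nat.pow_pred_clog_lt_self (by norm_num) hR2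
    have h2 : 0 < j := Nat.clog_pos (by norm_num) hR2
    have : 2 ^ j = 2 * 2 ^ (j - 1) := by rw [← pow_succ', Nat.sub_add_cancel h2]
    omega
  have hj3 : R0 + i0 ≤ j := by
    by_contra hcon
    have : 2 ^ j ≤ 2 ^ (R0 + i0) := Nat.pow_le_pow_right (by norm_num) (by omega)
    omega
  have h5 := hdy j hj3
  have hRpos : (0 : ℝ) < R := by exact_mod_cast (zero_lt_two.trans_le hR2)
  have h6 : T R ≤ 2 ^ d * T (2 ^ j) := by
    have hN : ((latticeCube d (2 ^ j)).card : ℝ) ≤ 2 ^ d * (latticeCube d R).card := by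
      have := card_latticeCube_mul_le d 1 R
      norm_num at this
      refine le_trans ?_ this
      exact_mod_cast Finset.card_le_card (latticeCube_mono hj2)
    have hN1 := card_latticeCube_pos d R
    have hN2 := card_latticeCube_pos d (2 ^ j)
    simp only [hT]
    rw [← mul_assoc]
    gcongr ?_ * ?_
    · rw [inv_le_iff_one_le_mul₀ hN1]
      rw [mul_right_comm, ← div_eq_mul_inv, le_div_iff₀ hN2]
      linarith
    · exact Finset.sum_le_sum_of_subset_of_nonneg (latticeCube_mono hj1)
        fun _ _ _ => by positivity
  have h7 : T (2 ^ j) ≤ K * δ * (4 * (R : ℝ) ^ 2) := by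
    simp only [ht] at h5
    rw [div_le_iff₀ (by positivity)] at h5
    refine h5.trans ?_
    gcongr
    have : ((2 : ℝ) ^ j) ≤ 2 * R := by exact_mod_cast hj2
    calc (4 : ℝ) ^ j = (2 ^ j) ^ 2 := by rw [← pow_mul, mul_comm, pow_mul]; norm_num
      _ ≤ (2 * R) ^ 2 := by gcongr
      _ = _ := by ring
  change ((R : ℝ) ^ 2)⁻¹ * T R ≤ _
  rw [inv_mul_le_iff₀ (by positivity)]
  calc T R ≤ 2 ^ d * (K * δ * (4 * (R : ℝ) ^ 2)) := h6.trans (by gcongr)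
    _ = _ := by ring

theorem sublinear_of_gradient_avg {d : ℕ} {u : Site d → ℝ}
    (h : ∀ δ : ℝ, 0 < δ → ∀ᶠ R : ℕ in atTop,
      ∑ x ∈ latticeCube d R, ‖grad u x‖ ^ 2 ≤ δ * (latticeCube d R).card) : Sublinear u := by
  obtain ⟨C, hC, hmain⟩ := exists_avg_sq_le d
  refine (tendsto_order.2 ⟨fun a ha => Eventually.of_forall fun R => ?_, fun a ha => ?_⟩)
  · refine ha.trans_le (mul_nonneg (by positivity) (mul_nonneg (by positivity) ?_))
    exact Finset.sum_nonneg fun _ _ => by positivity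
  · filter_upwards [hmain u (a / (2 * C)) (by positivity) (h _ (by positivity))] with R hR
    refine hR.trans_lt ?_
    field_simp
    linarith

theorem tendsto_card_latticeCube {d : ℕ} (hd : 0 < d) :
    Tendsto (fun R => ((latticeCube d R).card : ℝ)) atTop atTop := by
  refine tendsto_atTop_mono (fun R => ?_) tendsto_natCast_atTop_atTop
  rw [card_latticeCube]
  have : R ≤ (2 * R + 1) ^ d :=
    (show R ≤ 2 * R + 1 by omega).trans (Nat.le_self_pow hd.ne' _)
  exact_mod_cast this

theorem sublinear_of_energy_le {d : ℕ} (hd : 0 < d) {u : Site d → ℝ} {E : ℝ}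
    (h : ∀ R : ℕ, ∑ x ∈ latticeCube d R, ‖grad u x‖ ^ 2 ≤ E) : Sublinear u := by
  refine sublinear_of_gradient_avg fun δ hδ => ?_
  filter_upwards [(tendsto_card_latticeCube hd).eventually_ge_atTop (E / δ)] with R hR
  refine (h R).trans ?_
  rw [div_le_iff₀ hδ] at hR
  linarith

/-! ### Pointwise bounds for functions of finite energy -/

theorem sq_avg_sub_avg_le {α β : Type*} {s : Finset α} {t : Finset β} (hs : s.Nonempty)
    (ht : t.Nonempty) (f : α → ℝ) (g : β → ℝ) :
    ((s.card : ℝ)⁻¹ * ∑ x ∈ s, f x - (t.card : ℝ)⁻¹ * ∑ y ∈ t, g y) ^ 2 ≤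
      ((s.card : ℝ) * t.card)⁻¹ * ∑ x ∈ s, ∑ y ∈ t, (g y - f x) ^ 2 := by
  have hs' : (0 : ℝ) < s.card := by exact_mod_cast hs.card_pos
  have ht' : (0 : ℝ) < t.card := by exact_mod_cast ht.card_pos
  have h1 : (s.card : ℝ)⁻¹ * ∑ x ∈ s, f x - (t.card : ℝ)⁻¹ * ∑ y ∈ t, g y =
      -(((s.card : ℝ) * t.card)⁻¹ * ∑ p ∈ s ×ˢ t, (g p.2 - f p.1)) := by
    rw [Finset.sum_product]
    simp only [Finset.sum_sub_distrib, Finset.sum_const, nsmul_eq_mul, ← Finset.mul_sum]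
    field_simp
    ring
  rw [h1, neg_sq, mul_pow, ← Finset.sum_product' s t fun x y => (g y - f x) ^ 2]
  have h2 := sq_sum_le_card_mul_sum_sq (s := s ×ˢ t) (f := fun p => g p.2 - f p.1)
  rw [Finset.card_product] at h2
  push_cast at h2
  calc _ ≤ (((s.card : ℝ) * t.card)⁻¹) ^ 2 * ((s.card * t.card : ℝ) *
        ∑ p ∈ s ×ˢ t, (g p.2 - f p.1) ^ 2) := by gcongr
    _ = _ := by field_simp

theorem pow_le_card_latticeCube (d R : ℕ) : (R : ℝ) ^ d ≤ (latticeCube d R).card := by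
  rw [card_latticeCube]
  push_cast
  gcongr
  have : (0 : ℝ) ≤ R := by positivity
  linarith

theorem latticeCube_nonempty (d R : ℕ) : (latticeCube d R).Nonempty :=
  Finset.card_pos.1 (by exact_mod_cast card_latticeCube_pos d R)

theorem latticeCube_zero (d : ℕ) : latticeCube d 0 = {0} := by
  ext x
  rw [mem_latticeCube]
  simp [funext_iff]

/-- The average over the cube of size `R`. -/
noncomputable def cubeAvg {d : ℕ} (R : ℕ) (u : Site d → ℝ) : ℝ :=
  ((latticeCube d R).card : ℝ)⁻¹ * ∑ x ∈ latticeCube d R, u x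

theorem sq_cubeAvg_sub_le {d : ℕ} {u : Site d → ℝ} {E : ℝ} {R S : ℕ} (hRS : R ≤ S)
    (hu : ∀ R : ℕ, ∑ x ∈ latticeCube d R, ‖grad u x‖ ^ 2 ≤ E) :
    (cubeAvg R u - cubeAvg S u) ^ 2 ≤
      ((latticeCube d R).card : ℝ)⁻¹ * (2 ^ d * (10 * d) * (S : ℝ) ^ 2 * E) := by
  have hN1 := card_latticeCube_pos d R
  have hN2 := card_latticeCube_pos d S
  refine (sq_avg_sub_avg_le (latticeCube_nonempty d R) (latticeCube_nonempty d S) u u).trans ?_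
  rw [mul_inv, mul_assoc]
  refine mul_le_mul_of_nonneg_left ?_ (by positivity)
  rw [inv_mul_le_iff₀ hN2]
  have h1 : ∑ x ∈ latticeCube d R, ∑ y ∈ latticeCube d S, (u y - u x) ^ 2 ≤
      ∑ x ∈ latticeCube d S, ∑ y ∈ latticeCube d S, (u y - u x) ^ 2 :=
    Finset.sum_le_sum_of_subset_of_nonneg (latticeCube_mono hRS)
      fun _ _ _ => Finset.sum_nonneg fun _ _ => by positivity
  refine h1.trans ((sum_sum_sq_sub_le u S).trans ?_)
  calc _ ≤ 2 ^ d * (10 * d) * (S : ℝ) ^ 2 * (latticeCube d S).card * E := by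
        gcongr; exact hu _
    _ = _ := by ring

theorem sq_cubeAvg_shift_sub_le {d : ℕ} {u : Site d → ℝ} {E : ℝ} {R : ℕ} {z : Site d}
    (hz : z ∈ latticeCube d R) (hu : ∀ R : ℕ, ∑ x ∈ latticeCube d R, ‖grad u x‖ ^ 2 ≤ E) :
    (cubeAvg R (fun x => u (x + z)) - cubeAvg R u) ^ 2 ≤
      ((latticeCube d R).card : ℝ)⁻¹ * (d * (R * (2 * R + 1)) * E) := by
  have hN := card_latticeCube_pos d R
  have h1 : cubeAvg R (fun x => u (x + z)) - cubeAvg R u =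
      ((latticeCube d R).card : ℝ)⁻¹ * ∑ x ∈ latticeCube d R, (u (x + z) - u x) := by
    simp only [cubeAvg, Finset.sum_sub_distrib, mul_sub]
  rw [h1, mul_pow]
  have h2 := sq_sum_le_card_mul_sum_sq (s := latticeCube d R) (f := fun x => u (x + z) - u x)
  calc _ ≤ (((latticeCube d R).card : ℝ)⁻¹) ^ 2 * ((latticeCube d R).card *
        (d * (R * (2 * R + 1)) * E)) := by
        gcongr
        refine h2.trans ?_
        gcongr
        refine (sum_sq_shift_sub_le u R R hz).trans ?_
        gcongr
        exact hu _
    _ = _ := by field_simp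

theorem grad_shift {d : ℕ} (u : Site d → ℝ) (z x : Site d) :
    grad (fun y => u (y + z)) x = grad u (x + z) := by
  ext k
  simp only [grad_apply]
  rw [add_right_comm]

theorem energy_shift_le {d : ℕ} {u : Site d → ℝ} {E : ℝ}
    (hu : ∀ R : ℕ, ∑ x ∈ latticeCube d R, ‖grad u x‖ ^ 2 ≤ E) (z : Site d) (R : ℕ) :
    ∑ x ∈ latticeCube d R, ‖grad (fun y => u (y + z)) x‖ ^ 2 ≤ E := by
  obtain ⟨S, hS⟩ := exists_mem_latticeCube z
  simp_rw [grad_shift]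
  exact (sum_latticeCube_add_le hS (f := fun x => ‖grad u x‖ ^ 2)
    (fun _ => by positivity)).trans (hu _)

/-- A growth rate for functions of finite energy on `ℤ^d` with `d ≥ 2`, along dyadic cubes. -/
noncomputable def energyGrowth (d j : ℕ) : ℝ := if d = 2 then (j : ℝ) + 1 else 1

/-- Averages over consecutive dyadic cubes differ, by Poincaré, by at most a constant times √E
2^{i(2-d)/2}. In d = 2 every scale costs the same, whence linear growth in j; for d > 2 the costs
are summable. -/
theorem exists_sq_sub_le_energy {d : ℕ} (hd : 2 ≤ d) : ∃ C : ℝ, 0 < C ∧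
    ∀ (u : Site d → ℝ) (E : ℝ), (∀ R : ℕ, ∑ x ∈ latticeCube d R, ‖grad u x‖ ^ 2 ≤ E) →
    ∀ (j : ℕ) (z : Site d), z ∈ latticeCube d (2 ^ j) →
      (u z - u 0) ^ 2 ≤ C * E * energyGrowth d j ^ 2 := by
  set K : ℝ := 2 ^ d * (40 * d) with hK
  have hKpos : 0 < K := by
    have : 0 < d := by omega
    positivity
  -- 121 = 11², where 11 bounds 3 + 2∑θ^i relative to the growth rate: one telescoping sum around 0,
  -- one around z, and one shift between the two cubes.
  refine ⟨K * 121, by positivity, ?_⟩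
  -- θ^i bounds the cost of scale 2^i; for d > 2 the decay 2^{-i/2} of the case d = 3 suffices.
  set θ : ℝ := if d = 2 then 1 else (Real.sqrt 2)⁻¹ with hθ
  have hθ0 : 0 ≤ θ := by rw [hθ]; split_ifs <;> positivity
  have hθsq : ∀ i : ℕ, (((2 ^ i : ℕ) : ℝ) ^ 2) / ((2 ^ i : ℕ) : ℝ) ^ d ≤ (θ ^ i) ^ 2 := by
    intro i
    rw [hθ]
    push_cast
    split_ifs with h
    · subst h; rw [div_self (by positivity)]; simp
    · rw [← pow_mul (Real.sqrt 2)⁻¹, mul_comm i 2, pow_mul (Real.sqrt 2)⁻¹, inv_pow (Real.sqrt 2),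
        Real.sq_sqrt (by norm_num), div_le_iff₀ (by positivity), inv_pow]
      have h3 : 3 ≤ d := by omega
      calc ((2 : ℝ) ^ i) ^ 2 = (2 ^ i)⁻¹ * (2 ^ i) ^ 3 := by field_simp
        _ ≤ _ := by gcongr; exact one_le_pow₀ (by norm_num)
  have hsum : ∀ j : ℕ, 3 + 2 * ∑ i ∈ Finset.range j, θ ^ i ≤ 11 * energyGrowth d j := by
    intro j
    rw [hθ, energyGrowth]
    split_ifs with h
    · simp; linarith
    · have h2 : Real.sqrt 2 * Real.sqrt 2 = 2 := Real.mul_self_sqrt (by norm_num)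
      have h3 : (4 / 3 : ℝ) ≤ Real.sqrt 2 := by
        apply Real.le_sqrt_of_sq_le; norm_num
      have h4 : (Real.sqrt 2)⁻¹ ≤ 3 / 4 := by
        rw [inv_le_comm₀ (by positivity) (by norm_num)]; norm_num; linarith
      have h5 : ∑ i ∈ Finset.range j, ((Real.sqrt 2)⁻¹) ^ i ≤ ∑ i ∈ Finset.range j, (3 / 4 : ℝ) ^ i := by
        gcongr
      have h6 : ∑ i ∈ Finset.range j, (3 / 4 : ℝ) ^ i ≤ 4 := by
        rw [geom_sum_eq (by norm_num)]
        have : (0 : ℝ) ≤ (3 / 4) ^ j := by positivity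
        rw [div_le_iff_of_neg (by norm_num)]
        linarith
      linarith
  intro u E hu j z hz
  have hE : 0 ≤ E := (Finset.sum_nonneg fun _ _ => by positivity).trans (hu 0)
  set M := Real.sqrt (K * E)
  have hMsq : M ^ 2 = K * E := Real.sq_sqrt (by positivity)
  have hM0 : 0 ≤ M := Real.sqrt_nonneg _
  have hone : ∀ v : Site d → ℝ, (∀ R : ℕ, ∑ x ∈ latticeCube d R, ‖grad v x‖ ^ 2 ≤ E) →
      ∀ j, |v 0 - cubeAvg (2 ^ j) v| ≤ M * (1 + ∑ i ∈ Finset.range j, θ ^ i) := by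
    intro v hv j
    induction j with
    | zero =>
      have h1 := sq_cubeAvg_sub_le (zero_le_one) hv
      have h0 : cubeAvg 0 v = v 0 := by simp [cubeAvg, latticeCube_zero]
      rw [h0] at h1
      simp only [pow_zero, Finset.range_zero, Finset.sum_empty, add_zero, mul_one]
      apply abs_le_of_sq_le_sq _ hM0
      rw [hMsq]
      refine h1.trans ?_
      simp only [latticeCube_zero, Finset.card_singleton, Nat.cast_one, inv_one, one_mul, one_pow,
        mul_one]
      gcongr ?_ * E
      rw [hK]; gcongr; norm_num
    | succ i ih =>
      have h1 := sq_cubeAvg_sub_le (R := 2 ^ i) (S := 2 ^ (i + 1))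
        (Nat.pow_le_pow_right (by norm_num) (by omega)) hv
      have h2 : |cubeAvg (2 ^ i) v - cubeAvg (2 ^ (i + 1)) v| ≤ M * θ ^ i := by
        apply abs_le_of_sq_le_sq _ (by positivity)
        rw [mul_pow, hMsq]
        refine h1.trans ?_
        have h3 : ((latticeCube d (2 ^ i)).card : ℝ)⁻¹ ≤ (((2 ^ i : ℕ) : ℝ) ^ d)⁻¹ := by
          gcongr; exact pow_le_card_latticeCube d _
        calc _ ≤ (((2 ^ i : ℕ) : ℝ) ^ d)⁻¹ * (2 ^ d * (10 * d) * ((2 ^ (i + 1) : ℕ) : ℝ) ^ 2 * E) := by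
              gcongr
          _ = K * E * ((((2 ^ i : ℕ) : ℝ) ^ 2) / ((2 ^ i : ℕ) : ℝ) ^ d) := by
              rw [hK]; push_cast; ring
          _ ≤ _ := by gcongr; exact hθsq i
      rw [Finset.sum_range_succ, show v 0 - cubeAvg (2 ^ (i + 1)) v = (v 0 - cubeAvg (2 ^ i) v) +
        (cubeAvg (2 ^ i) v - cubeAvg (2 ^ (i + 1)) v) by ring]
      refine (abs_add_le _ _).trans ?_
      linarith
  have h1 := hone u hu j
  have h2 := hone (fun x => u (x + z)) (energy_shift_le hu z) j
  simp only [zero_add] at h2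
  have h3 : |cubeAvg (2 ^ j) (fun x => u (x + z)) - cubeAvg (2 ^ j) u| ≤ M := by
    apply abs_le_of_sq_le_sq _ hM0
    rw [hMsq]
    refine (sq_cubeAvg_shift_sub_le hz hu).trans ?_
    have h4 : (((2 ^ j : ℕ) : ℝ)) ^ 2 ≤ (latticeCube d (2 ^ j)).card := by
      refine le_trans ?_ (pow_le_card_latticeCube d _)
      gcongr
      exact_mod_cast Nat.one_le_two_pow
    rw [inv_mul_le_iff₀ (card_latticeCube_pos d _)]
    have h5 : (1 : ℝ) ≤ ((2 ^ j : ℕ) : ℝ) := by exact_mod_cast Nat.one_le_two_pow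
    set r : ℝ := ((2 ^ j : ℕ) : ℝ)
    have h6 : r * (2 * r + 1) ≤ 40 * r ^ 2 := by nlinarith
    calc d * (r * (2 * r + 1)) * E ≤ d * (40 * r ^ 2) * E := by gcongr
      _ = r ^ 2 * (1 * (40 * d) * E) := by ring
      _ ≤ (latticeCube d (2 ^ j)).card * (2 ^ d * (40 * d) * E) := by
          gcongr
          exact one_le_pow₀ (by norm_num)
      _ = _ := by rw [hK]
  have h4 : |u z - u 0| ≤ M * (11 * energyGrowth d j) := by
    have e : u z - u 0 = (u z - cubeAvg (2 ^ j) (fun x => u (x + z))) +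
      (cubeAvg (2 ^ j) (fun x => u (x + z)) - cubeAvg (2 ^ j) u) + -(u 0 - cubeAvg (2 ^ j) u) := by
      ring
    rw [e]
    refine (abs_add_three _ _ _).trans ?_
    rw [abs_neg]
    calc _ ≤ M * (3 + 2 * ∑ i ∈ Finset.range j, θ ^ i) := by linarith
      _ ≤ _ := by gcongr; exact hsum j
  calc (u z - u 0) ^ 2 = |u z - u 0| ^ 2 := (sq_abs _).symm
    _ ≤ (M * (11 * energyGrowth d j)) ^ 2 := by gcongr
    _ = K * 121 * E * energyGrowth d j ^ 2 := by rw [mul_pow, hMsq]; ring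

/-! ### The Dirichlet space -/

/-- Convergence of the increments over edges propagates along lattice paths from the origin. Hence
pointwise limits of gradients are gradients, and no discrete Poincaré lemma for curl-free fields is
required. -/
theorem exists_potential_of_tendsto {d : ℕ} {ι : Type*} {l : Filter ι} {u : ι → Site d → ℝ}
    {g : Site d → Fin d → ℝ}
    (h : ∀ x k, Tendsto (fun n => u n (x + unit k) - u n x) l (𝓝 (g x k))) (x : Site d) :
    ∃ c, Tendsto (fun n => u n x - u n 0) l (𝓝 c) := by
  induction x using site_induction with
  | h0 => exact ⟨0, by simpa using tendsto_const_nhds⟩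
  | hadd x k hx =>
    obtain ⟨c, hc⟩ := hx
    refine ⟨c + g x k, (hc.add (h x k)).congr fun n => by ring⟩
  | hsub x k hx =>
    obtain ⟨c, hc⟩ := hx
    refine ⟨c - g (x - unit k) k, (hc.sub (h (x - unit k) k)).congr fun n => ?_⟩
    rw [sub_add_cancel]; ring

theorem exists_grad_eq_of_tendsto {d : ℕ} {l : Filter ℕ} [l.NeBot] {u : ℕ → Site d → ℝ}
    {g : Site d → EuclideanSpace ℝ (Fin d)}
    (h : ∀ x, Tendsto (fun n => grad (u n) x) l (𝓝 (g x))) : ∃ U : Site d → ℝ, grad U = g := by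
  have h' : ∀ x k, Tendsto (fun n => u n (x + unit k) - u n x) l (𝓝 (g x k)) := fun x k =>
    (((EuclideanSpace.proj (𝕜 := ℝ) k).continuous.tendsto (g x)).comp (h x))
  choose U hU using exists_potential_of_tendsto h'
  refine ⟨U, ?_⟩
  ext x k
  refine tendsto_nhds_unique ?_ (h' x k)
  rw [grad_apply]
  exact ((hU (x + unit k)).sub (hU x)).congr fun n => by ring

theorem grad_add {d : ℕ} (u v : Site d → ℝ) : grad (u + v) = grad u + grad v := by
  ext x k; simp [grad_apply]; ring

theorem grad_sub {d : ℕ} (u v : Site d → ℝ) : grad (u - v) = grad u - grad v := by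
  ext x k; simp [grad_apply]; ring

theorem grad_smul {d : ℕ} (c : ℝ) (u : Site d → ℝ) : grad (c • u) = c • grad u := by
  ext x k; simp [grad_apply]; ring

theorem grad_zero {d : ℕ} : grad (0 : Site d → ℝ) = 0 := by
  ext x k; simp [grad_apply]

theorem grad_sum {d : ℕ} {ι : Type*} (s : Finset ι) (u : ι → Site d → ℝ) :
    grad (∑ i ∈ s, u i) = ∑ i ∈ s, grad (u i) := by
  ext x k
  rw [grad_apply]
  simp [Finset.sum_apply, grad_apply]

theorem mulField_add {d : ℕ} {lam : ℝ} (a : CoeffField d lam)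
    (F G : Site d → EuclideanSpace ℝ (Fin d)) : mulField a (F + G) = mulField a F + mulField a G := by
  ext x k; simp [mulField]; ring

theorem mulField_sub {d : ℕ} {lam : ℝ} (a : CoeffField d lam)
    (F G : Site d → EuclideanSpace ℝ (Fin d)) : mulField a (F - G) = mulField a F - mulField a G := by
  ext x k; simp [mulField]; ring

theorem mulField_smul {d : ℕ} {lam : ℝ} (a : CoeffField d lam) (c : ℝ)
    (F : Site d → EuclideanSpace ℝ (Fin d)) : mulField a (c • F) = c • mulField a F := by
  ext x k; simp [mulField]; ring

theorem gradStar_add {d : ℕ} (F G : Site d → EuclideanSpace ℝ (Fin d)) :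
    gradStar (F + G) = gradStar F + gradStar G := by
  ext x; simp only [gradStar, Pi.add_apply, PiLp.add_apply, ← Finset.sum_add_distrib]
  exact Finset.sum_congr rfl fun k _ => by ring

theorem gradStar_sub {d : ℕ} (F G : Site d → EuclideanSpace ℝ (Fin d)) :
    gradStar (F - G) = gradStar F - gradStar G := by
  ext x; simp only [gradStar, Pi.sub_apply, PiLp.sub_apply, ← Finset.sum_sub_distrib]
  exact Finset.sum_congr rfl fun k _ => by ring

/-! ### Functions of finite energy and the energy form. -/

theorem coeff_pos {d : ℕ} {lam : ℝ} (hlam : 0 < lam) (a : CoeffField d lam) (x : Site d)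
    (k : Fin d) : 0 < (a x k : ℝ) := hlam.trans (a x k).2.1

/-- Functions of finite Dirichlet energy. -/
def FiniteEnergy {d : ℕ} (u : Site d → ℝ) : Prop := Memℓp (grad u) 2

/-- The energy form `∑ a∇u·∇v`. -/
noncomputable def energyForm {d : ℕ} {lam : ℝ} (a : CoeffField d lam) (u v : Site d → ℝ) : ℝ :=
  ∑' x, inner ℝ (mulField a (grad u) x) (grad v x)

theorem FiniteEnergy.add {d : ℕ} {u v : Site d → ℝ} (hu : FiniteEnergy u) (hv : FiniteEnergy v) :
    FiniteEnergy (u + v) := by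
  unfold FiniteEnergy; rw [grad_add]; exact Memℓp.add hu hv

theorem FiniteEnergy.sub {d : ℕ} {u v : Site d → ℝ} (hu : FiniteEnergy u) (hv : FiniteEnergy v) :
    FiniteEnergy (u - v) := by
  unfold FiniteEnergy; rw [grad_sub]; exact Memℓp.sub hu hv

theorem FiniteEnergy.smul {d : ℕ} {u : Site d → ℝ} (c : ℝ) (hu : FiniteEnergy u) :
    FiniteEnergy (c • u) := by
  unfold FiniteEnergy; rw [grad_smul]; exact Memℓp.const_smul hu c

theorem FiniteEnergy.zero {d : ℕ} : FiniteEnergy (0 : Site d → ℝ) := by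
  unfold FiniteEnergy; rw [grad_zero]; exact zero_memℓp

theorem FiniteEnergy.sum {d : ℕ} {ι : Type*} (s : Finset ι) {u : ι → Site d → ℝ}
    (hu : ∀ i, FiniteEnergy (u i)) : FiniteEnergy (∑ i ∈ s, u i) := by
  classical
  induction s using Finset.induction_on with
  | empty => simpa using FiniteEnergy.zero
  | insert i s hi ih => rw [Finset.sum_insert hi]; exact (hu i).add ih

theorem FiniteEnergy.summable {d : ℕ} {u : Site d → ℝ} (hu : FiniteEnergy u) :
    Summable fun x => ‖grad u x‖ ^ 2 := by
  have := Memℓp.summable (p := 2) (by norm_num) hu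
  simpa using this

theorem memℓp_two_of_norm_le {α : Type*} {E F : Type*} [NormedAddCommGroup E]
    [NormedAddCommGroup F] {f : α → E} {g : α → F} (hg : Memℓp g 2) (h : ∀ x, ‖f x‖ ≤ ‖g x‖) :
    Memℓp f 2 := by
  refine memℓp_gen ?_
  refine Summable.of_nonneg_of_le (fun x => by positivity) (fun x => ?_)
    (hg.summable (by norm_num))
  gcongr
  exact h x

theorem euclidean_norm_le_of_abs_le {d : ℕ} {F G : EuclideanSpace ℝ (Fin d)}
    (h : ∀ k, |F k| ≤ |G k|) : ‖F‖ ≤ ‖G‖ := by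
  rw [EuclideanSpace.norm_eq, EuclideanSpace.norm_eq]
  apply Real.sqrt_le_sqrt
  gcongr with k _
  exact h k

theorem norm_mulField_le {d : ℕ} {lam : ℝ} (hlam : 0 < lam) (a : CoeffField d lam)
    (F : Site d → EuclideanSpace ℝ (Fin d)) (x : Site d) : ‖mulField a F x‖ ≤ ‖F x‖ := by
  refine euclidean_norm_le_of_abs_le fun k => ?_
  simp only [mulField]
  rw [abs_mul, abs_of_pos (coeff_pos hlam a x k)]
  exact mul_le_of_le_one_left (abs_nonneg _) (a x k).2.2.le

theorem summable_inner {α E : Type*} [NormedAddCommGroup E] [InnerProductSpace ℝ E]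
    {f g : α → E} (hf : Memℓp f 2) (hg : Memℓp g 2) : Summable fun x => inner ℝ (f x) (g x) :=
  lp.summable_inner (𝕜 := ℝ) (G := fun _ : α => E) ⟨f, hf⟩ ⟨g, hg⟩

theorem FiniteEnergy.summable_form {d : ℕ} {lam : ℝ} (hlam : 0 < lam) (a : CoeffField d lam)
    {u v : Site d → ℝ} (hu : FiniteEnergy u) (hv : FiniteEnergy v) :
    Summable fun x => inner ℝ (mulField a (grad u) x) (grad v x) :=
  summable_inner (memℓp_two_of_norm_le hu (norm_mulField_le hlam a _)) hv

theorem inner_mulField {d : ℕ} {lam : ℝ} (a : CoeffField d lam)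
    (F : Site d → EuclideanSpace ℝ (Fin d)) (G : EuclideanSpace ℝ (Fin d)) (x : Site d) :
    inner ℝ (mulField a F x) G = ∑ k, (a x k : ℝ) * F x k * G k := by
  simp [PiLp.inner_apply, mulField, mul_comm]

theorem energyForm_comm {d : ℕ} {lam : ℝ} (a : CoeffField d lam) (u v : Site d → ℝ) :
    energyForm a u v = energyForm a v u := by
  unfold energyForm
  congr 1; ext x
  rw [inner_mulField, inner_mulField]
  exact Finset.sum_congr rfl fun k _ => by ring

theorem energyForm_sub_left {d : ℕ} {lam : ℝ} (hlam : 0 < lam) (a : CoeffField d lam)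
    {u v w : Site d → ℝ} (hu : FiniteEnergy u) (hv : FiniteEnergy v) (hw : FiniteEnergy w) :
    energyForm a (u - v) w = energyForm a u w - energyForm a v w := by
  unfold energyForm
  rw [← (hu.summable_form hlam a hw).tsum_sub (hv.summable_form hlam a hw)]
  simp_rw [grad_sub, mulField_sub, Pi.sub_apply, inner_sub_left]

theorem energyForm_add_left {d : ℕ} {lam : ℝ} (hlam : 0 < lam) (a : CoeffField d lam)
    {u v w : Site d → ℝ} (hu : FiniteEnergy u) (hv : FiniteEnergy v) (hw : FiniteEnergy w) :
    energyForm a (u + v) w = energyForm a u w + energyForm a v w := by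
  unfold energyForm
  rw [← (hu.summable_form hlam a hw).tsum_add (hv.summable_form hlam a hw)]
  simp_rw [grad_add, mulField_add, Pi.add_apply, inner_add_left]

theorem energyForm_smul_left {d : ℕ} {lam : ℝ} (a : CoeffField d lam)
    {u w : Site d → ℝ} (c : ℝ) :
    energyForm a (c • u) w = c * energyForm a u w := by
  unfold energyForm
  rw [← tsum_mul_left]
  simp_rw [grad_smul, mulField_smul, Pi.smul_apply, inner_smul_left]
  simp

theorem energyForm_sum_left {d : ℕ} {lam : ℝ} (hlam : 0 < lam) (a : CoeffField d lam)
    {ι : Type*} (s : Finset ι) {u : ι → Site d → ℝ} (hu : ∀ i, FiniteEnergy (u i))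
    {w : Site d → ℝ} (hw : FiniteEnergy w) :
    energyForm a (∑ i ∈ s, u i) w = ∑ i ∈ s, energyForm a (u i) w := by
  classical
  induction s using Finset.induction_on with
  | empty => simpa using energyForm_smul_left a (u := 0) (w := w) 0
  | insert i s hi ih =>
    rw [Finset.sum_insert hi, Finset.sum_insert hi,
      energyForm_add_left hlam a (hu i) (FiniteEnergy.sum s hu) hw, ih]

theorem le_inner_mulField_self {d : ℕ} {lam : ℝ} (a : CoeffField d lam) (u : Site d → ℝ)
    (x : Site d) : lam * ‖grad u x‖ ^ 2 ≤ inner ℝ (mulField a (grad u) x) (grad u x) := by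
  rw [inner_mulField, norm_grad_sq, Finset.mul_sum]
  refine Finset.sum_le_sum fun k _ => ?_
  rw [grad_apply, mul_assoc, ← sq]
  exact mul_le_mul_of_nonneg_right (a x k).2.1.le (sq_nonneg _)

theorem sum_sq_le_energyForm {d : ℕ} {lam : ℝ} (hlam : 0 < lam) (a : CoeffField d lam)
    {u : Site d → ℝ} (hu : FiniteEnergy u) (s : Finset (Site d)) :
    lam * ∑ x ∈ s, ‖grad u x‖ ^ 2 ≤ energyForm a u u := by
  rw [Finset.mul_sum]
  refine (Finset.sum_le_sum fun x _ => le_inner_mulField_self a u x).trans ?_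
  refine (hu.summable_form hlam a hu).sum_le_tsum s fun x _ => ?_
  exact le_trans (by positivity) (le_inner_mulField_self a u x)

theorem grad_eq_zero_of_energyForm {d : ℕ} {lam : ℝ} (hlam : 0 < lam) (a : CoeffField d lam)
    {u : Site d → ℝ} (hu : FiniteEnergy u) (h : energyForm a u u ≤ 0) (x : Site d) :
    grad u x = 0 := by
  have h1 := (sum_sq_le_energyForm hlam a hu {x}).trans h
  rw [Finset.sum_singleton] at h1
  have h2 : ‖grad u x‖ ^ 2 ≤ 0 := by nlinarith
  have h3 : ‖grad u x‖ ^ 2 = 0 := le_antisymm h2 (by positivity)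
  simpa using h3

theorem eq_of_grad_eq_zero {d : ℕ} {u : Site d → ℝ} (h : ∀ x, grad u x = 0) (x : Site d) :
    u x = u 0 := by
  have h' : ∀ x k, u (x + unit k) - u x = 0 := fun x k => by
    rw [← grad_apply, h x]; rfl
  induction x using site_induction with
  | h0 => rfl
  | hadd x k hx => linarith [h' x k]
  | hsub x k hx =>
    have := h' (x - unit k) k
    rw [sub_add_cancel] at this
    linarith

/-- The closed subspace of all `√a ∇u` with `u` of finite energy. -/
noncomputable def weightedGradients {d : ℕ} {lam : ℝ} (a : CoeffField d lam) :
    Submodule ℝ (lp (fun _ : Site d => EuclideanSpace ℝ (Fin d)) 2) where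
  carrier := {F | ∃ u : Site d → ℝ, ∀ x k, F x k = Real.sqrt (a x k) * grad u x k}
  add_mem' := by
    rintro F G ⟨u, hu⟩ ⟨v, hv⟩
    refine ⟨u + v, fun x k => ?_⟩
    rw [lp.coeFn_add, Pi.add_apply, PiLp.add_apply, hu, hv, grad_add]
    simp; ring
  zero_mem' := ⟨0, fun x k => by rw [grad_zero]; simp⟩
  smul_mem' := by
    rintro c F ⟨u, hu⟩
    refine ⟨c • u, fun x k => ?_⟩
    rw [lp.coeFn_smul, Pi.smul_apply, PiLp.smul_apply, hu, grad_smul]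
    simp; ring

/-- Convergence in ℓ² implies convergence at every site; dividing by √a > 0 leaves a pointwise limit
of gradients, which is a gradient. -/
theorem isClosed_weightedGradients {d : ℕ} {lam : ℝ} (hlam : 0 < lam) (a : CoeffField d lam) :
    IsClosed (weightedGradients a : Set (lp (fun _ : Site d => EuclideanSpace ℝ (Fin d)) 2)) := by
  apply IsSeqClosed.isClosed
  intro F G hF hFG
  choose u hu using hF
  have hpt : ∀ x, Tendsto (fun n => F n x) atTop (𝓝 (G x)) := by
    intro x
    rw [tendsto_iff_norm_sub_tendsto_zero] at hFG ⊢
    refine squeeze_zero (fun _ => norm_nonneg _) (fun n => ?_) hFG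
    exact lp.norm_apply_le_norm (by norm_num) (F n - G) x
  have hg : ∀ x, Tendsto (fun n => grad (u n) x) atTop
      (𝓝 (WithLp.toLp 2 fun k => (Real.sqrt (a x k))⁻¹ * G x k)) := by
    intro x
    have h1 : Tendsto (fun n => (fun k => (Real.sqrt (a x k))⁻¹ * F n x k)) atTop
        (𝓝 fun k => (Real.sqrt (a x k))⁻¹ * G x k) := by
      rw [tendsto_pi_nhds]
      intro k
      exact (((EuclideanSpace.proj (𝕜 := ℝ) k).continuous.tendsto (G x)).comp
        (hpt x)).const_mul _
    have h2 := ((PiLp.continuous_toLp 2 fun _ : Fin d => ℝ).tendsto _).comp h1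
    refine h2.congr fun n => ?_
    ext k
    have : Real.sqrt (a x k) ≠ 0 := (Real.sqrt_pos.2 (coeff_pos hlam a x k)).ne'
    simp [hu, this]
  obtain ⟨U, hU⟩ := exists_grad_eq_of_tendsto hg
  refine ⟨U, fun x k => ?_⟩
  have : Real.sqrt (a x k) ≠ 0 := (Real.sqrt_pos.2 (coeff_pos hlam a x k)).ne'
  rw [hU]
  simp [this]

/-- This solves ∇*(a∇w) = ∇*(ξ 1_x). In the variables √a∇u the energy form is the inner product of
ℓ², and √a∇w is the orthogonal projection of a^{-1/2}ξ 1_x onto the closed space of weighted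
gradients. -/
theorem exists_energyForm_eq_inner {d : ℕ} {lam : ℝ} (hlam : 0 < lam) (a : CoeffField d lam)
    (x : Site d) (ξ : EuclideanSpace ℝ (Fin d)) :
    ∃ w : Site d → ℝ, FiniteEnergy w ∧ ∀ v, FiniteEnergy v →
      energyForm a w v = inner ℝ ξ (grad v x) := by
  classical
  have : CompleteSpace (weightedGradients a) :=
    (isClosed_weightedGradients hlam a).isComplete.completeSpace_coe
  have hs : ∀ x k, 0 < Real.sqrt (a x k) := fun x k => Real.sqrt_pos.2 (coeff_pos hlam a x k)
  set c : lp (fun _ : Site d => EuclideanSpace ℝ (Fin d)) 2 :=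
    lp.single 2 x (WithLp.toLp 2 fun k => (Real.sqrt (a x k))⁻¹ * ξ k)
  obtain ⟨w, hw⟩ := ((weightedGradients a).orthogonalProjectionOnto c).2
  -- Removing the weight √a costs at most a factor 1/√λ.
  have hwF : FiniteEnergy w := by
    have h1 := (lp.memℓp ((weightedGradients a).orthogonalProjectionOnto c).1).const_smul
      (Real.sqrt lam)⁻¹
    refine memℓp_two_of_norm_le h1 fun y => euclidean_norm_le_of_abs_le fun k => ?_
    rw [Pi.smul_apply, PiLp.smul_apply, hw, smul_eq_mul, ← mul_assoc, abs_mul]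
    refine le_mul_of_one_le_left (abs_nonneg _) ?_
    rw [abs_of_pos (mul_pos (inv_pos.2 (Real.sqrt_pos.2 hlam)) (hs y k)),
      le_inv_mul_iff₀ (Real.sqrt_pos.2 hlam), mul_one]
    exact Real.sqrt_le_sqrt (a y k).2.1.le
  refine ⟨w, hwF, fun v hv => ?_⟩
  set Fv : Site d → EuclideanSpace ℝ (Fin d) :=
    fun y => WithLp.toLp 2 fun k => Real.sqrt (a y k) * grad v y k with hFv
  have hFvmem : Memℓp Fv 2 := by
    refine memℓp_two_of_norm_le hv fun y => euclidean_norm_le_of_abs_le fun k => ?_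
    rw [hFv, abs_mul, abs_of_pos (hs y k)]
    refine mul_le_of_le_one_left (abs_nonneg _) ?_
    exact Real.sqrt_le_one.2 (a y k).2.2.le
  have horth := (weightedGradients a).starProjection_inner_eq_zero c ⟨Fv, hFvmem⟩
    ⟨v, fun y k => rfl⟩
  rw [inner_sub_left, sub_eq_zero] at horth
  have h1 : inner ℝ c (⟨Fv, hFvmem⟩ : lp (fun _ : Site d => EuclideanSpace ℝ (Fin d)) 2) =
      inner ℝ ξ (grad v x) := by
    rw [lp.inner_single_left]
    simp only [PiLp.inner_apply]
    refine Finset.sum_congr rfl fun k _ => ?_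
    have := (hs x k).ne'
    simp [hFv]
    field_simp
  rw [← h1, horth, lp.inner_eq_tsum, energyForm]
  congr 1; ext y
  rw [inner_mulField]
  simp only [PiLp.inner_apply]
  refine Finset.sum_congr rfl fun k _ => ?_
  have e1 := hw y k
  have e2 : ((weightedGradients a).starProjection c) y k = Real.sqrt (a y k) * grad w y k := e1
  rw [e2]
  simp only [hFv, RCLike.inner_apply, conj_trivial]
  have := Real.mul_self_sqrt (coeff_pos hlam a y k).le
  linear_combination (-grad w y k * grad v y k) * this

/-- Summation by parts against a Dirac function; this converts weak formulations into equations at a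
site. -/
theorem hasSum_inner_grad_single {d : ℕ} (F : Site d → EuclideanSpace ℝ (Fin d)) (z : Site d) :
    HasSum (fun x => inner ℝ (F x) (grad (Pi.single z (1 : ℝ)) x)) (gradStar F z) := by
  have h1 : ∀ x, inner ℝ (F x) (grad (Pi.single z (1 : ℝ)) x) =
      ∑ k, ((if x = z - unit k then F (z - unit k) k else 0) - if x = z then F z k else 0) := by
    intro x
    simp only [PiLp.inner_apply, grad_apply, Pi.single_apply]
    refine Finset.sum_congr rfl fun k _ => ?_
    simp only [← eq_sub_iff_add_eq]
    simp only [RCLike.inner_apply, conj_trivial]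
    split_ifs with h1 h2 h2
    · rw [← h1, ← h2]; ring
    · rw [← h1]; ring
    · rw [← h2]; ring
    · ring
  simp_rw [h1, gradStar]
  exact hasSum_sum fun k _ => (hasSum_ite_eq _ _).sub (hasSum_ite_eq _ _)

theorem finiteEnergy_single {d : ℕ} (z : Site d) (c : ℝ) : FiniteEnergy (Pi.single z c) := by
  suffices h : Memℓp (grad (Pi.single z c)) 0 from h.of_exponent_ge zero_le
  apply memℓp_zero
  refine Set.Finite.subset (s := {z} ∪ Set.range fun k => z - unit k)
    ((Set.finite_singleton z).union (Set.finite_range _)) ?_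
  intro x hx
  by_contra hcon
  apply hx
  ext k
  simp only [Set.singleton_union, Set.mem_insert_iff, Set.mem_range, not_or, not_exists] at hcon
  have h2 : x + unit k ≠ z := fun h => hcon.2 k (by rw [← h]; abel)
  simp [grad_apply, hcon.1, h2]

theorem energyForm_single {d : ℕ} {lam : ℝ} (a : CoeffField d lam) (w : Site d → ℝ) (z : Site d) :
    energyForm a w (Pi.single z 1) = gradStar (mulField a (grad w)) z :=
  (hasSum_inner_grad_single _ z).tsum_eq

theorem FiniteEnergy.sum_le_tsum {d : ℕ} {u : Site d → ℝ} (hu : FiniteEnergy u) (R : ℕ) :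
    ∑ x ∈ latticeCube d R, ‖grad u x‖ ^ 2 ≤ ∑' x, ‖grad u x‖ ^ 2 :=
  hu.summable.sum_le_tsum _ fun _ _ => by positivity

theorem FiniteEnergy.sublinear {d : ℕ} (hd : 0 < d) {u : Site d → ℝ} (hu : FiniteEnergy u) :
    Sublinear u := sublinear_of_energy_le hd hu.sum_le_tsum

theorem finiteEnergy_const {d : ℕ} (c : ℝ) : FiniteEnergy (fun _ : Site d => c) := by
  have : grad (fun _ : Site d => c) = 0 := by ext x k; simp [grad_apply]
  unfold FiniteEnergy; rw [this]; exact zero_memℓp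

theorem Sublinear.of_sq_le {d : ℕ} {u v w : Site d → ℝ} (hv : Sublinear v) (hw : Sublinear w)
    (h : ∀ x, u x ^ 2 ≤ 2 * v x ^ 2 + 2 * w x ^ 2) : Sublinear u := by
  have h1 := (Tendsto.const_mul 2 hv).add (Tendsto.const_mul 2 hw)
  simp only [mul_zero, add_zero] at h1
  refine squeeze_zero (fun R => ?_) (fun R => ?_) h1
  · exact mul_nonneg (by positivity) (mul_nonneg (by positivity)
      (Finset.sum_nonneg fun _ _ => by positivity))
  · have h2 : ∑ x ∈ latticeCube d R, u x ^ 2 ≤ 2 * ∑ x ∈ latticeCube d R, v x ^ 2 +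
        2 * ∑ x ∈ latticeCube d R, w x ^ 2 := by
      rw [Finset.mul_sum, Finset.mul_sum, ← Finset.sum_add_distrib]
      exact Finset.sum_le_sum fun x _ => h x
    calc _ ≤ ((R : ℝ) ^ 2)⁻¹ * (((latticeCube d R).card : ℝ)⁻¹ *
          (2 * ∑ x ∈ latticeCube d R, v x ^ 2 + 2 * ∑ x ∈ latticeCube d R, w x ^ 2)) := by gcongr
      _ = _ := by ring

theorem Sublinear.sub {d : ℕ} {v w : Site d → ℝ} (hv : Sublinear v) (hw : Sublinear w) :
    Sublinear (v - w) := hv.of_sq_le hw fun x => by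
  rw [Pi.sub_apply]; nlinarith [sq_nonneg (v x + w x)]

theorem Sublinear.add {d : ℕ} {v w : Site d → ℝ} (hv : Sublinear v) (hw : Sublinear w) :
    Sublinear (v + w) := hv.of_sq_le hw fun x => by
  rw [Pi.add_apply]; nlinarith [sq_nonneg (v x - w x)]

theorem sublinear_of_avg_sq_le {d : ℕ} {u : Site d → ℝ} {b : ℕ → ℝ}
    (hb : Tendsto (fun R : ℕ => ((R : ℝ) ^ 2)⁻¹ * b R) atTop (𝓝 0))
    (h : ∀ R, ∀ x ∈ latticeCube d R, u x ^ 2 ≤ b R) : Sublinear u := by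
  refine squeeze_zero (fun R => ?_) (fun R => ?_) hb
  · exact mul_nonneg (by positivity) (mul_nonneg (by positivity)
      (Finset.sum_nonneg fun _ _ => by positivity))
  · refine mul_le_mul_of_nonneg_left ?_ (by positivity)
    rw [inv_mul_le_iff₀ (card_latticeCube_pos d R)]
    refine (Finset.sum_le_sum (h R)).trans ?_
    rw [Finset.sum_const, nsmul_eq_mul]

theorem sublinear_of_bounded {d : ℕ} {u : Site d → ℝ} {M : ℝ} (h : ∀ x, |u x| ≤ M) :
    Sublinear u := by
  refine sublinear_of_avg_sq_le (b := fun _ => M ^ 2) ?_ fun R x _ => ?_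
  · have : Tendsto (fun R : ℕ => ((R : ℝ) ^ 2)⁻¹) atTop (𝓝 0) :=
      tendsto_inv_atTop_zero.comp ((tendsto_pow_atTop two_ne_zero).comp tendsto_natCast_atTop_atTop)
    simpa using this.mul_const (M ^ 2)
  · rw [← sq_abs]
    have := h x
    gcongr

/-! ### Dipoles and Green's functions. -/

/-- The finite energy function whose flux has a source at `x` and a sink at `y`. -/
theorem exists_dipole {d : ℕ} {lam : ℝ} (hlam : 0 < lam) (a : CoeffField d lam) (x y : Site d) :
    ∃ h : Site d → ℝ, FiniteEnergy h ∧ h y = 0 ∧ ∀ v, FiniteEnergy v →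
      energyForm a h v = v x - v y := by
  -- A dipole between `y` and `y + z` is a signed sum of one-edge dipoles along a lattice path.
  have key : ∀ z : Site d, ∃ h : Site d → ℝ, FiniteEnergy h ∧ ∀ v, FiniteEnergy v →
      energyForm a h v = v (y + z) - v y := by
    have hinner : ∀ (k : Fin d) (v : Site d → ℝ) (x : Site d),
        inner ℝ (EuclideanSpace.single k (1 : ℝ)) (grad v x) = v (x + unit k) - v x := by
      intro k v x
      rw [EuclideanSpace.inner_single_left]
      simp [grad_apply]
    intro z
    induction z using site_induction with
    | h0 =>
      exact ⟨0, FiniteEnergy.zero, fun v _ => by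
        simpa using energyForm_smul_left a (u := 0) (w := v) 0⟩
    | hadd z k hz =>
      obtain ⟨h, hF, hh⟩ := hz
      obtain ⟨w, hwF, hw⟩ := exists_energyForm_eq_inner hlam a (y + z) (EuclideanSpace.single k 1)
      refine ⟨h + w, hF.add hwF, fun v hv => ?_⟩
      rw [energyForm_add_left hlam a hF hwF hv, hh v hv, hw v hv, hinner, add_assoc]
      ring
    | hsub z k hz =>
      obtain ⟨h, hF, hh⟩ := hz
      obtain ⟨w, hwF, hw⟩ := exists_energyForm_eq_inner hlam a (y + (z - unit k))
        (EuclideanSpace.single k 1)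
      refine ⟨h - w, hF.sub hwF, fun v hv => ?_⟩
      rw [energyForm_sub_left hlam a hF hwF hv, hh v hv, hw v hv, hinner,
        show y + (z - unit k) + unit k = y + z by abel]
      ring
  obtain ⟨h, hF, hh⟩ := key (x - y)
  have hc := finiteEnergy_const (d := d) (h y)
  refine ⟨h - fun _ => h y, hF.sub hc, by simp, fun v hv => ?_⟩
  rw [energyForm_sub_left hlam a hF hc hv, hh v hv, add_sub_cancel]
  have : energyForm a (fun _ => h y) v = 0 := by
    have : grad (fun _ : Site d => h y) = 0 := by ext x k; simp [grad_apply]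
    rw [energyForm, this]
    simp [inner_mulField]
  rw [this, sub_zero]

theorem FiniteEnergy.comp_lipschitz {d : ℕ} {u : Site d → ℝ} (hu : FiniteEnergy u) {f : ℝ → ℝ}
    (hf : ∀ s t, |f s - f t| ≤ |s - t|) : FiniteEnergy fun x => f (u x) :=
  memℓp_two_of_norm_le hu fun x => euclidean_norm_le_of_abs_le fun k => by
    simpa [grad_apply] using hf _ _

/-- Testing a function with a contraction of itself. -/
theorem energyForm_comp_le {d : ℕ} {lam : ℝ} (hlam : 0 < lam) (a : CoeffField d lam)
    {u : Site d → ℝ} (hu : FiniteEnergy u) {f : ℝ → ℝ} (hf : ∀ s t, |f s - f t| ≤ |s - t|)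
    (hf2 : ∀ s t, (f s - f t) ^ 2 ≤ (s - t) * (f s - f t)) :
    energyForm a (fun x => f (u x)) (fun x => f (u x)) ≤ energyForm a u fun x => f (u x) := by
  have hfu := hu.comp_lipschitz hf
  refine Summable.tsum_le_tsum (fun x => ?_) (hfu.summable_form hlam a hfu)
    (hu.summable_form hlam a hfu)
  rw [inner_mulField, inner_mulField]
  refine Finset.sum_le_sum fun k _ => ?_
  rw [mul_assoc, mul_assoc]
  refine mul_le_mul_of_nonneg_left ?_ (coeff_pos hlam a x k).le
  simpa [grad_apply, sq] using hf2 (u (x + unit k)) (u x)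

/-- Weak maximum principle. The truncations min(h, 0) and max(h - h(x), 0) vanish at both poles, so
the energy form of h against them is 0. By `energyForm_comp_le` their own energy vanishes; they are
constant, hence 0. -/
theorem dipole_bounds {d : ℕ} {lam : ℝ} (hlam : 0 < lam) (a : CoeffField d lam) {x y : Site d}
    {h : Site d → ℝ} (hF : FiniteEnergy h) (hy : h y = 0)
    (hh : ∀ v, FiniteEnergy v → energyForm a h v = v x - v y) (z : Site d) :
    0 ≤ h z ∧ h z ≤ h x := by
  have hx : 0 ≤ h x := by
    have h1 := hh h hF
    have h2 := sum_sq_le_energyForm hlam a hF ∅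
    simp [hy] at h1 h2
    linarith
  have key : ∀ f : ℝ → ℝ, (∀ s t, |f s - f t| ≤ |s - t|) →
      (∀ s t, (f s - f t) ^ 2 ≤ (s - t) * (f s - f t)) → f (h x) = 0 → f 0 = 0 → f (h z) = 0 := by
    intro f hf hf2 hfx hf0
    have hfu := hF.comp_lipschitz hf
    have h1 := energyForm_comp_le hlam a hF hf hf2
    rw [hh _ hfu, hy, hfx, hf0, sub_zero] at h1
    have h2 := eq_of_grad_eq_zero (grad_eq_zero_of_energyForm hlam a hfu h1)
    have h3 := h2 z
    have h4 := h2 y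
    simp only [hy, hf0] at h3 h4
    rw [h3, ← h4]
  constructor
  · have := key (fun s => min s 0) (fun s t => ?_) (fun s t => ?_) (by simpa using hx) (by simp)
    · simpa using this
    · exact abs_min_sub_min_le_max s 0 t 0 |>.trans (by simp)
    · rcases le_total s 0 with h1 | h1 <;> rcases le_total t 0 with h2 | h2 <;>
        simp only [h1, h2, min_eq_left, min_eq_right] <;> nlinarith
  · have := key (fun s => max (s - h x) 0) (fun s t => ?_) (fun s t => ?_) (by simp)
      (by simpa using hx)
    · simpa using this
    · refine (abs_max_sub_max_le_max (s - h x) 0 (t - h x) 0).trans (by simp)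
    · rcases le_total (s - h x) 0 with h1 | h1 <;> rcases le_total (t - h x) 0 with h2 | h2 <;>
        simp only [h1, h2, max_eq_left, max_eq_right] <;> nlinarith

/-- The bound does not depend on the position of the far pole `x`. By symmetry h(z) is the value at
`x` of the dipole g with source `z`, hence at most g(z). But g(z) is also the energy of g, so the
pointwise estimate reads g(z)² ≤ C g(z) × growth², and one factor g(z) cancels. -/
theorem exists_dipole_le {d : ℕ} (hd : 2 ≤ d) {lam : ℝ} (hlam : 0 < lam) : ∃ C : ℝ, 0 < C ∧
    ∀ (a : CoeffField d lam) (x y : Site d) (h : Site d → ℝ), FiniteEnergy h → h y = 0 →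
      (∀ v, FiniteEnergy v → energyForm a h v = v x - v y) →
      ∀ (j : ℕ) (z : Site d), z - y ∈ latticeCube d (2 ^ j) → |h z| ≤ C * energyGrowth d j ^ 2 := by
  obtain ⟨C, hC, hmain⟩ := exists_sq_sub_le_energy hd
  refine ⟨C / lam, by positivity, fun a x y h hF hy hh j z hz => ?_⟩
  obtain ⟨g, hgF, hgy, hg⟩ := exists_dipole hlam a z y
  have hsymm : h z = g x := by
    have h1 := hh g hgF
    have h2 := hg h hF
    rw [energyForm_comm, h1, hy, hgy] at h2
    linarith
  have hb := dipole_bounds hlam a hgF hgy hg x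
  rw [hsymm, abs_of_nonneg hb.1]
  refine hb.2.trans ?_
  have hE : energyForm a g g = g z := by rw [hg g hgF, hgy, sub_zero]
  have hgz : 0 ≤ g z := (dipole_bounds hlam a hgF hgy hg z).1
  have h1 : ∀ R : ℕ, ∑ x ∈ latticeCube d R, ‖grad g x‖ ^ 2 ≤ g z / lam := by
    intro R
    rw [le_div_iff₀ hlam, mul_comm, ← hE]
    exact sum_sq_le_energyForm hlam a hgF _
  have h2 := hmain (fun x => g (x + y)) (g z / lam) (energy_shift_le h1 y) j (z - y) hz
  simp only [sub_add_cancel, zero_add, hgy, sub_zero] at h2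
  rcases hgz.eq_or_lt with h0 | h0
  · rw [← h0]; positivity
  · rw [sq, show C * (g z / lam) * energyGrowth d j ^ 2 =
      g z * (C / lam * energyGrowth d j ^ 2) by ring] at h2
    exact le_of_mul_le_mul_left h2 h0

theorem tendsto_gradStar_mulField {d : ℕ} {lam : ℝ} (a : CoeffField d lam) {ι : Type*}
    {l : Filter ι} {u : ι → Site d → ℝ} {U : Site d → ℝ}
    (h : ∀ x, Tendsto (fun n => u n x) l (𝓝 (U x))) (z : Site d) :
    Tendsto (fun n => gradStar (mulField a (grad (u n))) z) l
      (𝓝 (gradStar (mulField a (grad U)) z)) := by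
  simp only [gradStar, mulField, grad_apply]
  exact tendsto_finsetSum _ fun k _ => (((h _).sub (h _)).const_mul _).sub
    (((h _).sub (h _)).const_mul _)

/-- Fix the sink at `y`, send the source to infinity and change the sign. The uniform bound on
dipoles gives compactness at each site. It grows like the square of a logarithm in d = 2, which is
sublinear, and is constant for d > 2. -/
theorem exists_greenFunction {d : ℕ} (hd : 2 ≤ d) {lam : ℝ} (hlam : 0 < lam)
    (a : CoeffField d lam) : ∃ G, IsGreenFunction a G := by
  classical
  obtain ⟨C, hC, hmain⟩ := exists_dipole_le hd hlam
  suffices H : ∀ y : Site d, ∃ g : Site d → ℝ,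
      (∀ z, gradStar (mulField a (grad g)) z = if z = y then 1 else 0) ∧
      ∀ (j : ℕ) (z : Site d), z - y ∈ latticeCube d (2 ^ j) → |g z| ≤ C * energyGrowth d j ^ 2 by
    choose g hg hgb using H
    refine ⟨fun z y => g y z, fun y => ⟨hg y, fun hd2 => ?_, fun hd2 => ?_⟩⟩
    · obtain ⟨S, hS⟩ := exists_mem_latticeCube y
      refine sublinear_of_avg_sq_le
        (b := fun R => (C * ((Nat.clog 2 (R + S) : ℝ) + 1) ^ 2) ^ 2) ?_ fun R x hx => ?_
      -- With n = clog(R + S) + 1 the squared bound is C²n⁴, while R² dominates 2^n up to a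
      -- constant.
      · have h1 : Tendsto (fun n : ℕ => (n : ℝ) ^ 4 / 2 ^ n) atTop (𝓝 0) :=
          tendsto_pow_const_div_const_pow_of_one_lt 4 (by norm_num)
        have h2 : Tendsto (fun R : ℕ => Nat.clog 2 (R + S) + 1) atTop atTop := by
          refine tendsto_atTop_mono (fun R => ?_) (f := fun R => Nat.log 2 R) ?_
          · exact (Nat.log_mono_right (by omega)).trans
              ((Nat.log_le_clog 2 (R + S)).trans (Nat.le_succ _))
          · refine tendsto_atTop.2 fun b => ?_
            filter_upwards [eventually_ge_atTop (2 ^ b)] with R hR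
            exact Nat.le_log_of_pow_le (by norm_num) hR
        have h3 := ((h1.comp h2).const_mul (C ^ 2 * 4 * (1 + S)))
        rw [mul_zero] at h3
        refine squeeze_zero' (Eventually.of_forall fun R => by positivity) ?_ h3
        filter_upwards [eventually_ge_atTop 2] with R hR
        simp only [Function.comp]
        have hRpos : (0 : ℝ) < R := by exact_mod_cast (show 0 < R by omega)
        have h4 : 2 ^ (Nat.clog 2 (R + S) + 1) ≤ 4 * (R + S) := by
          have h5 : 2 ^ (Nat.clog 2 (R + S) - 1) < R + S :=
            Nat.pow_pred_clog_lt_self (by norm_num) (by omega)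
          have h6 : 0 < Nat.clog 2 (R + S) := Nat.clog_pos (by norm_num) (by omega)
          have : Nat.clog 2 (R + S) + 1 = (Nat.clog 2 (R + S) - 1) + 2 := by omega
          rw [this, pow_add]
          omega
        have h5 : ((2 : ℝ) ^ (Nat.clog 2 (R + S) + 1)) ≤ 4 * (1 + S) * (R : ℝ) ^ 2 := by
          have h6 : ((2 : ℝ) ^ (Nat.clog 2 (R + S) + 1)) ≤ 4 * (R + S) := by exact_mod_cast h4
          have h7 : (1 : ℝ) ≤ R := by exact_mod_cast (show 1 ≤ R by omega)
          have h8 : (0 : ℝ) ≤ S := by positivity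
          nlinarith [mul_nonneg h8 (sub_nonneg.2 h7)]
        push_cast
        set m : ℝ := (Nat.clog 2 (R + S) : ℝ) + 1
        calc ((R : ℝ) ^ 2)⁻¹ * (C * m ^ 2) ^ 2 = C ^ 2 * m ^ 4 * ((R : ℝ) ^ 2)⁻¹ := by ring
          _ ≤ C ^ 2 * m ^ 4 * (4 * (1 + S) / 2 ^ (Nat.clog 2 (R + S) + 1)) := by
              gcongr
              rw [inv_eq_one_div, div_le_div_iff₀ (by positivity) (by positivity)]
              linarith
          _ = _ := by ring
      · have h1 : x - y ∈ latticeCube d (2 ^ Nat.clog 2 (R + S)) := by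
          rw [sub_eq_add_neg]
          exact latticeCube_mono (Nat.le_pow_clog (by norm_num) _)
            (add_mem_latticeCube hx (neg_mem_latticeCube hS))
        have h2 := hgb y _ x h1
        rw [energyGrowth, if_pos hd2] at h2
        rw [← sq_abs]
        gcongr
    · refine ⟨C, fun z => ?_⟩
      obtain ⟨S, hS⟩ := exists_mem_latticeCube (z - y)
      have h2 := hgb y S z (latticeCube_mono Nat.lt_two_pow_self.le hS)
      rw [energyGrowth, if_neg (by omega)] at h2
      simpa using h2
  intro y
  let k0 : Fin d := ⟨0, by omega⟩
  set x : ℕ → Site d := fun n => Pi.single k0 (n : ℤ)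
  choose h hF hy hh using fun n => exists_dipole hlam a (x n) y
  have hbound := fun n => hmain a (x n) y (h n) (hF n) (hy n) (hh n)
  -- An ultrafilter gives limits at all sites simultaneously, in place of a diagonal subsequence.
  let U : Ultrafilter ℕ := Filter.hyperfilter ℕ
  have hU : (U : Filter ℕ) ≤ atTop := by
    rw [← Nat.cofinite_eq_atTop]; exact Filter.hyperfilter_le_cofinite
  have hlim : ∀ z, ∃ c, Tendsto (fun n => h n z) U (𝓝 c) := by
    intro z
    obtain ⟨S, hS⟩ := exists_mem_latticeCube (z - y)
    have h2 := fun n => hbound n S z (latticeCube_mono Nat.lt_two_pow_self.le hS)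
    set M := C * energyGrowth d S ^ 2
    obtain ⟨c, -, hc⟩ := (isCompact_Icc (a := -M) (b := M)).ultrafilter_le_nhds
      (U.map fun n => h n z) (by
        rw [le_principal_iff]
        exact mem_map.2 (Filter.univ_mem' fun n => abs_le.1 (h2 n)))
    exact ⟨c, hc⟩
  choose g hg using hlim
  refine ⟨-g, fun z => ?_, fun j z hz => ?_⟩
  · have h1 := tendsto_gradStar_mulField a (fun x => (hg x).neg) z
    refine tendsto_nhds_unique h1 ?_
    -- At a fixed `z` the moving source is eventually elsewhere, so only the sink at `y` remains.
    have h2 : ∀ᶠ n in (U : Filter ℕ), x n ≠ z := by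
      apply hU
      filter_upwards [eventually_gt_atTop (z k0).natAbs] with n hn heq
      have : x n k0 = z k0 := by rw [heq]
      simp [x] at this
      omega
    refine tendsto_const_nhds.congr' ?_
    filter_upwards [h2] with n hn
    have h3 := hh n (Pi.single z 1) (finiteEnergy_single z 1)
    rw [energyForm_single] at h3
    have h4 : gradStar (mulField a (grad fun x => -h n x)) z =
        -gradStar (mulField a (grad (h n))) z := by
      simp only [gradStar, mulField, grad_apply, ← Finset.sum_neg_distrib]
      exact Finset.sum_congr rfl fun k _ => by ring
    rw [h4, h3]
    simp [Pi.single_apply, hn, eq_comm]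
  · refine le_of_tendsto (hg z).neg.abs (Eventually.of_forall fun n => ?_)
    rw [abs_neg]
    exact hbound n j z hz

/-! ### One-site perturbations of the coefficient field -/

/-- Sublinear `a`-harmonic functions are constant. -/
def LiouvilleProperty {d : ℕ} {lam : ℝ} (a : CoeffField d lam) : Prop :=
  ∀ u : Site d → ℝ, (∀ z, gradStar (mulField a (grad u)) z = 0) → Sublinear u → ∀ x, u x = u 0

/-- The vector `(a(x) - a'(x)) ξ`. -/
noncomputable def siteDiff {d : ℕ} {lam : ℝ} (a a' : CoeffField d lam) (x : Site d)
    (ξ : EuclideanSpace ℝ (Fin d)) : EuclideanSpace ℝ (Fin d) :=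
  WithLp.toLp 2 fun k => ((a x k : ℝ) - a' x k) * ξ k

theorem siteDiff_add {d : ℕ} {lam : ℝ} (a a' : CoeffField d lam) (x : Site d)
    (ξ η : EuclideanSpace ℝ (Fin d)) :
    siteDiff a a' x (ξ + η) = siteDiff a a' x ξ + siteDiff a a' x η := by
  ext k; simp [siteDiff]; ring

theorem norm_siteDiff_le {d : ℕ} {lam : ℝ} (hlam : 0 < lam) (a a' : CoeffField d lam) (x : Site d)
    (ξ : EuclideanSpace ℝ (Fin d)) : ‖siteDiff a a' x ξ‖ ≤ ‖ξ‖ := by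
  refine euclidean_norm_le_of_abs_le fun k => ?_
  simp only [siteDiff, abs_mul]
  refine mul_le_of_le_one_left (abs_nonneg _) ?_
  rw [abs_le]
  have h1 := (a x k).2.2
  have h2 := (a' x k).2.2
  have h3 := coeff_pos hlam a x k
  have h4 := coeff_pos hlam a' x k
  constructor <;> linarith

theorem mulField_sub_mulField {d : ℕ} {lam : ℝ} (a a' : CoeffField d lam)
    (F : Site d → EuclideanSpace ℝ (Fin d)) (x : Site d) :
    mulField a F x - mulField a' F x = siteDiff a a' x (F x) := by
  ext k; simp [mulField, siteDiff]; ring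

theorem siteDiff_eq_zero {d : ℕ} {lam : ℝ} {a a' : CoeffField d lam} {x z : Site d}
    (h : AgreeOff x a a') (hz : z ≠ x) (ξ : EuclideanSpace ℝ (Fin d)) : siteDiff a a' z ξ = 0 := by
  ext k; simp [siteDiff, h z hz]

theorem gradStar_mulField_sub {d : ℕ} {lam : ℝ} {a a' : CoeffField d lam} {x : Site d}
    (h : AgreeOff x a a') (F : Site d → EuclideanSpace ℝ (Fin d)) (z : Site d) :
    gradStar (mulField a F) z - gradStar (mulField a' F) z =
      inner ℝ (siteDiff a a' x (F x)) (grad (Pi.single z (1 : ℝ)) x) := by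
  have h1 := (hasSum_inner_grad_single (mulField a F) z).sub
    (hasSum_inner_grad_single (mulField a' F) z)
  simp_rw [← inner_sub_left, mulField_sub_mulField] at h1
  refine h1.unique (hasSum_single x fun y hy => ?_)
  rw [siteDiff_eq_zero h hy, inner_zero_left]

theorem energyForm_sub_energyForm {d : ℕ} {lam : ℝ} (hlam : 0 < lam) {a a' : CoeffField d lam}
    {x : Site d} (h : AgreeOff x a a') {u v : Site d → ℝ} (hu : FiniteEnergy u)
    (hv : FiniteEnergy v) : energyForm a u v - energyForm a' u v =
      inner ℝ (siteDiff a a' x (grad u x)) (grad v x) := by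
  have h1 := (hu.summable_form hlam a hv).hasSum.sub (hu.summable_form hlam a' hv).hasSum
  simp_rw [← inner_sub_left, mulField_sub_mulField] at h1
  refine h1.unique (hasSum_single x fun y hy => ?_)
  rw [siteDiff_eq_zero h hy, inner_zero_left]

theorem gradStar_mulField_grad_sub {d : ℕ} {lam : ℝ} (a : CoeffField d lam) (u v : Site d → ℝ)
    (z : Site d) : gradStar (mulField a (grad (u - v))) z =
      gradStar (mulField a (grad u)) z - gradStar (mulField a (grad v)) z := by
  rw [grad_sub, mulField_sub, gradStar_sub, Pi.sub_apply]

theorem LiouvilleProperty.grad_eq {d : ℕ} {lam : ℝ} {a : CoeffField d lam} (ha : LiouvilleProperty a)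
    {u v : Site d → ℝ} (hu : Sublinear u) (hv : Sublinear v)
    (h : ∀ z, gradStar (mulField a (grad u)) z = gradStar (mulField a (grad v)) z) :
    grad u = grad v := by
  have h1 := ha (u - v) (fun z => by rw [gradStar_mulField_grad_sub, h z, sub_self]) (hu.sub hv)
  rw [← sub_eq_zero, ← grad_sub]
  ext x k
  rw [grad_apply, h1, h1 x]
  simp

/-- A sublinear `a'`-harmonic u satisfies the equation of `a` with a source at `x` of divergence
form. The finite-energy solution w of that equation is sublinear, so the Liouville property of `a`
gives ∇u = ∇w. Thus u has finite energy and may be tested against itself in its own `a'`-equation,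
which makes ∇u vanish. -/
theorem LiouvilleProperty.of_agreeOff {d : ℕ} (hd : 0 < d) {lam : ℝ} (hlam : 0 < lam)
    {a a' : CoeffField d lam} {x : Site d} (h : AgreeOff x a a') (ha : LiouvilleProperty a) :
    LiouvilleProperty a' := by
  intro u hu hsub
  obtain ⟨w, hwF, hw⟩ := exists_energyForm_eq_inner hlam a x (siteDiff a a' x (grad u x))
  have hgrad : grad u = grad w := by
    refine ha.grad_eq hsub (hwF.sublinear hd) fun z => ?_
    have h1 := gradStar_mulField_sub h (grad u) z
    rw [hu z, sub_zero] at h1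
    rw [h1, ← energyForm_single, hw _ (finiteEnergy_single z 1)]
  have huF : FiniteEnergy u := by unfold FiniteEnergy; rw [hgrad]; exact hwF
  refine eq_of_grad_eq_zero (grad_eq_zero_of_energyForm hlam a' huF ?_)
  have h1 := energyForm_sub_energyForm hlam h huF huF
  have h2 : energyForm a u u = energyForm a w u := by unfold energyForm; rw [hgrad]
  rw [h2, hw u huF] at h1
  linarith

theorem LiouvilleProperty.corrector_unique {d : ℕ} {lam : ℝ} {a : CoeffField d lam} (ha : LiouvilleProperty a)
    {i : Fin d} {φ ψ : Site d → ℝ} (hφ : IsSublinearCorrector a i φ)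
    (hψ : IsSublinearCorrector a i ψ) : φ = ψ := by
  have h1 := ha (φ - ψ) (fun z => ?_) (hφ.2.1.sub hψ.2.1)
  · funext x
    have := h1 x
    simp only [Pi.sub_apply, hφ.2.2, hψ.2.2, sub_self] at this
    linarith
  · have h2 := hφ.1 z
    have h3 := hψ.1 z
    have h4 : grad (φ - ψ) = (fun z => grad φ z + EuclideanSpace.single i (1 : ℝ)) -
        fun z => grad ψ z + EuclideanSpace.single i (1 : ℝ) := by
      rw [grad_sub]; ext z k; simp
    rw [h4, mulField_sub, gradStar_sub, Pi.sub_apply, h2, h3, sub_self]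

theorem LiouvilleProperty.existsUnique {d : ℕ} {lam : ℝ} {a : CoeffField d lam} (ha : LiouvilleProperty a)
    {i : Fin d} {φ : Site d → ℝ} (hφ : IsSublinearCorrector a i φ) :
    ∃! φ : Site d → ℝ, IsSublinearCorrector a i φ :=
  ⟨φ, hφ, fun _ hψ => ha.corrector_unique hψ hφ⟩

theorem LiouvilleProperty.eq_corrector {d : ℕ} {lam : ℝ} {a : CoeffField d lam} (ha : LiouvilleProperty a)
    {i : Fin d} {φ : Site d → ℝ} (hφ : IsSublinearCorrector a i φ) : φ = corrector a i := by
  have h := ha.existsUnique hφ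
  rw [corrector, dif_pos h]
  exact ha.corrector_unique hφ h.choose_spec.1

/-- The change of coefficients creates a source supported at `x`, which is solved in the energy
space of `a'`. The solution is sublinear, so adding it preserves sublinearity; subtracting a
constant restores the anchoring at 0. -/
theorem IsSublinearCorrector.exists_perturbation {d : ℕ} (hd : 0 < d) {lam : ℝ} (hlam : 0 < lam)
    {a a' : CoeffField d lam} {x : Site d} (h : AgreeOff x a a') {i : Fin d} {φ : Site d → ℝ}
    (hφ : IsSublinearCorrector a i φ) : ∃ w : Site d → ℝ, FiniteEnergy w ∧
      IsSublinearCorrector a' i (φ + w) ∧ ∀ v, FiniteEnergy v → energyForm a' w v =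
        inner ℝ (siteDiff a a' x (grad φ x + EuclideanSpace.single i (1 : ℝ))) (grad v x) := by
  obtain ⟨w, hwF, hw⟩ := exists_energyForm_eq_inner hlam a' x
    (siteDiff a a' x (grad φ x + EuclideanSpace.single i (1 : ℝ)))
  have hc := finiteEnergy_const (d := d) (w 0)
  have hg : grad (w - fun _ => w 0) = grad w := by
    rw [grad_sub]; ext z k; simp [grad_apply]
  have hF := hwF.sub hc
  refine ⟨w - fun _ => w 0, hF, ⟨fun z => ?_, hφ.2.1.add (hF.sublinear hd), ?_⟩, fun v hv => ?_⟩
  · have h1 := gradStar_mulField_sub h (fun z => grad φ z + EuclideanSpace.single i (1 : ℝ)) z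
    rw [hφ.1 z] at h1
    have h2 := hw _ (finiteEnergy_single z 1)
    rw [energyForm_single] at h2
    have h3 : (fun z => grad (φ + (w - fun _ => w 0)) z + EuclideanSpace.single i (1 : ℝ)) =
        (fun z => grad φ z + EuclideanSpace.single i (1 : ℝ)) + grad w := by
      rw [grad_add, hg]; ext z k; simp; ring
    rw [h3, mulField_add, gradStar_add, Pi.add_apply]
    linarith
  · simp [hφ.2.2]
  · rw [← hw v hv, energyForm, hg, energyForm]

theorem IsGreenFunction.sublinear {d : ℕ} (hd : 2 ≤ d) {lam : ℝ} {a : CoeffField d lam}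
    {G : Site d → Site d → ℝ} (hG : IsGreenFunction a G) (y : Site d) :
    Sublinear fun z => G z y := by
  rcases hd.eq_or_lt with h | h
  · exact (hG y).2.1 h.symm
  · obtain ⟨M, hM⟩ := (hG y).2.2 h
    exact sublinear_of_bounded hM

/-- The Frobenius norm dominates the operator norm. -/
theorem norm_sum_mul_le {d : ℕ} (f : EuclideanSpace ℝ (Fin d))
    (M : EuclideanSpace ℝ (Fin d × Fin d)) :
    ‖(WithLp.toLp 2 fun l => ∑ k, f k * M (l, k) : EuclideanSpace ℝ (Fin d))‖ ≤ ‖f‖ * ‖M‖ := by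
  refine le_of_sq_le_sq ?_ (by positivity)
  rw [mul_pow, EuclideanSpace.norm_sq_eq, EuclideanSpace.norm_sq_eq, EuclideanSpace.norm_sq_eq,
    Fintype.sum_prod_type, Finset.mul_sum]
  refine Finset.sum_le_sum fun l _ => ?_
  simp only [Real.norm_eq_abs, sq_abs]
  exact Finset.sum_mul_sq_le_sq_mul_sq _ _ _

/-- Moving (a' - a)∇w to the right-hand side replaces ξ by ξ + ∇w(x) and the operator by that of
`a`. Then w agrees, up to a constant, with the combination ∑ f_k D_k of one-edge dipoles at `x`, and
the gradients of these are columns of ∇∇G. -/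
theorem LiouvilleProperty.norm_grad_perturbation_le {d : ℕ} (hd : 2 ≤ d) {lam : ℝ} (hlam : 0 < lam)
    {a a' : CoeffField d lam} (ha : LiouvilleProperty a) {x : Site d} (h : AgreeOff x a a')
    -- `G` is arbitrary: it enters only through its equation and its sublinearity, so the estimate
    -- covers every Green's function.
    {G : Site d → Site d → ℝ} (hG : IsGreenFunction a G) {ξ : EuclideanSpace ℝ (Fin d)}
    {w : Site d → ℝ} (hwF : FiniteEnergy w)
    (hw : ∀ v, FiniteEnergy v → energyForm a' w v = inner ℝ (siteDiff a a' x ξ) (grad v x))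
    (y : Site d) : ‖grad w y‖ ≤ (1 + 1 / lam) * ‖mixedGrad G y x‖ * ‖ξ‖ := by
  -- Energy estimate: test the equation of `w` with `w` and cancel one factor ‖∇w(x)‖.
  have hwx : ‖grad w x‖ ≤ 1 / lam * ‖ξ‖ := by
    have h1 := sum_sq_le_energyForm hlam a' hwF {x}
    rw [Finset.sum_singleton, hw w hwF] at h1
    have h2 := (real_inner_le_norm (siteDiff a a' x ξ) (grad w x)).trans
      (mul_le_mul_of_nonneg_right (norm_siteDiff_le hlam a a' x ξ) (norm_nonneg _))
    rw [one_div, le_inv_mul_iff₀ hlam]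
    rcases (norm_nonneg (grad w x)).eq_or_lt with h0 | h0
    · rw [← h0]; simp
    · refine le_of_mul_le_mul_right ?_ h0
      nlinarith
  set f := siteDiff a a' x (ξ + grad w x) with hf
  have hfn : ‖f‖ ≤ (1 + 1 / lam) * ‖ξ‖ := by
    refine (norm_siteDiff_le hlam a a' x _).trans ((norm_add_le _ _).trans ?_)
    linarith
  have hw' : ∀ v, FiniteEnergy v → energyForm a w v = inner ℝ f (grad v x) := by
    intro v hv
    have h1 := energyForm_sub_energyForm hlam h hwF hv
    rw [hw v hv] at h1
    rw [hf, siteDiff_add, inner_add_left]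
    linarith
  choose D hDF hD using fun k : Fin d =>
    exists_energyForm_eq_inner hlam a x (EuclideanSpace.single k (1 : ℝ))
  -- Both sides are gradients of sublinear solutions with the same right-hand side, so the Liouville
  -- property applies.
  have hDG : ∀ k, grad (D k) = grad ((fun z => G z (x + unit k)) - fun z => G z x) := by
    intro k
    refine ha.grad_eq ((hDF k).sublinear (by omega))
      ((hG.sublinear hd (x + unit k)).sub (hG.sublinear hd x)) fun z => ?_
    rw [gradStar_mulField_grad_sub, (hG _).1, (hG _).1, ← energyForm_single,
      hD k _ (finiteEnergy_single z 1), EuclideanSpace.inner_single_left]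
    simp [grad_apply, Pi.single_apply, eq_comm]
  set W := ∑ k, f k • D k with hW
  have hWF : FiniteEnergy W := FiniteEnergy.sum _ fun k => (hDF k).smul _
  have hWw : ∀ v, FiniteEnergy v → energyForm a W v = inner ℝ f (grad v x) := by
    intro v hv
    rw [hW, energyForm_sum_left hlam a _ (fun k => (hDF k).smul _) hv]
    simp_rw [energyForm_smul_left, hD _ v hv, EuclideanSpace.inner_single_left]
    simp [PiLp.inner_apply, mul_comm]
  have hF := hwF.sub hWF
  have hz := grad_eq_zero_of_energyForm hlam a hF (by
    rw [energyForm_sub_left hlam a hwF hWF hF, hw' _ hF, hWw _ hF, sub_self]) y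
  rw [grad_sub, Pi.sub_apply, sub_eq_zero] at hz
  have hWy : grad W y = WithLp.toLp 2 fun l => ∑ k, f k * mixedGrad G y x (l, k) := by
    ext l
    rw [hW, grad_sum]
    simp only [Finset.sum_apply, grad_smul, Pi.smul_apply, hDG, WithLp.ofLp_sum,
      PiLp.smul_apply, smul_eq_mul]
    refine Finset.sum_congr rfl fun k _ => ?_
    simp only [grad_apply, mixedGrad, Pi.sub_apply]
    ring
  rw [hz, hWy]
  refine (norm_sum_mul_le f _).trans ?_
  calc _ ≤ (1 + 1 / lam) * ‖ξ‖ * ‖mixedGrad G y x‖ := by gcongr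
    _ = _ := by ring

/-- Both competitors are compared with `a` rather than with each other, so that only the Green's
function and the corrector of `a` appear; this costs the factor 2. -/
theorem LiouvilleProperty.lipDeriv_le {d : ℕ} (hd : 2 ≤ d) {lam : ℝ} (hlam : 0 < lam)
    {a : CoeffField d lam} (ha : LiouvilleProperty a) {i : Fin d}
    (hφ : ∃ φ, IsSublinearCorrector a i φ) {G : Site d → Site d → ℝ} (hG : IsGreenFunction a G)
    (x y : Site d) : lipDeriv x (fun b => grad (corrector b i) y) a ≤
      ENNReal.ofReal (2 * (1 + 1 / lam) * ‖mixedGrad G y x‖ *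
        ‖grad (corrector a i) x + EuclideanSpace.single i (1 : ℝ)‖) := by
  obtain ⟨φ, hφ⟩ := hφ
  obtain rfl := ha.eq_corrector hφ
  have key : ∀ a', AgreeOff x a a' → ‖grad (corrector a' i) y - grad (corrector a i) y‖ ≤
      (1 + 1 / lam) * ‖mixedGrad G y x‖ *
        ‖grad (corrector a i) x + EuclideanSpace.single i (1 : ℝ)‖ := by
    intro a' h
    obtain ⟨w, hwF, hcor, hw⟩ := hφ.exists_perturbation (by omega) hlam h
    have h1 := (ha.of_agreeOff (by omega) hlam h).eq_corrector hcor
    rw [← h1, grad_add, Pi.add_apply, add_sub_cancel_left]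
    exact ha.norm_grad_perturbation_le hd hlam h hG hwF hw y
  refine iSup_le fun a' => iSup_le fun a'' => iSup_le fun h' => iSup_le fun h'' => ?_
  refine ENNReal.ofReal_le_ofReal ?_
  rw [← sub_sub_sub_cancel_right _ _ (grad (corrector a i) y)]
  refine (norm_sub_le _ _).trans ?_
  linarith [key a' h', key a'' h'']

/-! ### Local boundedness of harmonic functions -/

theorem le_of_avg_shift {d : ℕ} (f : Site d → ℝ) (T : Finset (Site d)) (r : ℕ) :
    ∑ x ∈ T, (f x - cubeAvg r fun z => f (x + z)) ^ 2 ≤ ((latticeCube d r).card : ℝ)⁻¹ *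
      ∑ z ∈ latticeCube d r, ∑ x ∈ T, (f (x + z) - f x) ^ 2 := by
  rw [Finset.sum_comm, Finset.mul_sum]
  refine Finset.sum_le_sum fun x _ => ?_
  have := sq_avg_sub_avg_le (s := {x}) (Finset.singleton_nonempty x) (latticeCube_nonempty d r)
    f (fun z => f (x + z))
  simpa [cubeAvg] using this

/-- Faber–Krahn inequality. -/
theorem faber_krahn {d : ℕ} {f : Site d → ℝ} {s : Finset (Site d)} (hs : ∀ x ∉ s, f x = 0)
    {r : ℕ} (hr : 4 * s.card ≤ (latticeCube d r).card) {E : ℝ}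
    (hE : ∀ T : ℕ, ∑ x ∈ latticeCube d T, ‖grad f x‖ ^ 2 ≤ E) :
    ∑ x ∈ s, f x ^ 2 ≤ 12 * d * (r : ℝ) ^ 2 * E := by
  classical
  have hE0 : 0 ≤ E := (Finset.sum_nonneg fun _ _ => by positivity).trans (hE 0)
  obtain ⟨S, hS⟩ : ∃ S : ℕ, s ⊆ latticeCube d S := by
    choose S hS using fun x : Site d => exists_mem_latticeCube x
    exact ⟨s.sup S, fun x hx => latticeCube_mono (Finset.le_sup hx) (hS x)⟩
  set A := ∑ x ∈ s, f x ^ 2 with hA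
  set T := latticeCube d (S + r)
  have hN := card_latticeCube_pos d r
  set N : ℝ := ((latticeCube d r).card : ℝ) with hNdef
  have hsum : ∀ U : Finset (Site d), ∑ x ∈ U, f x ^ 2 ≤ A := by
    intro U
    calc ∑ x ∈ U, f x ^ 2 = ∑ x ∈ U ∩ s, f x ^ 2 := by
          refine (Finset.sum_subset Finset.inter_subset_left fun x hx hxs => ?_).symm
          rw [hs x fun h => hxs (Finset.mem_inter.2 ⟨hx, h⟩)]; ring
      _ ≤ A := Finset.sum_le_sum_of_subset_of_nonneg Finset.inter_subset_right
          fun _ _ _ => by positivity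
  -- Shift estimate: in ℓ², `f` is within order r√E of its average over cubes of size r.
  have h1 : ∑ x ∈ T, (f x - cubeAvg r fun z => f (x + z)) ^ 2 ≤ d * (r * (2 * r + 1)) * E := by
    refine (le_of_avg_shift f T r).trans ?_
    rw [inv_mul_le_iff₀ hN, ← nsmul_eq_mul, ← Finset.sum_const]
    refine Finset.sum_le_sum fun z hz => ?_
    refine (sum_sq_shift_sub_le f (S + r) r hz).trans ?_
    gcongr
    exact hE _
  -- A cube of size r has at least four times as many sites as the support, so by Cauchy–Schwarz
  -- these averages carry at most a quarter of `A`; after doubling, half of `A` is absorbed on the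
  -- left.
  have h2 : ∑ x ∈ T, (cubeAvg r fun z => f (x + z)) ^ 2 ≤ N⁻¹ * s.card * A := by
    have hpt : ∀ x, (cubeAvg r fun z => f (x + z)) ^ 2 ≤
        N⁻¹ ^ 2 * (s.card * ∑ z ∈ latticeCube d r, f (x + z) ^ 2) := by
      intro x
      rw [cubeAvg, mul_pow]
      refine mul_le_mul_of_nonneg_left ?_ (by positivity)
      set V := (latticeCube d r).filter fun z => x + z ∈ s
      have e1 : ∑ z ∈ latticeCube d r, f (x + z) = ∑ z ∈ V, f (x + z) := by
        rw [Finset.sum_filter]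
        refine Finset.sum_congr rfl fun z _ => ?_
        split_ifs with h
        · rfl
        · exact hs _ h
      have e2 : ∑ z ∈ V, f (x + z) ^ 2 ≤ ∑ z ∈ latticeCube d r, f (x + z) ^ 2 :=
        Finset.sum_le_sum_of_subset_of_nonneg (Finset.filter_subset _ _) fun _ _ _ => by positivity
      have e3 : V.card ≤ s.card := by
        refine Finset.card_le_card_of_injOn (fun z => x + z) (fun z hz => ?_)
          (add_right_injective x).injOn
        exact (Finset.mem_filter.1 hz).2
      rw [e1]
      refine sq_sum_le_card_mul_sum_sq.trans ?_
      gcongr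
    calc _ ≤ ∑ x ∈ T, N⁻¹ ^ 2 * (s.card * ∑ z ∈ latticeCube d r, f (x + z) ^ 2) :=
          Finset.sum_le_sum fun x _ => hpt x
      _ = N⁻¹ ^ 2 * (s.card * ∑ z ∈ latticeCube d r, ∑ x ∈ T, f (x + z) ^ 2) := by
          rw [Finset.sum_comm (s := latticeCube d r), Finset.mul_sum, Finset.mul_sum]
      _ ≤ N⁻¹ ^ 2 * (s.card * ∑ z ∈ latticeCube d r, A) := by
          gcongr with z _
          rw [← Finset.sum_image (s := T) (f := fun y => f y ^ 2) (g := fun x => x + z)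
            (add_left_injective z).injOn]
          exact hsum _
      _ = _ := by
          rw [Finset.sum_const, nsmul_eq_mul, ← hNdef]
          field_simp
  have h3 : A ≤ 2 * (d * (r * (2 * r + 1)) * E) + 2 * (N⁻¹ * s.card * A) := by
    have e1 : A ≤ ∑ x ∈ T, f x ^ 2 := Finset.sum_le_sum_of_subset_of_nonneg
      (hS.trans (latticeCube_mono (by omega))) fun _ _ _ => by positivity
    have e2 : ∑ x ∈ T, f x ^ 2 ≤ 2 * ∑ x ∈ T, (f x - cubeAvg r fun z => f (x + z)) ^ 2 +
        2 * ∑ x ∈ T, (cubeAvg r fun z => f (x + z)) ^ 2 := by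
      rw [Finset.mul_sum, Finset.mul_sum, ← Finset.sum_add_distrib]
      refine Finset.sum_le_sum fun x _ => ?_
      nlinarith [sq_nonneg (f x - 2 * cubeAvg r fun z => f (x + z))]
    linarith
  have hA0 : 0 ≤ A := Finset.sum_nonneg fun _ _ => by positivity
  have h4 : N⁻¹ * s.card ≤ 1 / 4 := by
    rw [inv_mul_le_iff₀ hN]
    have : (4 * s.card : ℝ) ≤ N := by rw [hNdef]; exact_mod_cast hr
    linarith
  have h5 : N⁻¹ * s.card * A ≤ 1 / 4 * A := by gcongr
  have h6 : (r : ℝ) * (2 * r + 1) ≤ 3 * (r : ℝ) ^ 2 := by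
    rcases Nat.eq_zero_or_pos r with h0 | h0
    · subst h0; simp
    · have : (1 : ℝ) ≤ r := by exact_mod_cast h0
      nlinarith
  have h7 : d * (r * (2 * r + 1)) * E ≤ d * (3 * (r : ℝ) ^ 2) * E := by gcongr
  linarith

theorem hasSum_inner_grad {d : ℕ} (F : Site d → EuclideanSpace ℝ (Fin d)) {g : Site d → ℝ}
    {s : Finset (Site d)} (hg : ∀ x ∉ s, g x = 0) :
    HasSum (fun x => inner ℝ (F x) (grad g x)) (∑ z ∈ s, g z * gradStar F z) := by
  have h1 : g = ∑ z ∈ s, g z • Pi.single z (1 : ℝ) := by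
    ext x
    rw [Finset.sum_apply]
    simp only [Pi.smul_apply, Pi.single_apply, smul_eq_mul, mul_ite, mul_one, mul_zero]
    rw [Finset.sum_ite_eq]
    split_ifs with h
    · rfl
    · exact hg x h
  have h2 : ∀ x, inner ℝ (F x) (grad g x) =
      ∑ z ∈ s, g z * inner ℝ (F x) (grad (Pi.single z (1 : ℝ)) x) := by
    intro x
    conv_lhs => rw [h1, grad_sum]
    rw [Finset.sum_apply, inner_sum]
    refine Finset.sum_congr rfl fun z _ => ?_
    rw [grad_smul, Pi.smul_apply, inner_smul_right]
  simp_rw [h2]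
  exact hasSum_sum fun z _ => (hasSum_inner_grad_single F z).mul_left _

theorem add_unit_mem_latticeCube {d S : ℕ} {x : Site d} {k : Fin d} (hx : x ∈ latticeCube d S) :
    x + unit k ∈ latticeCube d (S + 1) := by
  refine add_mem_latticeCube hx (mem_latticeCube.2 fun j => ?_)
  by_cases h : j = k
  · subst h; simp [unit]
  · simp [unit, h]

theorem mem_latticeCube_of_add_unit {d S : ℕ} {x : Site d} {k : Fin d}
    (hx : x + unit k ∈ latticeCube d S) : x ∈ latticeCube d (S + 1) := by
  have h : -unit k ∈ latticeCube d 1 := by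
    refine neg_mem_latticeCube (mem_latticeCube.2 fun j => ?_)
    by_cases h : j = k
    · subst h; simp [unit]
    · simp [unit, h]
  simpa using add_mem_latticeCube hx h

/-- Caccioppoli inequality for nonnegative subsolutions. -/
theorem caccioppoli {d : ℕ} {lam : ℝ} (hlam : 0 < lam) (a : CoeffField d lam) {v η : Site d → ℝ}
    (hv0 : ∀ x, 0 ≤ v x) (hv : ∀ x, gradStar (mulField a (grad v)) x ≤ 0) {S : ℕ} {κ : ℝ}
    (hη : ∀ x ∉ latticeCube d S, η x = 0) (hκ : ∀ x k, (η (x + unit k) - η x) ^ 2 ≤ κ) (T : ℕ) :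
    ∑ x ∈ latticeCube d T, ‖grad (fun x => η x * v x) x‖ ^ 2 ≤
      d * κ / lam * ∑ x ∈ latticeCube d (S + 1), v x ^ 2 := by
  classical
  set g : Site d → ℝ := fun x => η x ^ 2 * v x with hg
  set f : Site d → ℝ := fun x => η x * v x with hf
  set e : Site d → Fin d → ℝ := fun x k =>
    (a x k : ℝ) * (v x * v (x + unit k) * (η (x + unit k) - η x) ^ 2) with he
  have hout : ∀ x ∉ latticeCube d (S + 1), η x = 0 ∧ ∀ k, η (x + unit k) = 0 := fun x hx =>
    ⟨hη x fun h => hx (latticeCube_mono (by omega) h),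
      fun k => hη _ fun h => hx (mem_latticeCube_of_add_unit h)⟩
  -- Exact discrete product rule with test function η²v: the only error is the product of the two
  -- endpoint values of v with the squared increment of η.
  have hid : ∀ x, inner ℝ (mulField a (grad f) x) (grad f x) =
      inner ℝ (mulField a (grad v) x) (grad g x) + ∑ k, e x k := by
    intro x
    rw [inner_mulField, inner_mulField, ← Finset.sum_add_distrib]
    refine Finset.sum_congr rfl fun k _ => ?_
    simp only [grad_apply, hf, hg, he]
    ring
  have hpair : ∑ x ∈ latticeCube d (S + 1), inner ℝ (mulField a (grad v) x) (grad g x) ≤ 0 := by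
    have h1 := hasSum_inner_grad (mulField a (grad v)) (g := g) (s := latticeCube d S)
      (fun x hx => by simp [hg, hη x hx])
    have h2 : HasSum (fun x => inner ℝ (mulField a (grad v) x) (grad g x))
        (∑ x ∈ latticeCube d (S + 1), inner ℝ (mulField a (grad v) x) (grad g x)) := by
      refine hasSum_sum_of_ne_finset_zero fun x hx => ?_
      have : grad g x = 0 := by
        ext k; simp [grad_apply, hg, (hout x hx).1, (hout x hx).2 k]
      rw [this, inner_zero_right]
    rw [h2.unique h1]
    exact Finset.sum_nonpos fun z _ =>
      mul_nonpos_of_nonneg_of_nonpos (mul_nonneg (sq_nonneg _) (hv0 z)) (hv z)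
  have hκ0 : ∀ (_ : Fin d), 0 ≤ κ := fun k => (sq_nonneg _).trans (hκ 0 k)
  have hek : ∀ k, ∑ x ∈ latticeCube d (S + 1), e x k ≤
      κ * ∑ x ∈ latticeCube d (S + 1), v x ^ 2 := by
    intro k
    have hle : ∀ x ∈ latticeCube d (S + 1), e x k ≤ κ / 2 * v x ^ 2 + κ / 2 *
        (if x + unit k ∈ latticeCube d (S + 1) then v (x + unit k) ^ 2 else 0) := by
      intro x hx
      have hx0 := hv0 x
      have hx1 := hv0 (x + unit k)
      have hκk := hκ0 k
      by_cases h : x + unit k ∈ latticeCube d (S + 1)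
      · rw [if_pos h]
        have h1 : v x * v (x + unit k) * (η (x + unit k) - η x) ^ 2 ≤
            v x * v (x + unit k) * κ := by gcongr; exact hκ x k
        have h2 : e x k ≤ v x * v (x + unit k) * κ := by
          refine le_trans ?_ h1
          exact mul_le_of_le_one_left (by positivity) (a x k).2.2.le
        nlinarith [mul_nonneg hκk (sq_nonneg (v x - v (x + unit k)))]
      -- If the edge leaves the cube of size S + 1, then η vanishes at both its ends.
      · rw [if_neg h]
        have h1 : η (x + unit k) = 0 := hη _ fun h' => h (latticeCube_mono (by omega) h')
        have h2 : η x = 0 := hη _ fun h' => h (add_unit_mem_latticeCube h')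
        simp only [he, h1, h2]
        simp
        positivity
    refine (Finset.sum_le_sum hle).trans ?_
    rw [Finset.sum_add_distrib, ← Finset.mul_sum, ← Finset.mul_sum, ← Finset.sum_filter]
    have h3 := sum_comp_le_sum (s := (latticeCube d (S + 1)).filter fun x =>
      x + unit k ∈ latticeCube d (S + 1)) (t := latticeCube d (S + 1)) (e := fun x => x + unit k)
      (add_left_injective _) (fun x hx => (Finset.mem_filter.1 hx).2) (f := fun x => v x ^ 2)
      (fun _ => by positivity)
    have h4 := mul_le_mul_of_nonneg_left h3 (show 0 ≤ κ / 2 by have := hκ0 k; positivity)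
    linarith
  have hmain : lam * ∑ x ∈ latticeCube d (S + 1), ‖grad f x‖ ^ 2 ≤
      d * κ * ∑ x ∈ latticeCube d (S + 1), v x ^ 2 := by
    rw [Finset.mul_sum]
    calc _ ≤ ∑ x ∈ latticeCube d (S + 1), (inner ℝ (mulField a (grad v) x) (grad g x) +
          ∑ k, e x k) := Finset.sum_le_sum fun x _ => by
            rw [← hid]; exact le_inner_mulField_self a f x
      _ ≤ 0 + ∑ k, ∑ x ∈ latticeCube d (S + 1), e x k := by
          rw [Finset.sum_add_distrib, Finset.sum_comm (s := latticeCube d (S + 1))]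
          gcongr
      _ ≤ ∑ k : Fin d, κ * ∑ x ∈ latticeCube d (S + 1), v x ^ 2 := by
          rw [zero_add]; exact Finset.sum_le_sum fun k _ => hek k
      _ = _ := by rw [Finset.sum_const, Finset.card_univ, Fintype.card_fin, nsmul_eq_mul]; ring
  have hT : ∑ x ∈ latticeCube d T, ‖grad f x‖ ^ 2 ≤
      ∑ x ∈ latticeCube d (S + 1), ‖grad f x‖ ^ 2 := by
    calc _ = ∑ x ∈ latticeCube d T ∩ latticeCube d (S + 1), ‖grad f x‖ ^ 2 := by
          refine (Finset.sum_subset Finset.inter_subset_left fun x hx hxs => ?_).symm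
          have hx' := hout x fun h => hxs (Finset.mem_inter.2 ⟨hx, h⟩)
          have : grad f x = 0 := by ext k; simp [grad_apply, hf, hx'.1, hx'.2 k]
          simp [this]
      _ ≤ _ := Finset.sum_le_sum_of_subset_of_nonneg Finset.inter_subset_right
          fun _ _ _ => by positivity
  refine hT.trans ?_
  rw [div_mul_eq_mul_div, le_div_iff₀ hlam]
  linarith

theorem gradStar_mulField_grad {d : ℕ} {lam : ℝ} (a : CoeffField d lam) (u : Site d → ℝ)
    (x : Site d) : gradStar (mulField a (grad u)) x =
      ∑ k, ((a (x - unit k) k : ℝ) * (u x - u (x - unit k)) +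
        (a x k : ℝ) * (u x - u (x + unit k))) := by
  simp only [gradStar, mulField, grad_apply, sub_add_cancel]
  exact Finset.sum_congr rfl fun k _ => by ring

/-- Comparison at one site: c v plus a constant touches w from below at `x`, so w inherits the sign.
The slopes c = 0, 1, -1 give positive parts and absolute values. -/
theorem gradStar_nonpos_of_le {d : ℕ} {lam : ℝ} (hlam : 0 < lam) (a : CoeffField d lam)
    {v w : Site d → ℝ} {x : Site d} {c : ℝ} (h : ∀ y, w x - w y ≤ c * (v x - v y))
    (hv : c * gradStar (mulField a (grad v)) x ≤ 0) :
    gradStar (mulField a (grad w)) x ≤ 0 := by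
  refine le_trans ?_ hv
  rw [gradStar_mulField_grad, gradStar_mulField_grad, Finset.mul_sum]
  refine Finset.sum_le_sum fun k _ => ?_
  have h1 := mul_le_mul_of_nonneg_left (h (x - unit k)) (coeff_pos hlam a (x - unit k) k).le
  have h2 := mul_le_mul_of_nonneg_left (h (x + unit k)) (coeff_pos hlam a x k).le
  linarith

theorem gradStar_posPart_nonpos {d : ℕ} {lam : ℝ} (hlam : 0 < lam) (a : CoeffField d lam)
    {v : Site d → ℝ} (hv : ∀ x, gradStar (mulField a (grad v)) x ≤ 0) (k : ℝ) (x : Site d) :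
    gradStar (mulField a (grad fun y => max (v y - k) 0)) x ≤ 0 := by
  rcases le_total (v x - k) 0 with h | h
  · refine gradStar_nonpos_of_le hlam a (v := v) (c := 0) (fun y => ?_) (by simp)
    rw [max_eq_right h]
    simp
  · refine gradStar_nonpos_of_le hlam a (v := v) (c := 1) (fun y => ?_) (by simpa using hv x)
    rw [max_eq_left h]
    have := le_max_left (v y - k) 0
    linarith

theorem gradStar_abs_nonpos {d : ℕ} {lam : ℝ} (hlam : 0 < lam) (a : CoeffField d lam)
    {u : Site d → ℝ} (hu : ∀ x, gradStar (mulField a (grad u)) x = 0) (x : Site d) :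
    gradStar (mulField a (grad fun y => |u y|)) x ≤ 0 := by
  rcases le_total 0 (u x) with h | h
  · refine gradStar_nonpos_of_le hlam a (v := u) (c := 1) (fun y => ?_) (by simp [hu x])
    rw [abs_of_nonneg h]
    have := le_abs_self (u y)
    linarith
  · refine gradStar_nonpos_of_le hlam a (v := u) (c := -1) (fun y => ?_) (by simp [hu x])
    rw [abs_of_nonpos h]
    have := neg_abs_le (u y)
    linarith

theorem mem_latticeCube_iff_norm {d S : ℕ} {x : Site d} : x ∈ latticeCube d S ↔ ‖x‖ ≤ S := by
  rw [mem_latticeCube, pi_norm_le_iff_of_nonneg (by positivity)]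
  refine forall_congr' fun k => ?_
  rw [Int.norm_eq_abs]
  exact_mod_cast Iff.rfl

/-- A linear ramp in the sup norm. It vanishes already outside the cube of size S - 1, because
`caccioppoli` enlarges the support by one layer and the result should fit into the cube of size S.
-/
theorem exists_cutoff {d r S : ℕ} (hrS : r < S) : ∃ η : Site d → ℝ,
    (∀ x ∈ latticeCube d r, η x = 1) ∧ (∀ x ∉ latticeCube d (S - 1), η x = 0) ∧
    (∀ x, |η x| ≤ 1) ∧
    ∀ x k, (η (x + unit k) - η x) ^ 2 ≤ (((S : ℝ) - r) ^ 2)⁻¹ := by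
  have hpos : (0 : ℝ) < S - r := by
    have : (r : ℝ) < S := by exact_mod_cast hrS
    linarith
  refine ⟨fun x => max 0 (min 1 (((S : ℝ) - ‖x‖) / (S - r))), fun x hx => ?_, fun x hx => ?_,
    fun x => ?_, fun x k => ?_⟩
  · rw [mem_latticeCube_iff_norm] at hx
    have : 1 ≤ ((S : ℝ) - ‖x‖) / (S - r) := by rw [le_div_iff₀ hpos]; linarith
    simp [this]
  · have : (S : ℝ) ≤ ‖x‖ := by
      have h1 : ¬ ∀ k, |x k| ≤ ((S - 1 : ℕ) : ℤ) := fun h => hx (mem_latticeCube.2 h)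
      push Not at h1
      obtain ⟨k, hk⟩ := h1
      refine le_trans ?_ (norm_le_pi_norm x k)
      rw [Int.norm_eq_abs]
      have : (S : ℤ) ≤ |x k| := by omega
      exact_mod_cast this
    have : ((S : ℝ) - ‖x‖) / (S - r) ≤ 0 := div_nonpos_of_nonpos_of_nonneg (by linarith) hpos.le
    simp [this]
  · rw [abs_of_nonneg (le_max_left _ _)]
    exact max_le zero_le_one (min_le_left _ _)
  · rw [← inv_pow, ← sq_abs]
    gcongr
    refine (abs_max_sub_max_le_max _ _ _ _).trans ?_
    rw [sub_self, abs_zero, max_eq_right (abs_nonneg _)]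
    refine (abs_min_sub_min_le_max _ _ _ _).trans ?_
    rw [sub_self, abs_zero, max_eq_right (abs_nonneg _), ← sub_div, abs_div, abs_of_pos hpos,
      inv_eq_one_div]
    gcongr
    rw [sub_sub_sub_cancel_left]
    refine (abs_norm_sub_norm_le _ _).trans ?_
    rw [sub_add_cancel_left, norm_neg, unit, Pi.norm_single]
    simp

/-- One step of the De Giorgi iteration. -/
theorem deGiorgi_step {d : ℕ} {lam : ℝ} (hlam : 0 < lam) (a : CoeffField d lam) {v : Site d → ℝ}
    (hv : ∀ x, gradStar (mulField a (grad v)) x ≤ 0) {r S ρ : ℕ} (hrS : r < S) {k k' : ℝ}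
    (hk : k < k') (hρ : 4 * ∑ x ∈ latticeCube d S, max (v x - k) 0 ^ 2 ≤
      (k' - k) ^ 2 * (latticeCube d ρ).card) :
    ∑ x ∈ latticeCube d r, max (v x - k') 0 ^ 2 ≤
      12 * d ^ 2 / lam * ((ρ : ℝ) ^ 2 * (((S : ℝ) - r) ^ 2)⁻¹) *
        ∑ x ∈ latticeCube d S, max (v x - k) 0 ^ 2 := by
  classical
  obtain ⟨η, hη1, hη0, hηb, hηκ⟩ := exists_cutoff (d := d) hrS
  set w : Site d → ℝ := fun x => max (v x - k') 0 with hw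
  set A := ∑ x ∈ latticeCube d S, max (v x - k) 0 ^ 2 with hA
  have hcacc := caccioppoli hlam a (v := w) (fun x => le_max_right _ _)
    (gradStar_posPart_nonpos hlam a hv k') hη0 hηκ
  rw [Nat.sub_add_cancel (by omega)] at hcacc
  set s := (latticeCube d S).filter fun x => k' < v x with hs
  have hsf : ∀ x ∉ s, η x * w x = 0 := by
    intro x hx
    by_cases h1 : x ∈ latticeCube d S
    · have : ¬ k' < v x := fun h => hx (Finset.mem_filter.2 ⟨h1, h⟩)
      have : w x = 0 := max_eq_right (by linarith)
      rw [this, mul_zero]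
    · rw [hη0 x fun h => h1 (latticeCube_mono (by omega) h), zero_mul]
  -- Chebyshev's inequality on {v > k'}; it supplies the small support needed in `faber_krahn`.
  have hcard : (k' - k) ^ 2 * s.card ≤ A := by
    rw [mul_comm, ← nsmul_eq_mul, ← Finset.sum_const]
    refine (Finset.sum_le_sum fun x hx => ?_).trans (Finset.sum_le_sum_of_subset_of_nonneg
      (Finset.filter_subset _ _) fun _ _ _ => sq_nonneg _)
    have h1 := (Finset.mem_filter.1 hx).2
    have h2 := le_max_left (v x - k) 0
    have h3 : 0 ≤ k' - k := by linarith
    gcongr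
    linarith
  have hcard' : 4 * s.card ≤ (latticeCube d ρ).card := by
    have h1 : 0 < (k' - k) ^ 2 := by
      have : 0 < k' - k := by linarith
      positivity
    have h2 : (k' - k) ^ 2 * (4 * s.card) ≤ (k' - k) ^ 2 * ((latticeCube d ρ).card : ℝ) := by
      linarith
    exact_mod_cast le_of_mul_le_mul_left h2 h1
  have hfk := faber_krahn hsf hcard' hcacc
  have hwA : ∑ x ∈ latticeCube d S, w x ^ 2 ≤ A := by
    refine Finset.sum_le_sum fun x _ => ?_
    have : w x ≤ max (v x - k) 0 := max_le_max (by linarith) le_rfl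
    have : 0 ≤ w x := le_max_right _ _
    gcongr
  have hleft : ∑ x ∈ latticeCube d r, w x ^ 2 ≤ ∑ x ∈ s, (η x * w x) ^ 2 := by
    calc ∑ x ∈ latticeCube d r, w x ^ 2 = ∑ x ∈ latticeCube d r, (η x * w x) ^ 2 :=
          Finset.sum_congr rfl fun x hx => by rw [hη1 x hx, one_mul]
      _ = ∑ x ∈ latticeCube d r ∩ s, (η x * w x) ^ 2 := by
          refine (Finset.sum_subset Finset.inter_subset_left fun x hx hxs => ?_).symm
          rw [hsf x fun h => hxs (Finset.mem_inter.2 ⟨hx, h⟩)]; ring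
      _ ≤ _ := Finset.sum_le_sum_of_subset_of_nonneg Finset.inter_subset_right
          fun _ _ _ => sq_nonneg _
  refine hleft.trans (hfk.trans ?_)
  calc _ ≤ 12 * d * (ρ : ℝ) ^ 2 * (d * (((S : ℝ) - r) ^ 2)⁻¹ / lam * A) := by gcongr
    _ = _ := by ring

/-- The levels K(1 - 2^{-j}) increase while the cubes of size 2^N + 2^{N-j} shrink. The Faber–Krahn
scale is kept 2^m times smaller than the width of the shrinking layer, so each step gains 4^{-m}
against the fixed Caccioppoli constants, that is, at least a factor 4^{-d}. The iteration runs only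
while j + m ≤ N, since that scale cannot go below the lattice spacing. -/
theorem deGiorgi_iterate {d : ℕ} (hd : 2 ≤ d) {lam : ℝ} (hlam : 0 < lam) {m : ℕ}
    (hm : 12 * (d : ℝ) ^ 2 / lam * 4 ^ (d + 1) ≤ 4 ^ m) (a : CoeffField d lam) {v : Site d → ℝ}
    (hv : ∀ x, gradStar (mulField a (grad v)) x ≤ 0) {N : ℕ} {K : ℝ} (hK : 0 < K)
    (h0 : 2 ^ (m * d + d + 4) * ∑ x ∈ latticeCube d (2 ^ (N + 1)), max (v x) 0 ^ 2 ≤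
      2 ^ (N * d) * K ^ 2) (j : ℕ) (hj : j + m ≤ N) :
    ∑ x ∈ latticeCube d (2 ^ N + 2 ^ (N - j)), max (v x - K * (1 - (2 ^ j)⁻¹)) 0 ^ 2 ≤
      (4 ^ (d * j))⁻¹ * ∑ x ∈ latticeCube d (2 ^ (N + 1)), max (v x) 0 ^ 2 := by
  set A0 := ∑ x ∈ latticeCube d (2 ^ (N + 1)), max (v x) 0 ^ 2 with hA0
  induction j with
  | zero =>
    simp [hA0, pow_succ, mul_two]
  | succ j ih =>
    have ih' := ih (by omega)
    obtain ⟨q, rfl⟩ := Nat.exists_eq_add_of_le (show j + 1 + m ≤ N from hj)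
    have e1 : j + 1 + m + q - (j + 1) = m + q := by omega
    have e2 : j + 1 + m + q - j = m + q + 1 := by omega
    rw [e2] at ih'
    rw [e1]
    have hA0nn : 0 ≤ A0 := Finset.sum_nonneg fun _ _ => by positivity
    have hkk : K * (1 - (2 ^ (j + 1))⁻¹) - K * (1 - (2 ^ j)⁻¹) = K * (2 ^ (j + 1))⁻¹ := by
      rw [pow_succ]; field_simp; ring
    have hrS : 2 ^ (j + 1 + m + q) + 2 ^ (m + q) < 2 ^ (j + 1 + m + q) + 2 ^ (m + q + 1) := by
      have : 0 < 2 ^ (m + q) := by positivity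
      rw [pow_succ]; omega
    have hSr : (((2 ^ (j + 1 + m + q) + 2 ^ (m + q + 1) : ℕ) : ℝ) -
        ((2 ^ (j + 1 + m + q) + 2 ^ (m + q) : ℕ) : ℝ)) = 2 ^ (m + q) := by
      push_cast; ring
    have hstep := deGiorgi_step hlam a hv (ρ := 2 ^ q) hrS
      (k := K * (1 - (2 ^ j)⁻¹)) (k' := K * (1 - (2 ^ (j + 1))⁻¹)) ?_ ?_
    · refine hstep.trans ?_
      rw [hSr]
      have h1 : 12 * (d : ℝ) ^ 2 / lam * (((2 ^ q : ℕ) : ℝ) ^ 2 * (((2 : ℝ) ^ (m + q)) ^ 2)⁻¹) ≤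
          (4 ^ d)⁻¹ := by
        have h2 : (((2 ^ q : ℕ) : ℝ) ^ 2 * (((2 : ℝ) ^ (m + q)) ^ 2)⁻¹) = (4 ^ m)⁻¹ := by
          push_cast
          rw [pow_add, mul_pow, show (4 : ℝ) ^ m = (2 ^ m) ^ 2 by
            rw [← pow_mul, mul_comm, pow_mul]; norm_num]
          field_simp
        rw [h2, ← div_eq_mul_inv, div_le_iff₀ (by positivity), inv_mul_eq_div,
          le_div_iff₀ (by positivity)]
        refine le_trans ?_ hm
        gcongr <;> norm_num
      refine (mul_le_mul h1 ih' (Finset.sum_nonneg fun _ _ => by positivity)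
        (by positivity)).trans (le_of_eq ?_)
      rw [← mul_assoc, ← mul_inv, ← pow_add]
      ring_nf
    · have : 0 < K * (2 ^ (j + 1) : ℝ)⁻¹ := by positivity
      linarith
    · rw [hkk]
      have h1 : (2 : ℝ) ^ (q * d) ≤ (latticeCube d (2 ^ q)).card := by
        refine le_trans (le_of_eq ?_) (pow_le_card_latticeCube d _)
        push_cast; rw [pow_mul]
      refine (mul_le_mul_of_nonneg_left ih' (by norm_num)).trans ?_
      refine le_trans ?_ (mul_le_mul_of_nonneg_left h1 (by positivity))
      have h2 : A0 ≤ 2 ^ ((j + 1 + m + q) * d) * K ^ 2 / 2 ^ (m * d + d + 4) := by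
        rw [le_div_iff₀ (by positivity)]; linarith
      -- The exponent md + d + 4 in `h0` is what makes the powers cancel here; a factor 2^{2j - dj}
      -- is left over.
      have h3 : (4 : ℝ) * ((4 ^ (d * j))⁻¹ *
          (2 ^ ((j + 1 + m + q) * d) * K ^ 2 / 2 ^ (m * d + d + 4))) =
          (K * (2 ^ (j + 1))⁻¹) ^ 2 * 2 ^ (q * d) * (2 ^ (2 * j) / 2 ^ (d * j)) := by
        have e4 : (4 : ℝ) ^ (d * j) = 2 ^ (d * j) * 2 ^ (d * j) := by
          rw [← mul_pow]; norm_num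
        have e5 : (j + 1 + m + q) * d = d * j + d + m * d + q * d := by ring
        rw [e4, e5]
        simp only [pow_add]
        field_simp
        ring
      -- For d ≥ 2 the decay of the excess outweighs both the squared level gaps and the shrinking
      -- comparison volume.
      have h6 : (2 : ℝ) ^ (2 * j) / 2 ^ (d * j) ≤ 1 := by
        rw [div_le_one (by positivity)]
        exact pow_le_pow_right₀ (by norm_num) (Nat.mul_le_mul_right j hd)
      calc _ ≤ (4 : ℝ) * ((4 ^ (d * j))⁻¹ *
            (2 ^ ((j + 1 + m + q) * d) * K ^ 2 / 2 ^ (m * d + d + 4))) := by gcongr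
        _ ≤ (K * (2 ^ (j + 1))⁻¹) ^ 2 * 2 ^ (q * d) * 1 := by
          rw [h3]; gcongr
        _ = _ := mul_one _

/-- Local boundedness: the mean value inequality for subsolutions. -/
theorem exists_mean_value_bound {d : ℕ} (hd : 2 ≤ d) {lam : ℝ} (hlam : 0 < lam) :
    ∃ (C : ℝ) (m : ℕ), 0 < C ∧ ∀ (a : CoeffField d lam) (v : Site d → ℝ),
      (∀ x, 0 ≤ v x) → (∀ x, gradStar (mulField a (grad v)) x ≤ 0) → ∀ N : ℕ, m ≤ N →
        2 ^ (N * d) * v 0 ^ 2 ≤ C * ∑ x ∈ latticeCube d (2 ^ (N + 1)), v x ^ 2 := by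
  obtain ⟨m, hm⟩ := pow_unbounded_of_one_lt (12 * (d : ℝ) ^ 2 / lam * 4 ^ (d + 1))
    (show (1 : ℝ) < 4 by norm_num)
  refine ⟨4 * 2 ^ (m * d + d + 4), m, by positivity, fun a v hv0 hv N hN => ?_⟩
  set A := ∑ x ∈ latticeCube d (2 ^ (N + 1)), v x ^ 2 with hA
  have hA0 : A = ∑ x ∈ latticeCube d (2 ^ (N + 1)), max (v x) 0 ^ 2 :=
    Finset.sum_congr rfl fun x _ => by rw [max_eq_left (hv0 x)]
  have hmem : ∀ n, (0 : Site d) ∈ latticeCube d n := fun n => mem_latticeCube.2 (by simp)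
  have hvA : v 0 ^ 2 ≤ A :=
    Finset.single_le_sum (f := fun x => v x ^ 2) (fun _ _ => sq_nonneg _) (hmem _)
  rcases (show 0 ≤ A from (sq_nonneg _).trans hvA).eq_or_lt with h0 | h0
  · rw [← h0] at hvA ⊢
    have : v 0 ^ 2 = 0 := le_antisymm hvA (sq_nonneg _)
    rw [this]; simp
  -- The smallest K for which the starting condition of the iteration holds, namely with equality.
  set K := Real.sqrt (2 ^ (m * d + d + 4) * A / 2 ^ (N * d)) with hK
  have hKsq : K ^ 2 = 2 ^ (m * d + d + 4) * A / 2 ^ (N * d) := Real.sq_sqrt (by positivity)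
  have hKpos : 0 < K := Real.sqrt_pos.2 (by positivity)
  have hit := deGiorgi_iterate hd hlam hm.le a hv (N := N) (K := K) hKpos (by
    rw [← hA0, hKsq]; field_simp; exact le_rfl) (N - m) (by omega)
  rw [← hA0] at hit
  -- After N - m steps the whole remaining sum is at most K², so its single term at the origin is
  -- too.
  have h1 : max (v 0 - K * (1 - (2 ^ (N - m))⁻¹)) 0 ^ 2 ≤ K ^ 2 := by
    refine (Finset.single_le_sum (f := fun x => max (v x - K * (1 - (2 ^ (N - m))⁻¹)) 0 ^ 2)
      (fun _ _ => sq_nonneg _) (hmem _)).trans (hit.trans ?_)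
    rw [hKsq, inv_mul_eq_div, div_le_div_iff₀ (by positivity) (by positivity)]
    have h2 : (2 : ℝ) ^ (N * d) ≤ 2 ^ (m * d + d + 4) * 4 ^ (d * (N - m)) := by
      have : (4 : ℝ) ^ (d * (N - m)) = 2 ^ (2 * (d * (N - m))) := by
        rw [pow_mul 2]; norm_num
      rw [this, ← pow_add]
      apply pow_le_pow_right₀ (by norm_num)
      obtain ⟨q, rfl⟩ := Nat.exists_eq_add_of_le hN
      rw [Nat.add_sub_cancel_left]
      nlinarith
    calc A * 2 ^ (N * d) ≤ A * (2 ^ (m * d + d + 4) * 4 ^ (d * (N - m))) := by gcongr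
      _ = _ := by ring
  have h2 : v 0 ≤ 2 * K := by
    have h3 := abs_le_of_sq_le_sq h1 hKpos.le
    have h4 := (le_max_left (v 0 - K * (1 - (2 ^ (N - m))⁻¹)) 0).trans ((le_abs_self _).trans h3)
    have h5 : 0 ≤ K * ((2 : ℝ) ^ (N - m))⁻¹ := by positivity
    linarith
  calc 2 ^ (N * d) * v 0 ^ 2 ≤ 2 ^ (N * d) * (2 * K) ^ 2 := by
        gcongr
        exact hv0 0
    _ = 2 ^ (N * d) * (4 * K ^ 2) := by ring
    _ = _ := by rw [hKsq]; field_simp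

theorem gradStar_shift {d : ℕ} {lam : ℝ} (a : CoeffField d lam) (u : Site d → ℝ) (x z : Site d) :
    gradStar (mulField (shift x a) (grad fun y => u (y + x))) z =
      gradStar (mulField a (grad u)) (z + x) := by
  rw [gradStar_mulField_grad, gradStar_mulField_grad]
  refine Finset.sum_congr rfl fun k _ => ?_
  simp only [shift, sub_add_eq_add_sub, add_right_comm]

/-- The squared Euclidean length of a lattice site. -/
def siteSq {d : ℕ} (x : Site d) : ℝ := ∑ k, (x k : ℝ) ^ 2

theorem exists_cube_sq_le_siteSq {d : ℕ} (x : Site d) :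
    ∃ R : ℕ, x ∈ latticeCube d R ∧ (R : ℝ) ^ 2 ≤ siteSq x := by
  rcases isEmpty_or_nonempty (Fin d) with hd | hd
  · exact ⟨0, mem_latticeCube.2 fun k => hd.elim k, by simp [siteSq]⟩
  · obtain ⟨k, -, hk⟩ := Finset.exists_mem_eq_sup (Finset.univ : Finset (Fin d))
      Finset.univ_nonempty fun k => (x k).natAbs
    refine ⟨(x k).natAbs, mem_latticeCube.2 fun j => ?_, ?_⟩
    · rw [Int.abs_eq_natAbs, ← hk]
      exact_mod_cast Finset.le_sup (f := fun k => (x k).natAbs) (Finset.mem_univ j)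
    · have h1 : (((x k).natAbs : ℕ) : ℝ) ^ 2 = (x k : ℝ) ^ 2 := by
        rw [Nat.cast_natAbs, Int.cast_abs, sq_abs]
      rw [h1]
      exact Finset.single_le_sum (f := fun k => (x k : ℝ) ^ 2) (fun _ _ => sq_nonneg _)
        (Finset.mem_univ k)

/-- Sublinear harmonic functions grow sublinearly pointwise. -/
theorem Sublinear.pointwise {d : ℕ} (hd : 2 ≤ d) {lam : ℝ} (hlam : 0 < lam)
    {a : CoeffField d lam} {u : Site d → ℝ} (hu : ∀ z, gradStar (mulField a (grad u)) z = 0)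
    (hsub : Sublinear u) {ε : ℝ} (hε : 0 < ε) : ∃ B : ℝ, 0 ≤ B ∧ ∀ x, u x ^ 2 ≤ ε * siteSq x + B := by
  obtain ⟨C, m, hC, hmean⟩ := exists_mean_value_bound hd hlam
  -- C comes from the mean value inequality, 16 and 9^d from the squared size and the volume of the
  -- cube of size 2^{N+2}, and 4 from rounding R up to a power of two.
  set ε' := ε / (C * 16 * 9 ^ d * 4) with hε'
  have hε'pos : 0 < ε' := by positivity
  obtain ⟨R0, hR0⟩ := eventually_atTop.1 (hsub.eventually_lt_const hε'pos)
  set N0 := m + R0 with hN0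
  refine ⟨ε * (1 + 4 ^ N0), by positivity, fun x => ?_⟩
  obtain ⟨R, hxR, hR⟩ := exists_cube_sq_le_siteSq x
  set N := max N0 (Nat.clog 2 R) with hN
  have hRN : R ≤ 2 ^ N := (Nat.le_pow_clog (by norm_num) R).trans
    (Nat.pow_le_pow_right (by norm_num) (by omega))
  -- The mean value inequality at `x`: |u(· + x)| is a subsolution for the shifted coefficients.
  have h1 := hmean (shift x a) (fun y => |u (y + x)|) (fun _ => abs_nonneg _) (fun z => by
    refine gradStar_abs_nonpos hlam _ (fun z => ?_) z
    rw [gradStar_shift, hu]) N (by omega)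
  simp only [zero_add, sq_abs] at h1
  have h2 : ∑ y ∈ latticeCube d (2 ^ (N + 1)), u (y + x) ^ 2 ≤
      ∑ y ∈ latticeCube d (2 ^ (N + 2)), u y ^ 2 := by
    refine (sum_latticeCube_add_le (latticeCube_mono hRN hxR) (f := fun y => u y ^ 2)
      (fun _ => sq_nonneg _)).trans ?_
    refine Finset.sum_le_sum_of_subset_of_nonneg (latticeCube_mono ?_) fun _ _ _ => sq_nonneg _
    rw [pow_succ, pow_succ]; omega
  have h3 := hR0 (2 ^ (N + 2)) (by
    have : N + 2 < 2 ^ (N + 2) := Nat.lt_two_pow_self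
    omega)
  have hcard : ((latticeCube d (2 ^ (N + 2))).card : ℝ) ≤ 9 ^ d * 2 ^ (N * d) := by
    rw [card_latticeCube, pow_mul, ← mul_pow]
    have h8 : (1 : ℝ) ≤ 2 ^ N := one_le_pow₀ (by norm_num)
    push_cast
    gcongr
    rw [pow_add]; linarith
  have h4 : ∑ y ∈ latticeCube d (2 ^ (N + 2)), u y ^ 2 ≤
      ε' * (16 * 4 ^ N) * (9 ^ d * 2 ^ (N * d)) := by
    rw [inv_mul_lt_iff₀ (by positivity), inv_mul_lt_iff₀ (card_latticeCube_pos d _)] at h3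
    refine h3.le.trans ?_
    rw [mul_comm]
    have : (((2 ^ (N + 2) : ℕ) : ℝ) ^ 2 * ε') = ε' * (16 * 4 ^ N) := by
      push_cast
      rw [show (4 : ℝ) ^ N = (2 ^ N) ^ 2 by rw [← pow_mul, mul_comm, pow_mul]; norm_num]
      ring
    rw [this]
    gcongr
  have h5 : (4 : ℝ) ^ Nat.clog 2 R ≤ 4 * (1 + siteSq x) := by
    rcases Nat.lt_or_ge 1 R with hR1 | hR1
    · have h6 : 2 ^ (Nat.clog 2 R - 1) < R := Nat.pow_pred_clog_lt_self (by norm_num) hR1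
      have h7 : 0 < Nat.clog 2 R := Nat.clog_pos (by norm_num) hR1
      have h8 : (2 : ℝ) ^ (Nat.clog 2 R) ≤ 2 * R := by
        obtain ⟨c, hc⟩ := Nat.exists_eq_add_of_le' h7
        rw [hc] at h6 ⊢
        rw [Nat.add_sub_cancel] at h6
        rw [pow_succ]
        have : (2 : ℝ) ^ c ≤ R := by exact_mod_cast h6.le
        linarith
      calc (4 : ℝ) ^ Nat.clog 2 R = (2 ^ Nat.clog 2 R) ^ 2 := by
            rw [← pow_mul, mul_comm, pow_mul]; norm_num
        _ ≤ (2 * R) ^ 2 := by gcongr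
        _ ≤ _ := by linarith
    · rw [Nat.clog_of_right_le_one hR1]
      have : 0 ≤ siteSq x := (sq_nonneg _).trans hR
      simp; linarith
  have h5' : (4 : ℝ) ^ N ≤ 4 ^ N0 + 4 ^ Nat.clog 2 R := by
    have p1 : (0 : ℝ) ≤ 4 ^ N0 := by positivity
    have p2 : (0 : ℝ) ≤ 4 ^ Nat.clog 2 R := by positivity
    rcases max_choice N0 (Nat.clog 2 R) with h | h <;> rw [hN, h] <;> linarith
  have h6 : 2 ^ (N * d) * u x ^ 2 ≤ 2 ^ (N * d) * (ε / 4 * (4 ^ N0 + 4 * (1 + siteSq x))) := by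
    calc _ ≤ C * (ε' * (16 * 4 ^ N) * (9 ^ d * 2 ^ (N * d))) := h1.trans (by
          gcongr; exact h2.trans h4)
      _ = 2 ^ (N * d) * (ε / 4 * 4 ^ N) := by
          rw [hε']; field_simp
      _ ≤ _ := by gcongr; linarith
  have h7 := le_of_mul_le_mul_left h6 (by positivity)
  have : 0 ≤ ε * 4 ^ N0 := by positivity
  linarith

/-! ### The lazy random walk in the environment `a`, started at the origin -/

/-- The steps of the walk: stay, or move to a nearest neighbour. -/
abbrev Step (d : ℕ) : Type := Option (Fin d × Bool)

/-- The displacement of a step. -/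
def stepVec {d : ℕ} : Step d → Site d
  | none => 0
  | some (k, true) => unit k
  | some (k, false) => -unit k

/-- The reversed step. -/
def stepRev {d : ℕ} : Step d → Step d
  | none => none
  | some (k, b) => some (k, !b)

/-- The probability of a jump along an edge. -/
noncomputable def jumpProb {d : ℕ} {lam : ℝ} (a : CoeffField d lam) : Fin d × Bool → ℝ
  | (k, true) => (a 0 k : ℝ) / (4 * d)
  | (k, false) => (a (-unit k) k : ℝ) / (4 * d)

/-- The probability of a step from the origin. -/
noncomputable def stepProb {d : ℕ} {lam : ℝ} (a : CoeffField d lam) : Step d → ℝ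
  | none => 1 - ∑ j, jumpProb a j
  | some j => jumpProb a j

theorem stepVec_rev {d : ℕ} (e : Step d) : stepVec (stepRev e) = -stepVec e := by
  rcases e with _ | ⟨k, b⟩
  · simp [stepVec, stepRev]
  · cases b <;> simp [stepVec, stepRev]

theorem stepRev_stepRev {d : ℕ} (e : Step d) : stepRev (stepRev e) = e := by
  rcases e with _ | ⟨k, b⟩ <;> simp [stepRev]

theorem shift_shift {d : ℕ} {lam : ℝ} (a : CoeffField d lam) (x y : Site d) :
    shift x (shift y a) = shift (x + y) a := by
  funext z; simp [shift, add_assoc]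

theorem shift_zero {d : ℕ} {lam : ℝ} (a : CoeffField d lam) : shift 0 a = a := by
  funext z; simp [shift]

/-- Detailed balance: a conductance belongs to the edge and is the same seen from either end. -/
theorem stepProb_shift_rev {d : ℕ} {lam : ℝ} (a : CoeffField d lam) (e : Step d) :
    stepProb (shift (stepVec e) a) (stepRev e) = stepProb a e := by
  rcases e with _ | ⟨k, b⟩
  · simp [stepVec, stepRev, shift_zero]
  · cases b <;> simp [stepVec, stepRev, stepProb, jumpProb, shift]

theorem jumpProb_bounds {d : ℕ} {lam : ℝ} (hlam : 0 < lam) (a : CoeffField d lam)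
    (j : Fin d × Bool) : lam / (4 * d) ≤ jumpProb a j ∧ 0 ≤ jumpProb a j ∧
      jumpProb a j ≤ 1 / (4 * d) := by
  rcases j with ⟨k, b⟩
  cases b
  · refine ⟨?_, ?_, ?_⟩ <;> simp only [jumpProb]
    · gcongr; exact (a (-unit k) k).2.1.le
    · exact div_nonneg (coeff_pos hlam a _ k).le (by positivity)
    · gcongr; exact (a (-unit k) k).2.2.le
  · refine ⟨?_, ?_, ?_⟩ <;> simp only [jumpProb]
    · gcongr; exact (a 0 k).2.1.le
    · exact div_nonneg (coeff_pos hlam a _ k).le (by positivity)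
    · gcongr; exact (a 0 k).2.2.le

/-- Laziness: the normalisation 4d keeps the walk at rest with probability at least one half. This
is what makes its transition operator nonnegative. -/
theorem sum_jumpProb_le {d : ℕ} {lam : ℝ} (hlam : 0 < lam) (a : CoeffField d lam) :
    ∑ j, jumpProb a j ≤ 1 / 2 := by
  refine (Finset.sum_le_sum fun j _ => (jumpProb_bounds hlam a j).2.2).trans ?_
  rw [Finset.sum_const, Finset.card_univ, Fintype.card_prod, Fintype.card_fin, Fintype.card_bool,
    nsmul_eq_mul]
  rcases Nat.eq_zero_or_pos d with h | h
  · subst h; simp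
  · push_cast; field_simp; norm_num

theorem stepProb_nonneg {d : ℕ} {lam : ℝ} (hlam : 0 < lam) (a : CoeffField d lam) (e : Step d) :
    0 ≤ stepProb a e := by
  rcases e with _ | j
  · have := sum_jumpProb_le hlam a
    simp only [stepProb]; linarith
  · exact (jumpProb_bounds hlam a j).2.1

theorem sum_stepProb {d : ℕ} {lam : ℝ} (a : CoeffField d lam) : ∑ e, stepProb a e = 1 := by
  rw [Fintype.sum_option]; simp [stepProb]

theorem stepProb_le_one {d : ℕ} {lam : ℝ} (hlam : 0 < lam) (a : CoeffField d lam) (e : Step d) :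
    stepProb a e ≤ 1 := by
  rw [← sum_stepProb a]
  exact Finset.single_le_sum (f := stepProb a) (fun e _ => stepProb_nonneg hlam a e)
    (Finset.mem_univ e)

theorem measurable_stepProb {d : ℕ} {lam : ℝ} (e : Step d) :
    Measurable fun a : CoeffField d lam => stepProb a e := by
  have hco : ∀ (x : Site d) (k : Fin d), Measurable fun a : CoeffField d lam => (a x k : ℝ) :=
    fun x k => measurable_subtype_coe.comp ((measurable_pi_apply k).comp (measurable_pi_apply x))
  have hj : ∀ j : Fin d × Bool, Measurable fun a : CoeffField d lam => jumpProb a j := by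
    rintro ⟨k, b⟩
    cases b
    · exact (hco _ k).div_const _
    · exact (hco _ k).div_const _
  rcases e with _ | j
  · exact measurable_const.sub (Finset.measurable_fun_sum _ fun j _ => hj j)
  · exact hj j

theorem measurable_shift {d : ℕ} {lam : ℝ} (z : Site d) :
    Measurable (shift z : CoeffField d lam → CoeffField d lam) :=
  measurable_pi_lambda _ fun _ => measurable_pi_apply _

theorem sum_stepProb_mul {d : ℕ} (hd : 0 < d) {lam : ℝ} (a : CoeffField d lam) (u : Site d → ℝ)
    (hu : gradStar (mulField a (grad u)) 0 = 0) : ∑ e, stepProb a e * u (stepVec e) = u 0 := by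
  rw [gradStar_mulField_grad] at hu
  have hd' : (d : ℝ) ≠ 0 := by exact_mod_cast hd.ne'
  have h1 : ∑ j, jumpProb a j * (u (stepVec (some j)) - u 0) = 0 := by
    rw [Fintype.sum_prod_type]
    simp only [Fintype.sum_bool, jumpProb, stepVec]
    rw [← neg_eq_zero, ← mul_eq_zero_iff_left (a := (4 * d : ℝ)) (by positivity), ← hu,
      mul_neg, Finset.mul_sum, ← Finset.sum_neg_distrib]
    refine Finset.sum_congr rfl fun k _ => ?_
    simp only [zero_add, zero_sub]
    field_simp
    ring
  rw [Fintype.sum_option]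
  have h0 : u (stepVec (none : Step d)) = u 0 := rfl
  simp only [stepProb, h0, sub_mul, one_mul, Finset.sum_mul]
  simp only [mul_sub, Finset.sum_sub_distrib] at h1
  linarith

/-- The law of the walk after `n` steps. -/
noncomputable def walkLaw {d : ℕ} {lam : ℝ} : ℕ → CoeffField d lam → Site d → ℝ
  | 0, _, y => if y = 0 then 1 else 0
  -- Conditioning on the first step; the environment is re-centred so that the walk starts at the
  -- origin again.
  | n + 1, a, y => ∑ e, stepProb a e * walkLaw n (shift (stepVec e) a) (y - stepVec e)

theorem walkLaw_succ {d : ℕ} {lam : ℝ} (n : ℕ) (a : CoeffField d lam) (y : Site d) :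
    walkLaw (n + 1) a y =
      ∑ e, stepProb a e * walkLaw n (shift (stepVec e) a) (y - stepVec e) := rfl

theorem walkLaw_nonneg {d : ℕ} {lam : ℝ} (hlam : 0 < lam) (n : ℕ) (a : CoeffField d lam)
    (y : Site d) : 0 ≤ walkLaw n a y := by
  induction n generalizing a y with
  | zero => simp only [walkLaw]; split_ifs <;> norm_num
  | succ n ih =>
    exact Finset.sum_nonneg fun e _ => mul_nonneg (stepProb_nonneg hlam a e) (ih _ _)

theorem measurable_walkLaw {d : ℕ} {lam : ℝ} (n : ℕ) (y : Site d) :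
    Measurable fun a : CoeffField d lam => walkLaw n a y := by
  induction n generalizing y with
  | zero => exact measurable_const
  | succ n ih =>
    exact Finset.measurable_fun_sum _ fun e _ =>
      (measurable_stepProb e).mul ((ih _).comp (measurable_shift _))

theorem stepVec_mem {d : ℕ} (e : Step d) : stepVec e ∈ latticeCube d 1 := by
  have h : ∀ k : Fin d, unit k ∈ latticeCube d 1 := fun k => by
    have := add_unit_mem_latticeCube (k := k) (show (0 : Site d) ∈ latticeCube d 0 by
      rw [latticeCube_zero]; simp)
    simpa using this
  rcases e with _ | ⟨k, b⟩
  · exact mem_latticeCube.2 (by simp [stepVec])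
  · cases b
    · exact neg_mem_latticeCube (h k)
    · exact h k

theorem walkLaw_eq_zero {d : ℕ} {lam : ℝ} {n : ℕ} {a : CoeffField d lam} {y : Site d}
    (hy : y ∉ latticeCube d n) : walkLaw n a y = 0 := by
  induction n generalizing a y with
  | zero =>
    rw [latticeCube_zero, Finset.mem_singleton] at hy
    simp [walkLaw, hy]
  | succ n ih =>
    rw [walkLaw_succ]
    refine Finset.sum_eq_zero fun e _ => ?_
    rw [ih, mul_zero]
    intro h
    have := add_mem_latticeCube h (stepVec_mem e)
    rw [sub_add_cancel] at this
    exact hy this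

theorem sum_walkLaw_shift {d : ℕ} {lam : ℝ} (n : ℕ) (a : CoeffField d lam) (f : ℝ → Site d → ℝ)
    (hf : ∀ y, f 0 y = 0) (e : Step d) :
    ∑ y ∈ latticeCube d (n + 1), f (walkLaw n a (y - stepVec e)) y =
      ∑ y ∈ latticeCube d n, f (walkLaw n a y) (y + stepVec e) := by
  classical
  rw [← Finset.sum_image (s := latticeCube d n) (g := fun y => y + stepVec e)
    (f := fun y => f (walkLaw n a (y - stepVec e)) y) (add_left_injective _).injOn |>.trans
    (Finset.sum_congr rfl fun y _ => by rw [add_sub_cancel_right])]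
  symm
  apply Finset.sum_subset
  · intro y hy
    obtain ⟨x, hx, rfl⟩ := Finset.mem_image.1 hy
    exact add_mem_latticeCube hx (stepVec_mem e)
  · intro y _ hy2
    rw [walkLaw_eq_zero, hf]
    intro h
    exact hy2 (Finset.mem_image.2 ⟨_, h, by simp⟩)

/-- The expectation of `u` under the law of the walk after `n` steps. -/
noncomputable def walkMean {d : ℕ} {lam : ℝ} (n : ℕ) (a : CoeffField d lam) (u : Site d → ℝ) : ℝ :=
  ∑ y ∈ latticeCube d n, walkLaw n a y * u y

theorem walkMean_succ {d : ℕ} {lam : ℝ} (n : ℕ) (a : CoeffField d lam) (u : Site d → ℝ) :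
    walkMean (n + 1) a u = ∑ e, stepProb a e *
      walkMean n (shift (stepVec e) a) fun y => u (y + stepVec e) := by
  simp only [walkMean, walkLaw_succ, Finset.sum_mul]
  rw [Finset.sum_comm]
  refine Finset.sum_congr rfl fun e _ => ?_
  simp only [mul_assoc]
  rw [← Finset.mul_sum, sum_walkLaw_shift n _ (fun t y => t * u y) (by simp)]

theorem walkMean_add {d : ℕ} {lam : ℝ} (n : ℕ) (a : CoeffField d lam) (u v : Site d → ℝ) :
    walkMean n a (fun y => u y + v y) = walkMean n a u + walkMean n a v := by
  simp [walkMean, mul_add, Finset.sum_add_distrib]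

theorem walkMean_mul {d : ℕ} {lam : ℝ} (n : ℕ) (a : CoeffField d lam) (c : ℝ) (u : Site d → ℝ) :
    walkMean n a (fun y => c * u y) = c * walkMean n a u := by
  simp only [walkMean, Finset.mul_sum]
  exact Finset.sum_congr rfl fun y _ => by ring

theorem walkMean_const {d : ℕ} {lam : ℝ} (n : ℕ) (a : CoeffField d lam) (c : ℝ) :
    walkMean n a (fun _ => c) = c := by
  induction n generalizing a with
  | zero => simp [walkMean, latticeCube_zero, walkLaw]
  | succ n ih =>
    rw [walkMean_succ]
    simp only [ih]
    rw [← Finset.sum_mul, sum_stepProb, one_mul]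

theorem walkMean_mono {d : ℕ} {lam : ℝ} (hlam : 0 < lam) (n : ℕ) (a : CoeffField d lam)
    {u v : Site d → ℝ} (h : ∀ y ∈ latticeCube d n, u y ≤ v y) : walkMean n a u ≤ walkMean n a v :=
  Finset.sum_le_sum fun y hy => mul_le_mul_of_nonneg_left (h y hy) (walkLaw_nonneg hlam n a y)

theorem walkMean_harmonic {d : ℕ} (hd : 0 < d) {lam : ℝ} (n : ℕ) (a : CoeffField d lam)
    {u : Site d → ℝ} (hu : ∀ z, gradStar (mulField a (grad u)) z = 0) : walkMean n a u = u 0 := by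
  induction n generalizing a u with
  | zero => simp [walkMean, latticeCube_zero, walkLaw]
  | succ n ih =>
    rw [walkMean_succ, ← sum_stepProb_mul hd a u (hu 0)]
    refine Finset.sum_congr rfl fun e _ => ?_
    rw [ih _ fun z => by rw [gradStar_shift, hu], zero_add]

theorem measurable_walkMean {d : ℕ} {lam : ℝ} (n : ℕ) (u : Site d → ℝ) :
    Measurable fun a : CoeffField d lam => walkMean n a u :=
  Finset.measurable_fun_sum _ fun y _ => (measurable_walkLaw n y).mul_const _

/-! ### Entropy -/

/-- Squared Hellinger distance is at most relative entropy. For a single term, log t ≤ t - 1 with t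
= √(p/q) gives (√q - √p)² ≤ q log(q/p) + p - q, and the linear parts cancel after averaging. -/
theorem sum_sq_sqrt_sub_le {ι : Type*} [Fintype ι] {w q : ι → ℝ} (hw : ∀ e, 0 ≤ w e)
    (hw1 : ∑ e, w e = 1) (hq : ∀ e, 0 ≤ q e) :
    ∑ e, w e * (Real.sqrt (q e) - Real.sqrt (∑ e, w e * q e)) ^ 2 ≤
      Real.negMulLog (∑ e, w e * q e) - ∑ e, w e * Real.negMulLog (q e) := by
  set p := ∑ e, w e * q e with hp
  have hp0 : 0 ≤ p := Finset.sum_nonneg fun e _ => mul_nonneg (hw e) (hq e)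
  have hterm : ∀ e, w e * (Real.sqrt (q e) - Real.sqrt p) ^ 2 ≤
      (-(w e * q e) * Real.log p - w e * Real.negMulLog (q e)) + (w e * p - w e * q e) := by
    intro e
    rcases (hw e).eq_or_lt with h | h
    · rw [← h]; simp
    rw [show (-(w e * q e) * Real.log p - w e * Real.negMulLog (q e)) + (w e * p - w e * q e) =
      w e * (-q e * Real.log p - Real.negMulLog (q e) + p - q e) by ring]
    refine mul_le_mul_of_nonneg_left ?_ (hw e)
    rcases (hq e).eq_or_lt with h' | h'
    · rw [← h']; simp [Real.sq_sqrt hp0]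
    have hp1 : 0 < p := (mul_pos h h').trans_le
      (Finset.single_le_sum (f := fun e => w e * q e) (fun e _ => mul_nonneg (hw e) (hq e))
        (Finset.mem_univ e))
    have e1 := Real.sq_sqrt hp0
    have e2 := Real.sq_sqrt (hq e)
    have hsq : 0 < Real.sqrt (q e) := Real.sqrt_pos.2 h'
    have hsp : 0 < Real.sqrt p := Real.sqrt_pos.2 hp1
    have h1 := Real.log_le_sub_one_of_pos (div_pos hsp hsq)
    rw [Real.log_div hsp.ne' hsq.ne', Real.log_sqrt hp0, Real.log_sqrt (hq e)] at h1
    have h2 : q e * (Real.sqrt p / Real.sqrt (q e)) = Real.sqrt p * Real.sqrt (q e) := by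
      rw [mul_div_assoc', div_eq_iff hsq.ne']
      nlinarith
    have h3 := mul_le_mul_of_nonneg_left h1 (hq e)
    rw [mul_sub, mul_sub (q e) (Real.sqrt p / Real.sqrt (q e)), h2] at h3
    rw [Real.negMulLog]
    nlinarith
  refine (Finset.sum_le_sum fun e _ => hterm e).trans (le_of_eq ?_)
  rw [Finset.sum_add_distrib, Finset.sum_sub_distrib, Finset.sum_sub_distrib, ← Finset.sum_mul,
    ← Finset.sum_mul, hw1, Finset.sum_neg_distrib, ← hp, Real.negMulLog]
  ring

/-- The entropy of the walk after `n` steps. -/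
noncomputable def walkEntropy {d : ℕ} {lam : ℝ} (n : ℕ) (a : CoeffField d lam) : ℝ :=
  ∑ y ∈ latticeCube d n, Real.negMulLog (walkLaw n a y)

/-- The mutual information between the first step and the position after `n + 1` steps. -/
noncomputable def walkInfo {d : ℕ} {lam : ℝ} (n : ℕ) (a : CoeffField d lam) : ℝ :=
  walkEntropy (n + 1) a - ∑ e, stepProb a e * walkEntropy n (shift (stepVec e) a)

/-- By the recursion the law of the position is the mixture of its laws given the first step, so the
mutual information is a sum over sites of Jensen gaps of `Real.negMulLog`, each bounded by the
preceding inequality. -/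
theorem sum_sq_sqrt_sub_le_walkInfo {d : ℕ} {lam : ℝ} (hlam : 0 < lam) (n : ℕ)
    (a : CoeffField d lam) :
    ∑ e, stepProb a e * ∑ y ∈ latticeCube d (n + 1),
      (Real.sqrt (walkLaw n (shift (stepVec e) a) (y - stepVec e)) -
        Real.sqrt (walkLaw (n + 1) a y)) ^ 2 ≤ walkInfo n a := by
  have h1 : walkInfo n a = ∑ y ∈ latticeCube d (n + 1), (Real.negMulLog (walkLaw (n + 1) a y) -
      ∑ e, stepProb a e *
        Real.negMulLog (walkLaw n (shift (stepVec e) a) (y - stepVec e))) := by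
    rw [walkInfo, Finset.sum_sub_distrib, Finset.sum_comm]
    congr 1
    refine Finset.sum_congr rfl fun e _ => ?_
    rw [← Finset.mul_sum, sum_walkLaw_shift n _ (fun t _ => Real.negMulLog t) (by simp)]
    rfl
  rw [h1]
  simp_rw [Finset.mul_sum]
  rw [Finset.sum_comm]
  refine Finset.sum_le_sum fun y _ => ?_
  exact sum_sq_sqrt_sub_le (fun e => stepProb_nonneg hlam a e) (sum_stepProb a)
    (fun e => walkLaw_nonneg hlam n _ _)

theorem walkInfo_nonneg {d : ℕ} {lam : ℝ} (hlam : 0 < lam) (n : ℕ) (a : CoeffField d lam) :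
    0 ≤ walkInfo n a := by
  refine le_trans ?_ (sum_sq_sqrt_sub_le_walkInfo hlam n a)
  exact Finset.sum_nonneg fun e _ => mul_nonneg (stepProb_nonneg hlam a e)
    (Finset.sum_nonneg fun _ _ => sq_nonneg _)

/-- Cauchy–Schwarz after factoring q - p = (√q - √p)(√q + √p). -/
theorem sq_sum_sub_mul_le {ι : Type*} (s : Finset ι) {q p : ι → ℝ} (hq : ∀ y, 0 ≤ q y)
    (hp : ∀ y, 0 ≤ p y) (u : ι → ℝ) : (∑ y ∈ s, (q y - p y) * u y) ^ 2 ≤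
      (∑ y ∈ s, (Real.sqrt (q y) - Real.sqrt (p y)) ^ 2) *
        (2 * ∑ y ∈ s, (q y + p y) * u y ^ 2) := by
  have h1 := Finset.sum_mul_sq_le_sq_mul_sq s (fun y => Real.sqrt (q y) - Real.sqrt (p y))
    (fun y => (Real.sqrt (q y) + Real.sqrt (p y)) * u y)
  have h2 : ∀ y, (Real.sqrt (q y) - Real.sqrt (p y)) *
      ((Real.sqrt (q y) + Real.sqrt (p y)) * u y) = (q y - p y) * u y := by
    intro y
    have e1 := Real.mul_self_sqrt (hq y)
    have e2 := Real.mul_self_sqrt (hp y)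
    linear_combination u y * e1 - u y * e2
  simp_rw [h2] at h1
  refine h1.trans ?_
  refine mul_le_mul_of_nonneg_left ?_ (Finset.sum_nonneg fun _ _ => sq_nonneg _)
  rw [Finset.mul_sum]
  refine Finset.sum_le_sum fun y _ => ?_
  rw [mul_pow, ← mul_assoc]
  refine mul_le_mul_of_nonneg_right ?_ (sq_nonneg _)
  have e1 := Real.sq_sqrt (hq y)
  have e2 := Real.sq_sqrt (hp y)
  nlinarith [sq_nonneg (Real.sqrt (q y) - Real.sqrt (p y))]

/-- A harmonic function integrates to u(e) against the law given the first step e, and to u(0)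
against the unconditional law. The difference of the two is controlled by their Hellinger distance,
hence by the mutual information, times a second moment of u. -/
theorem sq_sub_le_walkInfo {d : ℕ} (hd : 0 < d) {lam : ℝ} (hlam : 0 < lam) (n : ℕ)
    (a : CoeffField d lam) {u : Site d → ℝ} (hu : ∀ z, gradStar (mulField a (grad u)) z = 0)
    (e : Step d) : stepProb a e ^ 2 * (u (stepVec e) - u 0) ^ 2 ≤
      4 * walkInfo n a * walkMean (n + 1) a fun y => u y ^ 2 := by
  set q : Site d → ℝ := fun y => walkLaw n (shift (stepVec e) a) (y - stepVec e)
  set p : Site d → ℝ := walkLaw (n + 1) a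
  have hq : ∀ y, 0 ≤ q y := fun y => walkLaw_nonneg hlam _ _ _
  have hp : ∀ y, 0 ≤ p y := fun y => walkLaw_nonneg hlam _ _ _
  have hw := stepProb_nonneg hlam a e
  have hmeanq : ∀ f : Site d → ℝ, ∑ y ∈ latticeCube d (n + 1), q y * f y =
      walkMean n (shift (stepVec e) a) fun y => f (y + stepVec e) := fun f =>
    sum_walkLaw_shift n _ (fun t y => t * f y) (by simp) e
  have h1 : u (stepVec e) - u 0 = ∑ y ∈ latticeCube d (n + 1), (q y - p y) * u y := by
    simp only [sub_mul, Finset.sum_sub_distrib]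
    rw [hmeanq, walkMean_harmonic hd n _ fun z => by rw [gradStar_shift, hu]]
    have := walkMean_harmonic hd (n + 1) a hu
    rw [walkMean] at this
    rw [this, zero_add]
  have h2 := sq_sum_sub_mul_le (latticeCube d (n + 1)) hq hp u
  rw [← h1] at h2
  set M := walkMean (n + 1) a fun y => u y ^ 2 with hM
  have hM0 : 0 ≤ M := Finset.sum_nonneg fun y _ => mul_nonneg (hp y) (sq_nonneg _)
  have h3 : stepProb a e * ∑ y ∈ latticeCube d (n + 1),
      (Real.sqrt (q y) - Real.sqrt (p y)) ^ 2 ≤ walkInfo n a := by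
    refine le_trans ?_ (sum_sq_sqrt_sub_le_walkInfo hlam n a)
    exact Finset.single_le_sum (f := fun e => stepProb a e * ∑ y ∈ latticeCube d (n + 1),
      (Real.sqrt (walkLaw n (shift (stepVec e) a) (y - stepVec e)) -
        Real.sqrt (walkLaw (n + 1) a y)) ^ 2)
      (fun e _ => mul_nonneg (stepProb_nonneg hlam a e)
        (Finset.sum_nonneg fun _ _ => sq_nonneg _)) (Finset.mem_univ e)
  have h4 : stepProb a e * (2 * ∑ y ∈ latticeCube d (n + 1), (q y + p y) * u y ^ 2) ≤ 4 * M := by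
    -- The conditional law is at most the unconditional one divided by `stepProb a e`; hence only
    -- the unconditional second moment appears.
    have e1 : stepProb a e * ∑ y ∈ latticeCube d (n + 1), q y * u y ^ 2 ≤ M := by
      rw [hmeanq fun y => u y ^ 2, hM, walkMean_succ]
      exact Finset.single_le_sum (f := fun e => stepProb a e *
        walkMean n (shift (stepVec e) a) fun y => u (y + stepVec e) ^ 2)
        (fun e _ => mul_nonneg (stepProb_nonneg hlam a e)
          (Finset.sum_nonneg fun y _ => mul_nonneg (walkLaw_nonneg hlam _ _ _) (sq_nonneg _)))
        (Finset.mem_univ e)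
    have e2 : stepProb a e * M ≤ M := mul_le_of_le_one_left hM0 (stepProb_le_one hlam a e)
    have e3 : ∑ y ∈ latticeCube d (n + 1), p y * u y ^ 2 = M := rfl
    simp only [add_mul, Finset.sum_add_distrib]
    rw [e3]
    linarith
  have h5 := mul_le_mul h3 h4 (mul_nonneg hw (mul_nonneg (by norm_num)
    (Finset.sum_nonneg fun y _ => mul_nonneg (add_nonneg (hq y) (hp y)) (sq_nonneg _))))
    (walkInfo_nonneg hlam n a)
  calc _ ≤ stepProb a e ^ 2 * ((∑ y ∈ latticeCube d (n + 1),
        (Real.sqrt (q y) - Real.sqrt (p y)) ^ 2) *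
        (2 * ∑ y ∈ latticeCube d (n + 1), (q y + p y) * u y ^ 2)) := by gcongr
    _ = _ := by ring
    _ ≤ walkInfo n a * (4 * M) := h5
    _ = _ := by ring

theorem walkEntropy_nonneg {d : ℕ} {lam : ℝ} (hlam : 0 < lam) (n : ℕ) (a : CoeffField d lam) :
    0 ≤ walkEntropy n a := by
  refine Finset.sum_nonneg fun y hy => Real.negMulLog_nonneg (walkLaw_nonneg hlam n a y) ?_
  rw [← walkMean_const n a 1]
  have := Finset.single_le_sum (f := fun y => walkLaw n a y * 1)
    (fun y _ => by simpa using walkLaw_nonneg hlam n a y) hy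
  simpa [walkMean] using this

/-- Gibbs' inequality against the uniform law on the cube reached in n steps. -/
theorem walkEntropy_le {d : ℕ} {lam : ℝ} (hlam : 0 < lam) (n : ℕ) (a : CoeffField d lam) :
    walkEntropy n a ≤ Real.log (latticeCube d n).card := by
  set N : ℝ := ((latticeCube d n).card : ℝ) with hNdef
  have hN : 0 < N := card_latticeCube_pos d n
  have h1 : ∀ t : ℝ, 0 ≤ t → Real.negMulLog t ≤ t * Real.log N + (N⁻¹ - t) := by
    intro t ht
    rcases ht.eq_or_lt with h | h
    · rw [← h]; simp; positivity
    · have h2 := Real.log_le_sub_one_of_pos (show 0 < (t * N)⁻¹ by positivity)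
      rw [Real.log_inv, Real.log_mul h.ne' hN.ne'] at h2
      have h3 := mul_le_mul_of_nonneg_left h2 ht
      have h4 : t * ((t * N)⁻¹ - 1) = N⁻¹ - t := by field_simp
      rw [h4] at h3
      rw [Real.negMulLog]
      linarith
  have h2 : ∑ y ∈ latticeCube d n, walkLaw n a y = 1 := by
    have := walkMean_const n a 1
    simpa [walkMean] using this
  refine (Finset.sum_le_sum fun y _ => h1 _ (walkLaw_nonneg hlam n a y)).trans (le_of_eq ?_)
  rw [Finset.sum_add_distrib, Finset.sum_sub_distrib, ← Finset.sum_mul, h2, Finset.sum_const,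
    nsmul_eq_mul, ← hNdef, mul_inv_cancel₀ hN.ne']
  ring

theorem measurable_walkEntropy {d : ℕ} {lam : ℝ} (n : ℕ) :
    Measurable fun a : CoeffField d lam => walkEntropy n a :=
  Finset.measurable_fun_sum _ fun y _ =>
    Real.continuous_negMulLog.measurable.comp (measurable_walkLaw n y)

/-! ### Annealed estimates for the walk -/

/-- Bounded measurable functions. -/
def BddMeas {Ω : Type*} [MeasurableSpace Ω] (f : Ω → ℝ) : Prop :=
  Measurable f ∧ ∃ M, ∀ a, |f a| ≤ M

namespace BddMeas

variable {Ω : Type*} [MeasurableSpace Ω] {f g : Ω → ℝ}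

theorem add (hf : BddMeas f) (hg : BddMeas g) : BddMeas fun a => f a + g a := by
  obtain ⟨hf, M, hM⟩ := hf
  obtain ⟨hg, N, hN⟩ := hg
  exact ⟨hf.add hg, M + N, fun a => (abs_add_le _ _).trans (add_le_add (hM a) (hN a))⟩

theorem mul (hf : BddMeas f) (hg : BddMeas g) : BddMeas fun a => f a * g a := by
  obtain ⟨hf, M, hM⟩ := hf
  obtain ⟨hg, N, hN⟩ := hg
  refine ⟨hf.mul hg, M * N, fun a => ?_⟩
  rw [abs_mul]
  exact mul_le_mul (hM a) (hN a) (abs_nonneg _) ((abs_nonneg _).trans (hM a))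

theorem const (c : ℝ) : BddMeas fun _ : Ω => c := ⟨measurable_const, |c|, fun _ => le_rfl⟩

theorem sum {ι : Type*} (s : Finset ι) {f : ι → Ω → ℝ} (hf : ∀ i, BddMeas (f i)) :
    BddMeas fun a => ∑ i ∈ s, f i a := by
  choose hm M hM using hf
  exact ⟨Finset.measurable_fun_sum _ fun i _ => hm i, ∑ i ∈ s, M i, fun a =>
    (Finset.abs_sum_le_sum_abs _ _).trans (Finset.sum_le_sum fun i _ => hM i a)⟩

theorem sub (hf : BddMeas f) (hg : BddMeas g) : BddMeas fun a => f a - g a := by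
  have := hf.add ((const (-1)).mul hg)
  simpa [sub_eq_add_neg] using this

theorem comp {T : Ω → Ω} (hf : BddMeas f) (hT : Measurable T) : BddMeas fun a => f (T a) := by
  obtain ⟨hf, M, hM⟩ := hf
  exact ⟨hf.comp hT, M, fun a => hM _⟩

theorem integrable (hf : BddMeas f) (P : Measure Ω) [IsProbabilityMeasure P] :
    Integrable f P := by
  obtain ⟨hf, M, hM⟩ := hf
  exact Integrable.of_bound hf.aestronglyMeasurable M (Eventually.of_forall hM)

end BddMeas

section Environment

variable {d : ℕ} {lam : ℝ}

theorem bddMeas_stepProb (hlam : 0 < lam) (e : Step d) :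
    BddMeas fun a : CoeffField d lam => stepProb a e :=
  ⟨measurable_stepProb e, 1, fun a => by
    rw [abs_of_nonneg (stepProb_nonneg hlam a e)]; exact stepProb_le_one hlam a e⟩

theorem bddMeas_walkMean (hlam : 0 < lam) (n : ℕ) (u : Site d → ℝ) :
    BddMeas fun a : CoeffField d lam => walkMean n a u := by
  refine ⟨measurable_walkMean n u, ∑ y ∈ latticeCube d n, |u y|, fun a => ?_⟩
  have h1 := walkMean_mono hlam n a (u := u) (v := fun _ => ∑ y ∈ latticeCube d n, |u y|)
    fun y hy => (le_abs_self _).trans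
      (Finset.single_le_sum (f := fun y => |u y|) (fun _ _ => abs_nonneg _) hy)
  have h2 := walkMean_mono hlam n a (u := fun _ => -∑ y ∈ latticeCube d n, |u y|) (v := u)
    fun y hy => (neg_le_neg (Finset.single_le_sum (f := fun y => |u y|)
      (fun _ _ => abs_nonneg _) hy)).trans (neg_abs_le _)
  rw [walkMean_const] at h1 h2
  exact abs_le.2 ⟨h2, h1⟩

theorem bddMeas_walkEntropy (hlam : 0 < lam) (n : ℕ) :
    BddMeas fun a : CoeffField d lam => walkEntropy n a :=
  ⟨measurable_walkEntropy n, Real.log (latticeCube d n).card, fun a => by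
    rw [abs_of_nonneg (walkEntropy_nonneg hlam n a)]; exact walkEntropy_le hlam n a⟩

/-- The transition operator of the environment seen from the walk. -/
noncomputable def envOp (f : CoeffField d lam → ℝ) (a : CoeffField d lam) : ℝ :=
  ∑ e, stepProb a e * f (shift (stepVec e) a)

theorem BddMeas.envOp (hlam : 0 < lam) {f : CoeffField d lam → ℝ} (hf : BddMeas f) :
    BddMeas (envOp f) :=
  BddMeas.sum _ fun e => (bddMeas_stepProb hlam e).mul (hf.comp (measurable_shift _))

theorem sum_comp_stepRev {M : Type*} [AddCommMonoid M] (f : Step d → M) :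
    ∑ e, f (stepRev e) = ∑ e, f e :=
  Function.Bijective.sum_comp (Function.Involutive.bijective stepRev_stepRev) f

variable {P : Measure (CoeffField d lam)}

theorem integral_shift (hP : IsStationaryMeasure P) (z : Site d) (f : CoeffField d lam → ℝ)
    (hf : Measurable f) : ∫ a, f (shift z a) ∂P = ∫ a, f a ∂P := by
  have := integral_map (μ := P) (hP z).aemeasurable (f := f) hf.aestronglyMeasurable
  rw [(hP z).map_eq] at this
  exact this.symm

/-- Reversibility. -/
theorem integral_stepProb_mul (hP : IsStationaryMeasure P) (e : Step d)
    {f g : CoeffField d lam → ℝ} (hf : Measurable f) (hg : Measurable g) :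
    ∫ a, stepProb a e * (f a * g (shift (stepVec e) a)) ∂P =
      ∫ a, stepProb a (stepRev e) * (f (shift (stepVec (stepRev e)) a) * g a) ∂P := by
  rw [← integral_shift hP (stepVec (stepRev e)) fun a =>
    stepProb a e * (f a * g (shift (stepVec e) a))]
  · congr 1; ext a
    rw [shift_shift, stepVec_rev, add_neg_cancel, shift_zero, ← stepVec_rev]
    have := stepProb_shift_rev a (stepRev e)
    rw [stepRev_stepRev] at this
    rw [this]
  · exact (measurable_stepProb e).mul (hf.mul (hg.comp (measurable_shift _)))

variable [IsProbabilityMeasure P]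

/-- Self-adjointness: apply reversibility to each step and relabel e by its reverse. -/
theorem integral_mul_envOp (hlam : 0 < lam) (hP : IsStationaryMeasure P)
    {f g : CoeffField d lam → ℝ} (hf : BddMeas f) (hg : BddMeas g) :
    ∫ a, f a * envOp g a ∂P = ∫ a, envOp f a * g a ∂P := by
  have h1 : ∀ a, f a * envOp g a = ∑ e, stepProb a e * (f a * g (shift (stepVec e) a)) := by
    intro a
    rw [envOp, Finset.mul_sum]
    exact Finset.sum_congr rfl fun e _ => by ring
  have h2 : ∀ a, envOp f a * g a = ∑ e, stepProb a e * (f (shift (stepVec e) a) * g a) := by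
    intro a
    rw [envOp, Finset.sum_mul]
    exact Finset.sum_congr rfl fun e _ => by ring
  simp_rw [h1, h2]
  rw [integral_finsetSum, integral_finsetSum, ← sum_comp_stepRev]
  · exact Finset.sum_congr rfl fun e _ => by
      have := integral_stepProb_mul hP (stepRev e) hf.1 hg.1
      rw [stepRev_stepRev] at this
      exact this
  · exact fun e _ => ((bddMeas_stepProb hlam e).mul
      ((hf.comp (measurable_shift _)).mul hg)).integrable P
  · exact fun e _ => ((bddMeas_stepProb hlam e).mul
      (hf.mul (hg.comp (measurable_shift _)))).integrable P

theorem integral_envOp (hlam : 0 < lam) (hP : IsStationaryMeasure P)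
    {g : CoeffField d lam → ℝ} (hg : BddMeas g) : ∫ a, envOp g a ∂P = ∫ a, g a ∂P := by
  have h := integral_mul_envOp hlam hP (BddMeas.const 1) hg
  have h1 : envOp (fun _ : CoeffField d lam => (1 : ℝ)) = fun _ => 1 := by
    funext a; simp only [envOp, mul_one]; exact sum_stepProb a
  rw [h1] at h
  simpa using h

/-- On jumps st ≥ -(s² + t²)/2, and the walk rests with probability at least one half; together f Qf
≥ (f² - Q(f²))/2 pointwise. The right side integrates to 0 by invariance of P. -/
theorem integral_mul_envOp_self_nonneg (hlam : 0 < lam) (hP : IsStationaryMeasure P)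
    {f : CoeffField d lam → ℝ} (hf : BddMeas f) : 0 ≤ ∫ a, f a * envOp f a ∂P := by
  have hsq := hf.mul hf
  have hQ := hsq.envOp hlam
  have hpt : ∀ a, 1 / 2 * (f a * f a) - 1 / 2 * envOp (fun b => f b * f b) a ≤
      f a * envOp f a := by
    intro a
    have h1 : ∀ j : Fin d × Bool, -(1 / 2) * (jumpProb a j * (f a * f a)) -
        1 / 2 * (jumpProb a j * (f (shift (stepVec (some j)) a) * f (shift (stepVec (some j)) a))) ≤
        f a * (jumpProb a j * f (shift (stepVec (some j)) a)) := by
      intro j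
      have := (jumpProb_bounds hlam a j).2.1
      nlinarith [mul_nonneg this (sq_nonneg (f a + f (shift (stepVec (some j)) a)))]
    have h2 := Finset.sum_le_sum fun j (_ : j ∈ Finset.univ) => h1 j
    rw [Finset.sum_sub_distrib, ← Finset.mul_sum, ← Finset.mul_sum, ← Finset.mul_sum,
      ← Finset.sum_mul] at h2
    have h0 : shift (stepVec (none : Step d)) a = a := shift_zero a
    simp only [envOp, Fintype.sum_option, h0]
    have h3 : stepProb a none = 1 - ∑ j, jumpProb a j := rfl
    have h4 : ∀ j, stepProb a (some j) = jumpProb a j := fun j => rfl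
    simp only [h4]
    rw [h3, mul_add]
    have h5 := mul_le_mul_of_nonneg_right (sum_jumpProb_le hlam a) (mul_self_nonneg (f a))
    linarith
  have hI := integral_mono ((((BddMeas.const (1 / 2)).mul hsq).sub
    ((BddMeas.const (1 / 2)).mul hQ)).integrable P) ((hf.mul (hf.envOp hlam)).integrable P) hpt
  refine le_trans (le_of_eq ?_) hI
  rw [integral_sub (((BddMeas.const (1 / 2)).mul hsq).integrable P)
    (((BddMeas.const (1 / 2)).mul hQ).integrable P), integral_const_mul, integral_const_mul,
    integral_envOp hlam hP hsq, sub_self]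

theorem BddMeas.envOp_iterate (hlam : 0 < lam) {f : CoeffField d lam → ℝ} (hf : BddMeas f)
    (j : ℕ) : BddMeas (_root_.envOp^[j] f) := by
  induction j with
  | zero => exact hf
  | succ j ih => rw [Function.iterate_succ_apply']; exact ih.envOp hlam

/-- Moving one factor across, ⟨f, Q^{j+2}f⟩ = ⟨Qf, Q^j Qf⟩, reduces everything to j = 0 and j = 1.
-/
theorem integral_mul_envOp_iterate_nonneg (hlam : 0 < lam) (hP : IsStationaryMeasure P) (j : ℕ)
    {f : CoeffField d lam → ℝ} (hf : BddMeas f) : 0 ≤ ∫ a, f a * envOp^[j] f a ∂P := by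
  induction j using Nat.twoStepInduction generalizing f with
  | zero => exact integral_nonneg fun a => mul_self_nonneg _
  | one => exact integral_mul_envOp_self_nonneg hlam hP hf
  | more j ih _ =>
    have h := ih (hf.envOp hlam)
    rw [← integral_mul_envOp hlam hP hf ((hf.envOp hlam).envOp_iterate hlam j)] at h
    rwa [← Function.iterate_succ_apply' envOp, ← Function.iterate_succ_apply,
      ] at h

/-! ### Mean square displacement, entropy increments and the Liouville property. -/

/-- The local drift in the direction `k`. -/
noncomputable def walkDrift (k : Fin d) (a : CoeffField d lam) : ℝ :=
  ∑ e, stepProb a e * (stepVec e k : ℝ)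

theorem bddMeas_walkDrift (hlam : 0 < lam) (k : Fin d) :
    BddMeas (walkDrift k : CoeffField d lam → ℝ) :=
  BddMeas.sum _ fun e => (bddMeas_stepProb hlam e).mul (BddMeas.const _)

theorem walkMean_coord (n : ℕ) (k : Fin d) (a : CoeffField d lam) :
    walkMean n a (fun y => (y k : ℝ)) = ∑ j ∈ Finset.range n, envOp^[j] (walkDrift k) a := by
  induction n generalizing a with
  | zero => simp [walkMean, latticeCube_zero]
  | succ n ih =>
    rw [walkMean_succ, Finset.sum_range_succ']
    simp only [Pi.add_apply, Int.cast_add, walkMean_add, walkMean_const, ih,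
      Function.iterate_succ_apply', mul_add, Finset.sum_add_distrib]
    congr 1
    simp only [envOp, Finset.mul_sum]
    rw [Finset.sum_comm]

/-- Condition on the first step. Its square contributes at most 1. The cross term equals -2∑_j ⟨b,
Q^j b⟩ with b the local drift, which is nonpositive: in a reversible lazy environment the
correlations only slow the walk down. -/
theorem integral_walkMean_sq_le (hlam : 0 < lam) (hP : IsStationaryMeasure P) (n : ℕ)
    (k : Fin d) : ∫ a, walkMean n a (fun y => (y k : ℝ) ^ 2) ∂P ≤ n := by
  induction n with
  | zero => simp [walkMean, latticeCube_zero]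
  | succ n ih =>
    set D : CoeffField d lam → ℝ := fun a => walkMean n a fun y => (y k : ℝ) ^ 2
    set m : CoeffField d lam → ℝ := fun a => walkMean n a fun y => (y k : ℝ)
    have hD : BddMeas D := bddMeas_walkMean hlam n _
    have hm : BddMeas m := bddMeas_walkMean hlam n _
    have hrec : ∀ a, walkMean (n + 1) a (fun y => (y k : ℝ) ^ 2) = envOp D a +
        2 * ∑ e, stepProb a e * ((stepVec e k : ℝ) * m (shift (stepVec e) a)) +
        ∑ e, stepProb a e * (stepVec e k : ℝ) ^ 2 := by
      intro a
      rw [walkMean_succ, envOp, Finset.mul_sum, ← Finset.sum_add_distrib,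
        ← Finset.sum_add_distrib]
      refine Finset.sum_congr rfl fun e _ => ?_
      have : (fun y : Site d => (((y + stepVec e) k : ℤ) : ℝ) ^ 2) = fun y =>
          ((y k : ℝ) ^ 2 + (2 * (stepVec e k : ℝ)) * (y k : ℝ)) + (stepVec e k : ℝ) ^ 2 := by
        funext y; push_cast [Pi.add_apply]; ring
      rw [this, walkMean_add, walkMean_add, walkMean_const, walkMean_mul]
      simp only [D, m]
      ring
    have hb2 : ∀ e : Step d, BddMeas fun a : CoeffField d lam =>
        stepProb a e * ((stepVec e k : ℝ) * m (shift (stepVec e) a)) := fun e =>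
      (bddMeas_stepProb hlam e).mul ((BddMeas.const _).mul (hm.comp (measurable_shift _)))
    have hb3 : ∀ e : Step d, BddMeas fun a : CoeffField d lam =>
        stepProb a e * (stepVec e k : ℝ) ^ 2 := fun e =>
      (bddMeas_stepProb hlam e).mul (BddMeas.const _)
    have h2 : ∫ a, ∑ e, stepProb a e * ((stepVec e k : ℝ) * m (shift (stepVec e) a)) ∂P ≤ 0 := by
      rw [integral_finsetSum _ fun e _ => (hb2 e).integrable P]
      -- Reversing the first step changes the sign of its displacement and turns the re-centred mean
      -- into one at the original environment.
      have e1 : ∀ e : Step d,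
          ∫ a, stepProb a e * ((stepVec e k : ℝ) * m (shift (stepVec e) a)) ∂P =
          -∫ a, stepProb a (stepRev e) * ((stepVec (stepRev e) k : ℝ) * m a) ∂P := by
        intro e
        rw [integral_stepProb_mul hP e (f := fun _ => (stepVec e k : ℝ)) measurable_const hm.1,
          ← integral_neg]
        congr 1; ext a
        rw [stepVec_rev]
        push_cast [Pi.neg_apply]
        ring
      simp_rw [e1]
      rw [Finset.sum_neg_distrib, sum_comp_stepRev fun e =>
        ∫ a, stepProb a e * ((stepVec e k : ℝ) * m a) ∂P, ← integral_finsetSum]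
      · have e2 : ∀ a, ∑ e, stepProb a e * ((stepVec e k : ℝ) * m a) =
            ∑ j ∈ Finset.range n, walkDrift k a * envOp^[j] (walkDrift k) a := by
          intro a
          rw [← Finset.mul_sum, ← walkMean_coord, walkDrift, Finset.sum_mul]
          exact Finset.sum_congr rfl fun e _ => by simp only [m]; ring
        simp_rw [e2]
        rw [integral_finsetSum _ fun j _ => ((bddMeas_walkDrift hlam k).mul
          ((bddMeas_walkDrift hlam k).envOp_iterate hlam j)).integrable P]
        have := Finset.sum_nonneg fun j (_ : j ∈ Finset.range n) =>
          integral_mul_envOp_iterate_nonneg hlam hP j (bddMeas_walkDrift hlam k)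
        linarith
      · exact fun e _ => ((bddMeas_stepProb hlam e).mul ((BddMeas.const _).mul hm)).integrable P
    have h3 : ∫ a, ∑ e, stepProb a e * (stepVec e k : ℝ) ^ 2 ∂P ≤ 1 := by
      have : ∀ a : CoeffField d lam, ∑ e, stepProb a e * (stepVec e k : ℝ) ^ 2 ≤ 1 := by
        intro a
        rw [← sum_stepProb a]
        refine Finset.sum_le_sum fun e _ => mul_le_of_le_one_right (stepProb_nonneg hlam a e) ?_
        have := mem_latticeCube.1 (stepVec_mem e) k
        rw [sq_le_one_iff_abs_le_one]
        exact_mod_cast this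
      have h4 := integral_mono ((BddMeas.sum _ hb3).integrable P)
        ((BddMeas.const (1 : ℝ)).integrable P) this
      simpa using h4
    simp_rw [hrec]
    have i1 := (hD.envOp hlam).integrable P
    have i2 := (((BddMeas.const 2).mul (BddMeas.sum Finset.univ hb2))).integrable P
    have i3 := (BddMeas.sum Finset.univ hb3).integrable P
    have i12 : Integrable (fun a => envOp D a +
        2 * ∑ e, stepProb a e * ((stepVec e k : ℝ) * m (shift (stepVec e) a))) P := i1.add i2
    rw [integral_add i12 i3, integral_add i1 i2, integral_envOp hlam hP hD,
      integral_const_mul]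
    push_cast
    linarith

theorem integral_walkMean_siteSq_le (hlam : 0 < lam) (hP : IsStationaryMeasure P) (n : ℕ) :
    ∫ a, walkMean n a siteSq ∂P ≤ d * n := by
  have h1 : ∀ a : CoeffField d lam, walkMean n a siteSq =
      ∑ k, walkMean n a fun y => (y k : ℝ) ^ 2 := by
    intro a
    simp only [walkMean, siteSq, Finset.mul_sum]
    rw [Finset.sum_comm]
  simp_rw [h1]
  rw [integral_finsetSum _ fun k _ => (bddMeas_walkMean hlam n _).integrable P]
  refine (Finset.sum_le_sum fun k _ => integral_walkMean_sq_le hlam hP n k).trans (le_of_eq ?_)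
  simp

/-- Invariance of P removes the transition operator, so the averaged mutual informations are
increments of the averaged entropy. -/
theorem integral_walkInfo (hlam : 0 < lam) (hP : IsStationaryMeasure P) (n : ℕ) :
    ∫ a, walkInfo n a ∂P = ∫ a, walkEntropy (n + 1) a ∂P - ∫ a, walkEntropy n a ∂P := by
  have hH : ∀ n, BddMeas fun a : CoeffField d lam => walkEntropy n a :=
    fun n => bddMeas_walkEntropy hlam n
  rw [← integral_envOp hlam hP (hH n), ← integral_sub ((hH _).integrable P)
    (((hH n).envOp hlam).integrable P)]
  rfl

theorem bddMeas_walkInfo (hlam : 0 < lam) (n : ℕ) :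
    BddMeas fun a : CoeffField d lam => walkInfo n a :=
  (bddMeas_walkEntropy hlam (n + 1)).sub ((bddMeas_walkEntropy hlam n).envOp hlam)

/-- Otherwise the averaged entropy would eventually grow at least like (d + 1) log n, against its
upper bound d log n + C. -/
theorem frequently_integral_walkInfo_le (hlam : 0 < lam) (hP : IsStationaryMeasure P) :
    ∃ᶠ n : ℕ in atTop, (n + 1 : ℝ) * ∫ a, walkInfo n a ∂P ≤ d + 1 := by
  by_contra hcon
  rw [not_frequently, eventually_atTop] at hcon
  obtain ⟨n0, hn0⟩ := hcon
  set h : ℕ → ℝ := fun n => ∫ a, walkEntropy n a ∂P with hh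
  have hstep : ∀ n, n0 ≤ n → h n + (d + 1) * (Real.log (n + 2) - Real.log (n + 1)) ≤ h (n + 1) := by
    intro n hn
    have h1 := hn0 n hn
    rw [not_le, integral_walkInfo hlam hP] at h1
    have h2 : Real.log ((n : ℝ) + 2) - Real.log (n + 1) ≤ 1 / (n + 1) := by
      rw [← Real.log_div (by positivity) (by positivity)]
      refine (Real.log_le_sub_one_of_pos (by positivity)).trans (le_of_eq ?_)
      field_simp; ring
    have h3 : ((d : ℝ) + 1) * (1 / (n + 1)) ≤ h (n + 1) - h n := by
      rw [mul_one_div, div_le_iff₀ (by positivity)]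
      linarith
    have h4 : ((d : ℝ) + 1) * (Real.log (n + 2) - Real.log (n + 1)) ≤ (d + 1) * (1 / (n + 1)) := by
      gcongr
    linarith
  have hlow : ∀ i : ℕ, h n0 + (d + 1) * (Real.log ((n0 + i : ℕ) + 1) - Real.log (n0 + 1)) ≤
      h (n0 + i) := by
    intro i
    induction i with
    | zero => simp
    | succ i ih =>
      have := hstep (n0 + i) (by omega)
      rw [show (((n0 + (i + 1) : ℕ) : ℝ) + 1) = ((n0 + i : ℕ) : ℝ) + 2 by push_cast; ring,
        ← add_assoc]
      linarith
  have hup : ∀ n : ℕ, h n ≤ d * (Real.log 2 + Real.log (n + 1)) := by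
    intro n
    have h1 := integral_mono ((bddMeas_walkEntropy hlam n).integrable P)
      ((BddMeas.const (Real.log (latticeCube d n).card)).integrable P) (walkEntropy_le hlam n)
    rw [integral_const, probReal_univ, one_smul, card_latticeCube] at h1
    refine h1.trans ?_
    push_cast
    rw [Real.log_pow, ← Real.log_mul (by norm_num) (by positivity)]
    gcongr
    linarith
  have hlim : Tendsto (fun i : ℕ => Real.log (((n0 + i : ℕ) : ℝ) + 1)) atTop atTop :=
    Real.tendsto_log_atTop.comp (tendsto_atTop_add_const_right _ _
      (tendsto_natCast_atTop_atTop.comp (tendsto_atTop_mono (fun i => Nat.le_add_left i n0) tendsto_id)))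
  obtain ⟨i, hi⟩ := (hlim.eventually_gt_atTop
    (d * Real.log 2 - h n0 + (d + 1) * Real.log (n0 + 1))).exists
  have h1 := hlow i
  have h2 := hup (n0 + i)
  linarith

/-- Environments for which the walk is diffusive and of small mutual information along a
sequence of times. -/
def DiffusiveEnv (a : CoeffField d lam) : Prop :=
  ∃ M : ℝ, ∃ᶠ n : ℕ in atTop,
    (n + 1 : ℝ) * walkInfo n a + walkMean (n + 1) a siteSq / (n + 1) ≤ M

/-- Along the times chosen above the averages are at most (d + 1) + d. By Fatou the lower limit is
integrable, hence finite almost surely; the times at which it is approached may depend on `a`. -/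
theorem ae_diffusiveEnv (hlam : 0 < lam) (hP : IsStationaryMeasure P) :
    ∀ᵐ a ∂P, DiffusiveEnv a := by
  obtain ⟨ns, hns, hle⟩ := extraction_of_frequently_atTop
    (frequently_integral_walkInfo_le hlam hP)
  set X : ℕ → CoeffField d lam → ℝ := fun n a =>
    (n + 1 : ℝ) * walkInfo n a + walkMean (n + 1) a siteSq / (n + 1) with hX
  have hXb : ∀ n, BddMeas (X n) := by
    intro n
    have := ((BddMeas.const ((n : ℝ) + 1)).mul (bddMeas_walkInfo (d := d) hlam n)).add
      ((bddMeas_walkMean (d := d) hlam (n + 1) siteSq).mul (BddMeas.const (((n : ℝ) + 1)⁻¹)))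
    simpa only [hX, div_eq_mul_inv] using this
  have hX0 : ∀ n a, 0 ≤ X n a := by
    intro n a
    have h1 := walkInfo_nonneg hlam n a
    have h2 : 0 ≤ walkMean (n + 1) a siteSq := by
      have := walkMean_mono hlam (n + 1) a (u := fun _ => 0) (v := siteSq)
        fun y _ => Finset.sum_nonneg fun _ _ => sq_nonneg _
      rwa [walkMean_const] at this
    simp only [hX]
    positivity
  have hXint : ∀ j, ∫ a, X (ns j) a ∂P ≤ 2 * d + 1 := by
    intro j
    have h1 := hle j
    have h2 := integral_walkMean_siteSq_le (P := P) hlam hP (ns j + 1)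
    simp only [hX]
    rw [integral_add (((BddMeas.const _).mul (bddMeas_walkInfo hlam _)).integrable P)
      (by
        have := ((bddMeas_walkMean (d := d) (lam := lam) hlam (ns j + 1) siteSq).mul
          (BddMeas.const (((ns j : ℝ) + 1)⁻¹))).integrable P
        simpa only [div_eq_mul_inv] using this), integral_const_mul, integral_div]
    have h3 : (∫ a, walkMean (ns j + 1) a siteSq ∂P) / ((ns j : ℝ) + 1) ≤ d := by
      rw [div_le_iff₀ (by positivity)]
      push_cast at h2
      exact h2
    linarith
  have hfatou : ∫⁻ a, liminf (fun j => ENNReal.ofReal (X (ns j) a)) atTop ∂P ≠ ⊤ := by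
    refine ne_top_of_le_ne_top (b := ENNReal.ofReal (2 * d + 1)) ENNReal.ofReal_ne_top ?_
    refine (lintegral_liminf_le fun j => (hXb _).1.ennreal_ofReal).trans ?_
    refine liminf_le_of_frequently_le' (Frequently.of_forall fun j => ?_)
    rw [← ofReal_integral_eq_lintegral_ofReal ((hXb _).integrable P)
      (Eventually.of_forall (hX0 _))]
    exact ENNReal.ofReal_le_ofReal (hXint j)
  have hae := ae_lt_top (Measurable.liminf fun j => (hXb (ns j)).1.ennreal_ofReal) hfatou
  filter_upwards [hae] with a ha
  obtain ⟨M, hM1, hM2⟩ := ENNReal.lt_iff_exists_nnreal_btwn.1 ha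
  refine ⟨M, ?_⟩
  have hfr := frequently_lt_of_liminf_lt (by isBoundedDefault) hM1
  refine hns.tendsto_atTop.frequently (hfr.mono fun j hj => ?_)
  have : X (ns j) a ≤ M := by
    have h1 : ENNReal.ofReal (X (ns j) a) < ENNReal.ofReal M := by simpa using hj
    exact ((ENNReal.ofReal_lt_ofReal_iff' ).1 h1).1.le
  exact this

/-- Along good times I_n ≤ M/(n + 1) and E|X_{n+1}|² ≤ M(n + 1). With u² ≤ ε|x|² + B the key
inequality yields 4εM² + 4MB/(n + 1), which is arbitrarily small. -/
theorem DiffusiveEnv.eq_zero_step (hd : 2 ≤ d) (hlam : 0 < lam) {a : CoeffField d lam}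
    (ha : DiffusiveEnv a) {u : Site d → ℝ} (hu : ∀ z, gradStar (mulField a (grad u)) z = 0)
    (hgrow : ∀ ε : ℝ, 0 < ε → ∃ B : ℝ, 0 ≤ B ∧ ∀ x, u x ^ 2 ≤ ε * siteSq x + B) (k : Fin d) :
    u (unit k) = u 0 := by
  obtain ⟨M, hM⟩ := ha
  set e : Step d := some (k, true)
  have hw : 0 < stepProb a e := lt_of_lt_of_le (by
    have : (0 : ℝ) < d := by exact_mod_cast (show 0 < d by omega)
    positivity) (jumpProb_bounds hlam a (k, true)).1
  have hM0 : 0 ≤ M := by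
    obtain ⟨n, hn⟩ := hM.exists
    refine le_trans ?_ hn
    have h1 := walkInfo_nonneg hlam n a
    have h2 : 0 ≤ walkMean (n + 1) a siteSq := by
      have := walkMean_mono hlam (n + 1) a (u := fun _ => 0) (v := siteSq)
        fun y _ => Finset.sum_nonneg fun _ _ => sq_nonneg _
      rwa [walkMean_const] at this
    positivity
  have key : ∀ ε : ℝ, 0 < ε → stepProb a e ^ 2 * (u (stepVec e) - u 0) ^ 2 ≤
      4 * (M * (ε * M)) + ε := by
    intro ε hε
    obtain ⟨B, hB0, hB⟩ := hgrow ε hε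
    have hlim : ∀ᶠ n : ℕ in atTop, 4 * (M * B) ≤ ε * (n + 1) := by
      have : Tendsto (fun n : ℕ => ε * ((n : ℝ) + 1)) atTop atTop :=
        (tendsto_atTop_add_const_right _ _ tendsto_natCast_atTop_atTop).const_mul_atTop hε
      exact this.eventually_ge_atTop _
    obtain ⟨n, hn, hn2⟩ := (hM.and_eventually hlim).exists
    have hI := walkInfo_nonneg hlam n a
    have hD : 0 ≤ walkMean (n + 1) a siteSq := by
      have := walkMean_mono hlam (n + 1) a (u := fun _ => 0) (v := siteSq)
        fun y _ => Finset.sum_nonneg fun _ _ => sq_nonneg _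
      rwa [walkMean_const] at this
    have hn1 : (0 : ℝ) < n + 1 := by positivity
    have hI' : walkInfo n a ≤ M / (n + 1) := by
      rw [le_div_iff₀ hn1]
      have : 0 ≤ walkMean (n + 1) a siteSq / (n + 1) := by positivity
      linarith
    have hD' : walkMean (n + 1) a siteSq ≤ M * (n + 1) := by
      rw [← div_le_iff₀ hn1]
      have : 0 ≤ ((n : ℝ) + 1) * walkInfo n a := by positivity
      linarith
    have hmean : walkMean (n + 1) a (fun y => u y ^ 2) ≤ ε * (M * (n + 1)) + B := by
      refine (walkMean_mono hlam (n + 1) a fun y _ => hB y).trans ?_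
      rw [walkMean_add, walkMean_mul, walkMean_const]
      gcongr
    refine (sq_sub_le_walkInfo (by omega) hlam n a hu e).trans ?_
    calc 4 * walkInfo n a * walkMean (n + 1) a (fun y => u y ^ 2)
        ≤ 4 * (M / (n + 1)) * (ε * (M * (n + 1)) + B) := by
          gcongr
          exact Finset.sum_nonneg fun y _ => mul_nonneg (walkLaw_nonneg hlam _ _ _) (sq_nonneg _)
      _ = 4 * (M * (ε * M)) + 4 * (M * B) / (n + 1) := by field_simp
      _ ≤ _ := by
          gcongr
          rwa [div_le_iff₀ hn1]
  have h0 : stepProb a e ^ 2 * (u (stepVec e) - u 0) ^ 2 ≤ 0 := by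
    refine le_of_forall_pos_le_add fun δ hδ => ?_
    -- This ε satisfies 4M²ε + ε = δ.
    have h1 := key (δ / (4 * M * M + 1)) (by positivity)
    refine h1.trans (le_of_eq ?_)
    field_simp
    ring
  have h1 : (u (stepVec e) - u 0) ^ 2 ≤ 0 := by
    by_contra hcon
    push Not at hcon
    have : 0 < stepProb a e ^ 2 * (u (stepVec e) - u 0) ^ 2 := by positivity
    linarith
  have h2 : u (stepVec e) - u 0 = 0 := by
    have := le_antisymm h1 (sq_nonneg _)
    simpa using this
  exact sub_eq_zero.1 h2

/-- A diffusive environment only controls the gradient at the origin, so all shifts of `a` are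
required to be diffusive, which by stationarity still holds almost surely. -/
theorem ae_liouvilleProperty (hd : 2 ≤ d) (hlam : 0 < lam) (hP : IsStationaryMeasure P) :
    ∀ᵐ a ∂P, LiouvilleProperty a := by
  have hall : ∀ᵐ a ∂P, ∀ x : Site d, DiffusiveEnv (shift x a) :=
    ae_all_iff.2 fun x => (hP x).quasiMeasurePreserving.ae (ae_diffusiveEnv hlam hP)
  filter_upwards [hall] with a ha u hu hsub
  refine eq_of_grad_eq_zero fun x => ?_
  ext k
  rw [grad_apply]
  have h1 := (ha x).eq_zero_step hd hlam (u := fun y => u (y + x))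
    (fun z => by rw [gradStar_shift, hu]) (fun ε hε => ?_) k
  · simp only [zero_add] at h1
    rw [add_comm x, h1]
    simp
  · obtain ⟨B, hB0, hB⟩ := hsub.pointwise hd hlam hu (show 0 < ε / 2 by positivity)
    refine ⟨ε * siteSq x + B, ?_, fun y => (hB _).trans ?_⟩
    · have : 0 ≤ siteSq x := Finset.sum_nonneg fun _ _ => sq_nonneg _
      positivity
    · have : siteSq (y + x) ≤ 2 * siteSq y + 2 * siteSq x := by
        simp only [siteSq, Finset.mul_sum, ← Finset.sum_add_distrib]
        refine Finset.sum_le_sum fun k _ => ?_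
        push_cast [Pi.add_apply]
        nlinarith [sq_nonneg ((y k : ℝ) - x k)]
      have := mul_le_mul_of_nonneg_left this (show 0 ≤ ε / 2 by positivity)
      linarith

end Environment


/-! ### The maximal inequality -/

/-- Vitali covering: lattice cubes are closed balls of the sup metric, so some of the selected cubes
are disjoint while their fivefold enlargements cover `S`. -/
theorem card_mul_le_of_forall_cube {d N : ℕ} (F : Site d → ENNReal) (α : ENNReal)
    {S : Finset (Site d)} (hS : S ⊆ latticeCube d N)
    (hx : ∀ x ∈ S, ∃ R ≤ N, α * (latticeCube d R).card ≤ ∑ y ∈ latticeCube d R, F (y + x)) :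
    α * S.card ≤ 5 ^ d * ∑ y ∈ latticeCube d (2 * N), F y := by
  classical
  choose! R hRN hR using hx
  obtain ⟨u, huS, hdisj, hcov⟩ := Vitali.exists_disjoint_subfamily_covering_enlargement_closedBall
    (α := Site d) (ι := Site d) (S : Set (Site d)) (fun x => x) (fun x => (R x : ℝ)) N
    (fun x hx => by exact_mod_cast hRN x hx) 5 (by norm_num)
  have hufin : u.Finite := S.finite_toSet.subset huS
  lift u to Finset (Site d) using hufin
  have hball : ∀ (x y : Site d) (r : ℕ), y ∈ Metric.closedBall x (r : ℝ) ↔ y - x ∈ latticeCube d r := by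
    intro x y r
    rw [Metric.mem_closedBall, dist_eq_norm, mem_latticeCube_iff_norm]
  have h1 : S ⊆ u.biUnion fun b => (latticeCube d (5 * R b)).image fun y => y + b := by
    intro x hx
    obtain ⟨b, hb, hsub⟩ := hcov x hx
    have h2 : x ∈ Metric.closedBall b ((5 * R b : ℕ) : ℝ) := by
      push_cast
      exact hsub (Metric.mem_closedBall_self (by positivity))
    rw [hball] at h2
    exact Finset.mem_biUnion.2 ⟨b, hb, Finset.mem_image.2 ⟨_, h2, by simp⟩⟩
  have h2 : S.card ≤ ∑ b ∈ u, 5 ^ d * (latticeCube d (R b)).card := by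
    refine (Finset.card_le_card h1).trans (Finset.card_biUnion_le.trans ?_)
    refine Finset.sum_le_sum fun b _ => Finset.card_image_le.trans ?_
    rw [card_latticeCube, card_latticeCube, ← mul_pow]
    exact Nat.pow_le_pow_left (by omega) d
  calc α * S.card ≤ α * ((∑ b ∈ u, 5 ^ d * (latticeCube d (R b)).card : ℕ) : ENNReal) := by
        gcongr
    _ = 5 ^ d * ∑ b ∈ u, α * (latticeCube d (R b)).card := by
        push_cast
        rw [← Finset.mul_sum, ← Finset.mul_sum]; ring
    _ ≤ 5 ^ d * ∑ b ∈ u, ∑ y ∈ (latticeCube d (R b)).image fun y => y + b, F y := by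
        gcongr with b hb
        rw [Finset.sum_image fun _ _ _ _ h => add_left_injective b h]
        exact hR b (huS hb)
    _ = 5 ^ d * ∑ y ∈ u.biUnion fun b => (latticeCube d (R b)).image fun y => y + b, F y := by
        rw [Finset.sum_biUnion]
        intro b hb c hc hbc
        rw [Function.onFun, Finset.disjoint_left]
        intro y hy hy'
        obtain ⟨z, hz, rfl⟩ := Finset.mem_image.1 hy
        obtain ⟨z', hz', h⟩ := Finset.mem_image.1 hy'
        have h3 : z + b ∈ Metric.closedBall b (R b : ℝ) := by rw [hball]; simpa using hz
        have h4 : z + b ∈ Metric.closedBall c (R c : ℝ) := by rw [hball, ← h]; simpa using hz'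
        exact Set.disjoint_left.1 (hdisj hb hc hbc) h3 h4
    _ ≤ 5 ^ d * ∑ y ∈ latticeCube d (2 * N), F y := by
        gcongr
        intro y hy
        obtain ⟨b, hb, hy⟩ := Finset.mem_biUnion.1 hy
        obtain ⟨z, hz, rfl⟩ := Finset.mem_image.1 hy
        rw [two_mul]
        exact add_mem_latticeCube (latticeCube_mono (hRN b (huS hb)) hz) (hS (huS hb))

/-- Weak type maximal inequality for averages along lattice shifts. -/
theorem maximal_inequality {d : ℕ} {lam : ℝ} {P : Measure (CoeffField d lam)}
    (hP : IsStationaryMeasure P) {f : CoeffField d lam → ENNReal} (hf : Measurable f) (α : ENNReal) :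
    α * P {a | ∃ R : ℕ, α * (latticeCube d R).card ≤ ∑ y ∈ latticeCube d R, f (shift y a)} ≤
      10 ^ d * ∫⁻ a, f a ∂P := by
  classical
  -- Restricting to R ≤ N makes the covering argument finite; N tends to infinity at the end by
  -- monotonicity.
  set B : ℕ → Set (CoeffField d lam) := fun N =>
    {a | ∃ R ≤ N, α * (latticeCube d R).card ≤ ∑ y ∈ latticeCube d R, f (shift y a)} with hB
  have hBm : ∀ N, MeasurableSet (B N) := by
    intro N
    have : B N = ⋃ R ∈ Finset.range (N + 1),
        {a | α * (latticeCube d R).card ≤ ∑ y ∈ latticeCube d R, f (shift y a)} := by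
      ext a; simp [hB]
    rw [this]
    exact Finset.measurableSet_biUnion _ fun R _ => measurableSet_le measurable_const
      (Finset.measurable_fun_sum _ fun y _ => hf.comp (measurable_shift y))
  have hmono : Monotone B := fun M N hMN a ⟨R, hR, h⟩ => ⟨R, hR.trans hMN, h⟩
  have hunion : {a | ∃ R : ℕ, α * (latticeCube d R).card ≤
      ∑ y ∈ latticeCube d R, f (shift y a)} = ⋃ N, B N := by
    ext a
    simp only [hB, Set.mem_iUnion, Set.mem_ofPred_eq]
    exact ⟨fun ⟨R, h⟩ => ⟨R, R, le_rfl, h⟩, fun ⟨_, R, _, h⟩ => ⟨R, h⟩⟩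
  have hN : ∀ N, α * P (B N) ≤ 10 ^ d * ∫⁻ a, f a ∂P := by
    intro N
    -- Transference: the covering bound is applied along the orbit of `a`, and integration with
    -- stationarity removes the shifts. The enlargement from N to 2N turns 5^d into 10^d.
    have hpt : ∀ a, α * ∑ x ∈ latticeCube d N, (B N).indicator 1 (shift x a) ≤
        5 ^ d * ∑ y ∈ latticeCube d (2 * N), f (shift y a) := by
      intro a
      have h1 := card_mul_le_of_forall_cube (fun y => f (shift y a)) α
        (S := (latticeCube d N).filter fun x => shift x a ∈ B N) (Finset.filter_subset _ _)
        (fun x hx => by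
          obtain ⟨R, hR, h⟩ := (Finset.mem_filter.1 hx).2
          refine ⟨R, hR, h.trans (le_of_eq (Finset.sum_congr rfl fun y _ => ?_))⟩
          rw [shift_shift])
      refine le_trans (le_of_eq ?_) h1
      rw [Finset.card_filter]
      push_cast
      congr 1
      refine Finset.sum_congr rfl fun x _ => ?_
      by_cases h : shift x a ∈ B N <;> simp [h]
    have hint := lintegral_mono (μ := P) hpt
    have hshift : ∀ (g : CoeffField d lam → ENNReal), Measurable g → ∀ x,
        ∫⁻ a, g (shift x a) ∂P = ∫⁻ a, g a ∂P := fun g hg x => (hP x).lintegral_comp hg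
    have hind : Measurable ((B N).indicator (1 : CoeffField d lam → ENNReal)) :=
      measurable_one.indicator (hBm N)
    have hind' : ∀ x, Measurable fun a => (B N).indicator (1 : CoeffField d lam → ENNReal)
        (shift x a) := fun x => hind.comp (measurable_shift x)
    have hf' : ∀ x, Measurable fun a => f (shift x a) := fun x => hf.comp (measurable_shift x)
    rw [lintegral_const_mul _ (Finset.measurable_fun_sum _ fun x _ => hind' x),
      lintegral_finsetSum _ fun x _ => hind' x,
      lintegral_const_mul _ (Finset.measurable_fun_sum _ fun x _ => hf' x),
      lintegral_finsetSum _ fun x _ => hf' x] at hint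
    simp_rw [hshift _ hind, hshift _ hf] at hint
    rw [lintegral_indicator_one (hBm N), Finset.sum_const, Finset.sum_const, nsmul_eq_mul,
      nsmul_eq_mul] at hint
    have hcard : (((latticeCube d (2 * N)).card : ℕ) : ENNReal) ≤
        2 ^ d * ((latticeCube d N).card : ℕ) := by
      rw [card_latticeCube, card_latticeCube]
      have : (2 * (2 * N) + 1) ^ d ≤ 2 ^ d * (2 * N + 1) ^ d := by
        rw [← mul_pow]; exact Nat.pow_le_pow_left (by omega) d
      exact_mod_cast this
    have hc0 : (((latticeCube d N).card : ℕ) : ENNReal) ≠ 0 := by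
      have := (latticeCube_nonempty d N).card_pos.ne'
      exact_mod_cast this
    refine (ENNReal.mul_le_mul_iff_right hc0 (ENNReal.natCast_ne_top _)).1 ?_
    calc _ = α * (((latticeCube d N).card : ℕ) * P (B N)) := by ring
      _ ≤ 5 ^ d * (((latticeCube d (2 * N)).card : ℕ) * ∫⁻ a, f a ∂P) := hint
      _ ≤ 5 ^ d * ((2 ^ d * ((latticeCube d N).card : ℕ)) * ∫⁻ a, f a ∂P) := by gcongr
      _ = _ := by
        rw [show (10 : ENNReal) ^ d = 5 ^ d * 2 ^ d by rw [← mul_pow]; norm_num]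
        ring
  rw [hunion, hmono.measure_iUnion, ENNReal.mul_iSup]
  exact iSup_le hN

/-! ### Projection onto stationary gradients -/

section Potential

variable {d : ℕ} {lam : ℝ}

/-- A measurable weight field with values in `[c, 1]`. -/
structure IsWeight (w : CoeffField d lam → Fin d → ℝ) (c : ℝ) : Prop where
  pos : 0 < c
  measurable : ∀ k, Measurable fun a => w a k
  lower : ∀ a k, c ≤ w a k
  upper : ∀ a k, w a k ≤ 1

/-- The weighted gradient of the stationary field generated by `ψ`. -/
noncomputable def statGrad (w : CoeffField d lam → Fin d → ℝ) (ψ : CoeffField d lam → ℝ)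
    (a : CoeffField d lam) : EuclideanSpace ℝ (Fin d) :=
  WithLp.toLp 2 fun k => w a k * (ψ (shift (unit k) a) - ψ a)

variable {P : Measure (CoeffField d lam)} {w : CoeffField d lam → Fin d → ℝ} {c : ℝ}

theorem memLp_comp_shift (hP : IsStationaryMeasure P) {f : CoeffField d lam → ℝ}
    (hf : MemLp f 2 P) (z : Site d) : MemLp (fun a => f (shift z a)) 2 P :=
  hf.comp_measurePreserving (hP z)

theorem memLp_statGrad (hP : IsStationaryMeasure P) (hw : IsWeight w c)
    {ψ : CoeffField d lam → ℝ} (hψ : MemLp ψ 2 P) :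
    MemLp (statGrad w ψ) 2 P := by
  refine MemLp.of_eval_piLp fun k => ?_
  have h1 : MemLp (fun a => ψ (shift (unit k) a) - ψ a) 2 P := (memLp_comp_shift hP hψ _).sub hψ
  refine h1.of_le_mul (c := 1) ((hw.measurable k).aestronglyMeasurable.mul h1.1)
    (Eventually.of_forall fun a => ?_)
  simp only [statGrad, norm_mul]
  gcongr
  rw [Real.norm_eq_abs, abs_of_nonneg (hw.pos.le.trans (hw.lower a k))]
  exact hw.upper a k

theorem measurable_statGrad (hw : IsWeight w c) {ψ : CoeffField d lam → ℝ} (hψ : Measurable ψ) :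
    Measurable (statGrad w ψ) := by
  refine (WithLp.measurable_toLp 2 _).comp (measurable_pi_lambda _ fun k => ?_)
  exact (hw.measurable k).mul ((hψ.comp (measurable_shift _)).sub hψ)

/-- The weighted gradients of square integrable stationary fields. -/
def statGradSubmodule (P : Measure (CoeffField d lam)) (w : CoeffField d lam → Fin d → ℝ) :
    Submodule ℝ (Lp (EuclideanSpace ℝ (Fin d)) 2 P) where
  carrier := {F | ∃ ψ : CoeffField d lam → ℝ, Measurable ψ ∧ MemLp ψ 2 P ∧ F =ᵐ[P] statGrad w ψ}
  add_mem' := by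
    rintro F G ⟨ψ, hψ, hψ2, hF⟩ ⟨χ, hχ, hχ2, hG⟩
    refine ⟨ψ + χ, hψ.add hχ, hψ2.add hχ2, ?_⟩
    filter_upwards [hF, hG, Lp.coeFn_add F G] with a h1 h2 h3
    rw [h3, Pi.add_apply, h1, h2]
    ext k
    simp only [statGrad, PiLp.add_apply, Pi.add_apply]
    ring
  zero_mem' := by
    refine ⟨0, measurable_const, MemLp.zero, ?_⟩
    filter_upwards [Lp.coeFn_zero (EuclideanSpace ℝ (Fin d)) 2 P] with a h
    rw [h]
    ext k
    simp [statGrad]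
  smul_mem' := by
    rintro r F ⟨ψ, hψ, hψ2, hF⟩
    refine ⟨r • ψ, hψ.const_smul r, hψ2.const_smul r, ?_⟩
    filter_upwards [hF, Lp.coeFn_smul r F] with a h1 h2
    rw [h2, Pi.smul_apply, h1]
    ext k
    simp only [statGrad, PiLp.smul_apply, Pi.smul_apply, smul_eq_mul]
    ring

/-- Elements of the closure of the weighted stationary gradients are limits, in `L²` and almost
everywhere, of such gradients. -/
theorem exists_seq_of_mem_closure {p : Lp (EuclideanSpace ℝ (Fin d)) 2 P}
    (hp : p ∈ (statGradSubmodule P w).topologicalClosure) :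
    ∃ ψ : ℕ → CoeffField d lam → ℝ, (∀ n, Measurable (ψ n) ∧ MemLp (ψ n) 2 P) ∧
      Tendsto (fun n => eLpNorm (fun a => statGrad w (ψ n) a - p a) 2 P) atTop (𝓝 0) ∧
      ∀ᵐ a ∂P, ∀ k, Tendsto (fun n => statGrad w (ψ n) a k) atTop (𝓝 (p a k)) := by
  obtain ⟨F, hF, hFp⟩ := mem_closure_iff_seq_limit.1
    (show p ∈ closure (statGradSubmodule P w : Set (Lp (EuclideanSpace ℝ (Fin d)) 2 P)) from hp)
  obtain ⟨ns, hns, hae⟩ := (tendstoInMeasure_of_tendsto_Lp hFp).exists_seq_tendsto_ae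
  choose ψ hψm hψ2 hψF using hF
  refine ⟨fun n => ψ (ns n), fun n => ⟨hψm _, hψ2 _⟩, ?_, ?_⟩
  · have h1 : Tendsto (fun n => eLpNorm (⇑(F (ns n)) - ⇑p) 2 P) atTop (𝓝 0) :=
      ((Lp.tendsto_Lp_iff_tendsto_eLpNorm' F p).1 hFp).comp hns.tendsto_atTop
    refine h1.congr fun n => eLpNorm_congr_ae ?_
    filter_upwards [hψF (ns n)] with a h
    rw [Pi.sub_apply, h]
  · have h1 : ∀ᵐ a ∂P, ∀ n, F n a = statGrad w (ψ n) a := ae_all_iff.2 hψF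
    filter_upwards [hae, h1] with a h2 h3 k
    simp_rw [← h3]
    exact ((EuclideanSpace.proj k : EuclideanSpace ℝ (Fin d) →L[ℝ] ℝ).continuous.tendsto _).comp h2

/-- Orthogonal projection onto the closure of the weighted stationary gradients. -/
theorem exists_statGrad_projection (hP : IsStationaryMeasure P) (hw : IsWeight w c)
    {g : CoeffField d lam → EuclideanSpace ℝ (Fin d)} (hg : MemLp g 2 P) :
    ∃ (p : CoeffField d lam → EuclideanSpace ℝ (Fin d)) (ψ : ℕ → CoeffField d lam → ℝ),
      Measurable p ∧ MemLp p 2 P ∧ (∀ n, Measurable (ψ n) ∧ MemLp (ψ n) 2 P) ∧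
      Tendsto (fun n => eLpNorm (fun a => statGrad w (ψ n) a - p a) 2 P) atTop (𝓝 0) ∧
      (∀ᵐ a ∂P, ∀ k, Tendsto (fun n => statGrad w (ψ n) a k) atTop (𝓝 (p a k))) ∧
      (∀ χ : CoeffField d lam → ℝ, Measurable χ → MemLp χ 2 P →
        ∫ a, inner ℝ (g a - p a) (statGrad w χ a) ∂P = 0) ∧
      ∀ h : CoeffField d lam → EuclideanSpace ℝ (Fin d), MemLp h 2 P →
        (∀ χ : CoeffField d lam → ℝ, Measurable χ → MemLp χ 2 P →
          ∫ a, inner ℝ (h a) (statGrad w χ a) ∂P = 0) →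
        ∫ a, inner ℝ (h a) (p a) ∂P = 0 := by
  set W := statGradSubmodule P w with hW
  set K := W.topologicalClosure with hK
  have : CompleteSpace K := W.isClosed_topologicalClosure.completeSpace_coe
  set g' := hg.toLp g with hg'
  set p := K.starProjection g' with hp
  have hpK : p ∈ K := K.starProjection_apply_mem g'
  have hmemW : ∀ χ : CoeffField d lam → ℝ, Measurable χ → ∀ hχ : MemLp χ 2 P,
      (memLp_statGrad hP hw hχ).toLp _ ∈ W := fun χ hχ hχ2 =>
    ⟨χ, hχ, hχ2, MemLp.coeFn_toLp _⟩
  obtain ⟨ψ, hψ, hlim, hae⟩ := exists_seq_of_mem_closure hpK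
  refine ⟨p, ψ, (Lp.stronglyMeasurable p).measurable, Lp.memLp p, hψ, hlim, hae, ?_, ?_⟩
  · intro χ hχ hχ2
    have h1 : inner ℝ (g' - p) ((memLp_statGrad hP hw hχ2).toLp _) = 0 :=
      (Submodule.mem_orthogonal' K _).1 (K.sub_starProjection_mem_orthogonal g') _
        (W.le_topologicalClosure (hmemW χ hχ hχ2))
    rw [← h1, L2.inner_def]
    refine integral_congr_ae ?_
    filter_upwards [Lp.coeFn_sub g' p, hg.coeFn_toLp,
      (memLp_statGrad hP hw hχ2).coeFn_toLp] with a h2 h3 h4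
    rw [h2, h4, Pi.sub_apply, h3]
  · intro h hh horth
    -- The kernel of pairing with `h` is closed, so it contains the closure of the gradients as soon
    -- as it contains the gradients.
    have h1 : W ≤ (LinearMap.ker (innerSL ℝ (hh.toLp h)).toLinearMap) := by
      rintro G ⟨χ, hχ, hχ2, hG⟩
      rw [LinearMap.mem_ker, ← horth χ hχ hχ2]
      change inner ℝ (hh.toLp h) G = _
      rw [L2.inner_def]
      refine integral_congr_ae ?_
      filter_upwards [hG, hh.coeFn_toLp] with a h2 h3
      rw [h2, h3]
    have h2 : K ≤ (LinearMap.ker (innerSL ℝ (hh.toLp h)).toLinearMap) :=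
      W.topologicalClosure_minimal h1 (innerSL ℝ (hh.toLp h)).isClosed_ker
    have h3 : inner ℝ (hh.toLp h) p = 0 := h2 hpK
    rw [← h3, L2.inner_def]
    refine integral_congr_ae ?_
    filter_upwards [hh.coeFn_toLp] with a h4
    rw [h4]

end Potential

/-! ### Existence of the random corrector -/

section Existence

variable {d : ℕ} {lam : ℝ} {P : Measure (CoeffField d lam)}

theorem ae_shift (hP : IsStationaryMeasure P) {p : CoeffField d lam → Prop}
    (h : ∀ᵐ a ∂P, p a) : ∀ᵐ a ∂P, ∀ x, p (shift x a) :=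
  ae_all_iff.2 fun x => (hP x).quasiMeasurePreserving.ae h

/-- A random field whose increments are the limits of those of stationary fields. -/
theorem exists_field_of_tendsto (hP : IsStationaryMeasure P) {ψ : ℕ → CoeffField d lam → ℝ}
    (hψ : ∀ n, Measurable (ψ n)) {χ : CoeffField d lam → Fin d → ℝ}
    (h : ∀ᵐ a ∂P, ∀ k, Tendsto (fun n => ψ n (shift (unit k) a) - ψ n a) atTop (𝓝 (χ a k))) :
    ∃ φ : CoeffField d lam → Site d → ℝ, (∀ x, Measurable fun a => φ a x) ∧ (∀ a, φ a 0 = 0) ∧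
      ∀ᵐ a ∂P, ∀ x k, grad (φ a) x k = χ (shift x a) k := by
  set u : ℕ → Site d → CoeffField d lam → ℝ := fun n x a => ψ n (shift x a) - ψ n a with hu
  have hum : ∀ n x, Measurable (u n x) := fun n x =>
    ((hψ n).comp (measurable_shift x)).sub (hψ n)
  -- The measurable set where all limits exist; cutting off outside it makes φ defined for every `a`
  -- and measurable.
  set S : Set (CoeffField d lam) := ⋂ x, {a | ∃ c, Tendsto (fun n => u n x a) atTop (𝓝 c)} with hS
  have hSm : MeasurableSet S :=
    MeasurableSet.iInter fun x => measurableSet_exists_tendsto fun n => hum n x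
  have hex : ∀ a x, ∃ c, Tendsto (fun n => S.indicator (u n x) a) atTop (𝓝 c) := by
    intro a x
    by_cases ha : a ∈ S
    · obtain ⟨c, hc⟩ := Set.mem_iInter.1 ha x
      exact ⟨c, by simpa [ha] using hc⟩
    · exact ⟨0, by simp [ha]⟩
  choose φ hφ using hex
  refine ⟨φ, fun x => ?_, fun a => ?_, ?_⟩
  · exact measurable_of_tendsto_metrizable (fun n => (hum n x).indicator hSm)
      (tendsto_pi_nhds.2 fun a => hφ a x)
  · refine tendsto_nhds_unique (hφ a 0) ?_
    have : ∀ n, S.indicator (u n 0) a = 0 := fun n => by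
      by_cases ha : a ∈ S <;> simp [ha, hu, shift_zero]
    simp [this]
  · filter_upwards [ae_shift hP h] with a ha
    have hinc : ∀ x k, Tendsto (fun n => u n (x + unit k) a - u n x a) atTop
        (𝓝 (χ (shift x a) k)) := by
      intro x k
      refine (ha x k).congr fun n => ?_
      simp only [hu]
      rw [shift_shift, add_comm (unit k) x]
      ring
    have haS : a ∈ S := by
      refine Set.mem_iInter.2 fun x => ?_
      obtain ⟨c, hc⟩ := exists_potential_of_tendsto (u := fun n x => u n x a) hinc x
      refine ⟨c, hc.congr fun n => ?_⟩
      simp [hu, shift_zero]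
    intro x k
    rw [grad_apply]
    refine tendsto_nhds_unique ((hφ a (x + unit k)).sub (hφ a x)) ?_
    simpa [haS] using hinc x k

theorem mulField_shift (a : CoeffField d lam) (u v : Site d → ℝ) (i : Fin d) (x : Site d)
    (h : ∀ z, grad v z = grad u (z + x)) :
    gradStar (mulField (shift x a) fun z => grad v z + EuclideanSpace.single i (1 : ℝ)) 0 =
      gradStar (mulField a fun z => grad u z + EuclideanSpace.single i (1 : ℝ)) x := by
  simp only [gradStar, mulField, h, shift]
  refine Finset.sum_congr rfl fun k _ => ?_
  rw [show (0 : Site d) - unit k + x = x - unit k by abel, zero_add]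

/-- With weight √a the corrector equation is an orthogonality relation: if p is the projection of √a
e_i onto the closure of the √a-weighted stationary gradients, then ∇φ = -p/√a gives a(∇φ + e_i) =
√a(√a e_i - p), which is orthogonal to all unweighted stationary gradients. -/
theorem exists_isRandomCorrector [IsProbabilityMeasure P] (hlam : 0 < lam)
    (hP : IsStationaryMeasure P) (i : Fin d) : ∃ φ, IsRandomCorrector P i φ := by
  have hco : ∀ (x : Site d) (k : Fin d), Measurable fun a : CoeffField d lam => (a x k : ℝ) :=
    fun x k => measurable_subtype_coe.comp ((measurable_pi_apply k).comp (measurable_pi_apply x))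
  set w : CoeffField d lam → Fin d → ℝ := fun a k => √(a 0 k : ℝ) with hwdef
  have hw : IsWeight w √lam :=
    { pos := Real.sqrt_pos.2 hlam
      measurable := fun k => (hco 0 k).sqrt
      lower := fun a k => Real.sqrt_le_sqrt (a 0 k).2.1.le
      upper := fun a k => Real.sqrt_le_one.2 (a 0 k).2.2.le }
  have hw0 : ∀ a k, 0 < w a k := fun a k => hw.pos.trans_le (hw.lower a k)
  have hww : ∀ a k, w a k * w a k = a 0 k := fun a k =>
    Real.mul_self_sqrt (coeff_pos hlam a 0 k).le
  have hwinv : ∀ a k, (w a k)⁻¹ ≤ (√lam)⁻¹ := fun a k => inv_anti₀ hw.pos (hw.lower a k)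
  set g : CoeffField d lam → EuclideanSpace ℝ (Fin d) := fun a =>
    WithLp.toLp 2 fun k => if k = i then w a k else 0 with hg
  have hg2 : MemLp g 2 P := by
    refine MemLp.of_eval_piLp fun k => ?_
    by_cases hk : k = i
    · simp only [hg, hk, if_true]
      refine MemLp.of_bound (hw.measurable i).aestronglyMeasurable 1
        (Eventually.of_forall fun a => ?_)
      rw [Real.norm_eq_abs, abs_of_pos (hw0 a i)]
      exact hw.upper a i
    · simp only [hg, hk, if_false]
      exact MemLp.zero
  obtain ⟨p, ψ, hpm, hp2, hψ, -, hae, horth, hann⟩ := exists_statGrad_projection hP hw hg2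
  have hpk : ∀ k, MemLp (fun a => p a k) 2 P := fun k => hp2.eval_piLp k
  obtain ⟨φ, hφm, hφ0, hφ⟩ := exists_field_of_tendsto hP (ψ := fun n a => -ψ n a)
    (fun n => (hψ n).1.neg) (χ := fun a k => -(p a k / w a k)) (by
      filter_upwards [hae] with a ha k
      refine ((ha k).div_const (w a k)).neg.congr fun n => ?_
      simp only [statGrad]
      field_simp [(hw0 a k).ne']
      ring)
  have hφ' : ∀ᵐ a ∂P, ∀ k, grad (φ a) 0 k = -(p a k / w a k) := by
    filter_upwards [hφ] with a ha k
    rw [ha, shift_zero]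
  have hstat : ∀ᵐ a ∂P, ∀ x, grad (φ a) x = grad (φ (shift x a)) 0 := by
    filter_upwards [hφ, ae_shift hP hφ'] with a h1 h2 x
    ext k
    rw [h1, h2]
  have hgrad2 : ∀ k, MemLp (fun a => grad (φ a) 0 k) 2 P := by
    intro k
    have h1 : Measurable fun a => grad (φ a) 0 k := (hφm _).sub (hφm _)
    refine (hpk k).of_le_mul (c := (√lam)⁻¹) h1.aestronglyMeasurable ?_
    filter_upwards [hφ'] with a ha
    rw [ha, norm_neg, norm_div, div_eq_inv_mul, Real.norm_eq_abs (w a k), abs_of_pos (hw0 a k)]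
    exact mul_le_mul_of_nonneg_right (hwinv a k) (norm_nonneg _)
  have hmean : ∀ k, ∫ a, grad (φ a) 0 k ∂P = 0 := by
    intro k
    -- Pairing with e_k/√a undoes the weight. Stationary differences have mean zero, so this field
    -- annihilates all weighted gradients, hence also p, which gives E∇φ = 0.
    set h : CoeffField d lam → EuclideanSpace ℝ (Fin d) := fun a =>
      WithLp.toLp 2 fun j => if j = k then (w a j)⁻¹ else 0 with hh
    have hinner : ∀ a (v : EuclideanSpace ℝ (Fin d)), inner ℝ (h a) v = v k / w a k := by
      intro a v
      simp [PiLp.inner_apply, hh, div_eq_mul_inv]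
    have hh2 : MemLp h 2 P := by
      refine MemLp.of_eval_piLp fun j => ?_
      by_cases hk : j = k
      · simp only [hh, hk, if_true]
        refine MemLp.of_bound (hw.measurable k).inv.aestronglyMeasurable (√lam)⁻¹
          (Eventually.of_forall fun a => ?_)
        rw [Real.norm_eq_abs, abs_of_pos (inv_pos.2 (hw0 a k))]
        exact hwinv a k
      · simp only [hh, hk, if_false]
        exact MemLp.zero
    have h1 := hann h hh2 fun χ hχ hχ2 => by
      simp only [hinner, statGrad]
      have : ∀ a, w a k * (χ (shift (unit k) a) - χ a) / w a k = χ (shift (unit k) a) - χ a :=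
        fun a => by field_simp [(hw0 a k).ne']
      simp only [this]
      rw [integral_sub ((memLp_comp_shift hP hχ2 _).integrable (by norm_num))
        (hχ2.integrable (by norm_num)), integral_shift hP _ _ hχ, sub_self]
    simp only [hinner] at h1
    rw [← neg_eq_zero, ← integral_neg, ← h1]
    refine integral_congr_ae ?_
    filter_upwards [hφ'] with a ha
    rw [ha, neg_neg]
  refine ⟨φ, ⟨hφm, hstat, MemLp.of_eval_piLp hgrad2, ?_⟩, ?_⟩
  · ext k
    rw [eval_integral_piLp fun k => (hgrad2 k).integrable (by norm_num), hmean]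
    rfl
  set f : Fin d → CoeffField d lam → ℝ := fun k a =>
    (a 0 k : ℝ) * (grad (φ a) 0 k + if k = i then 1 else 0) with hf
  have hfm : ∀ k, Measurable (f k) := fun k =>
    (hco 0 k).mul (((hφm _).sub (hφm _)).add_const _)
  have hf2 : ∀ k, MemLp (f k) 2 P := by
    intro k
    have h1 : MemLp (fun a => grad (φ a) 0 k + if k = i then (1 : ℝ) else 0) 2 P :=
      (hgrad2 k).add (memLp_const _)
    refine h1.of_le_mul (c := 1) (hfm k).aestronglyMeasurable (Eventually.of_forall fun a => ?_)
    rw [norm_mul, Real.norm_eq_abs (a 0 k : ℝ), abs_of_pos (coeff_pos hlam a 0 k)]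
    gcongr
    exact (a 0 k).2.2.le
  have hmul : ∀ {u v : CoeffField d lam → ℝ}, MemLp u 2 P → MemLp v 2 P →
      Integrable (fun a => u a * v a) P := fun hu hv => hu.integrable_mul hv
  -- Testing with indicators of arbitrary measurable sets turns the weak equation into an almost
  -- sure one at the origin.
  have hdiv : ∀ᵐ a ∂P, ∑ k, (f k (shift (-unit k) a) - f k a) = 0 := by
    have hint : ∀ k, Integrable (fun a => f k (shift (-unit k) a) - f k a) P := fun k =>
      ((memLp_comp_shift hP (hf2 k) _).sub (hf2 k)).integrable (by norm_num)
    refine Integrable.ae_eq_zero_of_forall_setIntegral_eq_zero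
      (integrable_finsetSum _ fun k _ => hint k) fun s hs _ => ?_
    set χ : CoeffField d lam → ℝ := s.indicator 1 with hχ
    have hχm : Measurable χ := measurable_one.indicator hs
    have hχ2 : MemLp χ 2 P := by
      refine MemLp.of_bound hχm.aestronglyMeasurable 1 (Eventually.of_forall fun a => ?_)
      by_cases ha : a ∈ s <;> simp [hχ, ha]
    have hk : ∀ k, ∫ a in s, (f k (shift (-unit k) a) - f k a) ∂P =
        ∫ a, f k a * (χ (shift (unit k) a) - χ a) ∂P := by
      intro k
      have e1 : ∫ a in s, (f k (shift (-unit k) a) - f k a) ∂P =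
          ∫ a, (f k (shift (-unit k) a) * χ a - f k a * χ a) ∂P := by
        rw [← integral_indicator hs]
        congr 1; ext a
        by_cases ha : a ∈ s <;> simp [hχ, ha]
      rw [e1, integral_sub (hmul (memLp_comp_shift hP (hf2 k) _) hχ2) (hmul (hf2 k) hχ2),
        ← integral_shift hP (unit k) (fun a => f k (shift (-unit k) a) * χ a)
          (((hfm k).comp (measurable_shift _)).mul hχm)]
      simp only [shift_shift, neg_add_cancel, shift_zero, mul_sub]
      rw [integral_sub (hmul (hf2 k) (memLp_comp_shift hP hχ2 _)) (hmul (hf2 k) hχ2)]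
    have hprod : ∀ k, Integrable (fun a => f k a * (χ (shift (unit k) a) - χ a)) P := fun k =>
      hmul (hf2 k) ((memLp_comp_shift hP hχ2 (unit k)).sub hχ2)
    rw [integral_finsetSum _ fun k _ => (hint k).integrableOn, Finset.sum_congr rfl fun k _ => hk k,
      ← integral_finsetSum _ fun k _ => hprod k, ← horth χ hχm hχ2]
    refine integral_congr_ae ?_
    filter_upwards [hφ'] with a ha
    rw [PiLp.inner_apply]
    refine Finset.sum_congr rfl fun k _ => ?_
    have := (hw0 a k).ne'
    simp only [hf, hg, statGrad, ha, ← hww, PiLp.sub_apply, RCLike.inner_apply, conj_trivial]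
    split_ifs
    · field_simp; ring
    · field_simp; ring
  have hzero : ∀ᵐ a ∂P,
      gradStar (mulField a fun z => grad (φ a) z + EuclideanSpace.single i (1 : ℝ)) 0 = 0 := by
    filter_upwards [hdiv, hstat] with a h1 h2
    rw [← h1]
    refine Finset.sum_congr rfl fun k _ => ?_
    simp only [hf, mulField, zero_sub, h2 (-unit k), PiLp.add_apply, PiLp.single_apply]
    simp [shift]
  -- The equation at the origin for every shift of `a` is the equation at every site.
  filter_upwards [ae_shift hP hzero, hstat, ae_shift hP hstat] with a h1 h2 h3
  refine ⟨fun x => ?_, hφ0 a⟩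
  rw [← h1 x]
  refine (mulField_shift a (φ a) (φ (shift x a)) i x fun z => ?_).symm
  rw [h3 x z, h2 (z + x), shift_shift]

end Existence

/-! ### Approximation of stationary gradients by gradients of stationary fields -/

section Weyl

variable {d : ℕ} {lam : ℝ} {P : Measure (CoeffField d lam)}

theorem integral_mul_second_difference (hP : IsStationaryMeasure P) {η : CoeffField d lam → ℝ}
    (hη : Measurable η) (hη2 : MemLp η 2 P) (z : Site d) :
    ∫ a, η a * (2 * η a - η (shift (-z) a) - η (shift z a)) ∂P =
      ∫ a, (η (shift z a) - η a) ^ 2 ∂P := by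
  have hmul : ∀ {u v : CoeffField d lam → ℝ}, MemLp u 2 P → MemLp v 2 P →
      Integrable (fun a => u a * v a) P := fun hu hv => hu.integrable_mul hv
  have hs := memLp_comp_shift hP hη2
  have e1 : ∫ a, η a * η (shift (-z) a) ∂P = ∫ a, η (shift z a) * η a ∂P := by
    rw [← integral_shift hP z (fun a => η a * η (shift (-z) a))
      (hη.mul (hη.comp (measurable_shift _)))]
    simp only [shift_shift, neg_add_cancel, shift_zero]
  have e2 : ∫ a, η (shift z a) * η (shift z a) ∂P = ∫ a, η a * η a ∂P :=
    integral_shift hP z (fun a => η a * η a) (hη.mul hη)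
  have e3 : ∀ a, η a * (2 * η a - η (shift (-z) a) - η (shift z a)) =
      η a * η a + η a * η a - η a * η (shift (-z) a) - η (shift z a) * η a := fun a => by ring
  have e4 : ∀ a, (η (shift z a) - η a) ^ 2 =
      η (shift z a) * η (shift z a) + η a * η a - η (shift z a) * η a - η (shift z a) * η a :=
    fun a => by ring
  simp only [e3, e4]
  have i1 := hmul hη2 hη2
  have i2 := hmul hη2 (hs (-z))
  have i3 := hmul (hs z) hη2
  have i4 := hmul (hs z) (hs z)
  have j1 : Integrable (fun a => η a * η a + η a * η a) P := i1.add i1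
  have j2 : Integrable (fun a => η a * η a + η a * η a - η a * η (shift (-z) a)) P := j1.sub i2
  have j3 : Integrable (fun a => η (shift z a) * η (shift z a) + η a * η a) P := i4.add i1
  have j4 : Integrable (fun a => η (shift z a) * η (shift z a) + η a * η a -
    η (shift z a) * η a) P := j3.sub i3
  rw [integral_sub j2 i3, integral_sub j1 i2, integral_add i1 i1, integral_sub j4 i3,
    integral_sub j3 i3, integral_add i4 i1, e1, e2]

variable [IsProbabilityMeasure P]

/-- Ergodicity is stated for strictly invariant sets, whereas {η > 0} is invariant only up to null
sets; hence the set on which η is positive along the whole orbit. If it had probability 1, the mean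
of η would be positive. -/
theorem ae_nonpos_of_shift_invariant (hE : IsErgodicMeasure P) {η : CoeffField d lam → ℝ}
    (hη : Measurable η) (hint : Integrable η P)
    (hinv : ∀ᵐ a ∂P, ∀ x, η (shift x a) = η a) (hmean : ∫ a, η a ∂P = 0) :
    ∀ᵐ a ∂P, η a ≤ 0 := by
  set A : Set (CoeffField d lam) := ⋂ z, {a | 0 < η (shift z a)} with hA
  have hAm : MeasurableSet A := MeasurableSet.iInter fun z =>
    measurableSet_lt measurable_const (hη.comp (measurable_shift z))
  have hAmem : ∀ a, a ∈ A ↔ ∀ z, 0 < η (shift z a) := fun a => Set.mem_iInter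
  have hAinv : ∀ z : Site d, shift z ⁻¹' A = A := by
    intro z
    ext a
    rw [Set.mem_preimage, hAmem, hAmem]
    refine ⟨fun h y => ?_, fun h y => ?_⟩
    · have := h (y - z)
      rwa [shift_shift, sub_add_cancel] at this
    · rw [shift_shift]
      exact h _
  rcases hE A hAm hAinv with h | h
  · filter_upwards [measure_eq_zero_iff_ae_notMem.1 h, hinv] with a h1 h2
    by_contra h3
    refine h1 ((hAmem a).2 fun z => ?_)
    rw [h2]
    exact not_le.1 h3
  · exfalso
    have h1 : ∀ᵐ a ∂P, a ∈ A := (prob_compl_eq_zero_iff hAm).2 h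
    have hpos : ∀ᵐ a ∂P, 0 < η a := by
      filter_upwards [h1] with a h2
      simpa [shift_zero] using (hAmem a).1 h2 0
    have h0 : η =ᵐ[P] 0 :=
      (integral_eq_zero_iff_of_nonneg_ae (hpos.mono fun a h => h.le) hint).1 hmean
    obtain ⟨a, h2, h3⟩ := (hpos.and h0).exists
    rw [h3] at h2
    exact lt_irrefl _ h2

theorem ae_eq_zero_of_shift_invariant (hP : IsStationaryMeasure P) (hE : IsErgodicMeasure P)
    {η : CoeffField d lam → ℝ} (hη : Measurable η) (hint : Integrable η P)
    (hinv : ∀ k, ∀ᵐ a ∂P, η (shift (unit k) a) = η a) (hmean : ∫ a, η a ∂P = 0) :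
    ∀ᵐ a ∂P, η a = 0 := by
  have hall : ∀ᵐ a ∂P, ∀ x, η (shift x a) = η a := by
    filter_upwards [ae_shift hP (ae_all_iff.2 hinv)] with a ha x
    induction x using site_induction with
    | h0 => rw [shift_zero]
    | hadd x k hx => rw [add_comm, ← shift_shift, ha x k, hx]
    | hsub x k hx => rw [← hx, ← ha (x - unit k) k, shift_shift, add_sub_cancel]
  have h1 := ae_nonpos_of_shift_invariant hE hη hint hall hmean
  have h2 := ae_nonpos_of_shift_invariant hE hη.neg hint.neg
    (hall.mono fun a h x => by simp [h x]) (by simp [integral_neg, hmean])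
  filter_upwards [h1, h2] with a h3 h4
  simp only [Pi.neg_apply] at h4
  linarith

/-- Let ζ be ∇φ minus its projection onto the closure of stationary gradients. It is curl-free and
orthogonal to these gradients, hence harmonic in each component, hence shift invariant. By
ergodicity it is constant, and its mean is zero. -/
theorem MemH.exists_statGrad_approx (hP : IsStationaryMeasure P) (hE : IsErgodicMeasure P)
    {φ : CoeffField d lam → Site d → ℝ} (hφ : MemH P φ) :
    ∃ ψ : ℕ → CoeffField d lam → ℝ, (∀ n, Measurable (ψ n) ∧ MemLp (ψ n) 2 P) ∧
      Tendsto (fun n => eLpNorm (fun a => statGrad (fun _ _ => 1) (ψ n) a - grad (φ a) 0) 2 P)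
        atTop (𝓝 0) := by
  have hw : IsWeight (fun (_ : CoeffField d lam) (_ : Fin d) => (1 : ℝ)) 1 :=
    ⟨one_pos, fun _ => measurable_const, fun _ _ => le_rfl, fun _ _ => le_rfl⟩
  obtain ⟨p, ψ, hpm, hp2, hψ, hlim, hae, horth, hann⟩ :=
    exists_statGrad_projection hP hw hφ.sq_integrable
  refine ⟨ψ, hψ, hlim.congr fun n => eLpNorm_congr_ae ?_⟩
  have hgm : ∀ k, Measurable fun a => grad (φ a) 0 k := fun k =>
    (hφ.measurable _).sub (hφ.measurable _)
  set ζ : Fin d → CoeffField d lam → ℝ := fun k a => grad (φ a) 0 k - p a k with hζ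
  have hζm : ∀ k, Measurable (ζ k) := fun k =>
    (hgm k).sub ((measurable_pi_apply k).comp ((WithLp.measurable_ofLp 2 _).comp hpm))
  have hζ2 : ∀ k, MemLp (ζ k) 2 P := fun k => (hφ.sq_integrable.eval_piLp k).sub (hp2.eval_piLp k)
  have hcurl : ∀ᵐ a ∂P, ∀ j k, ζ k (shift (unit j) a) - ζ k a =
      ζ j (shift (unit k) a) - ζ j a := by
    filter_upwards [hφ.stationary, ae_shift hP hae] with a h1 h2 j k
    have h3 : ∀ x k, Tendsto (fun n => ψ n (shift (x + unit k) a) - ψ n (shift x a)) atTop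
        (𝓝 (p (shift x a) k)) := fun x k => by
      simpa [statGrad, shift_shift, add_comm] using h2 x k
    have h4 : p (shift (unit j) a) k - p (shift 0 a) k =
        p (shift (unit k) a) j - p (shift 0 a) j := by
      refine tendsto_nhds_unique ((h3 (unit j) k).sub (h3 0 k))
        (((h3 (unit k) j).sub (h3 0 j)).congr fun n => ?_)
      rw [add_comm (unit k) (unit j), zero_add, zero_add]
      ring
    rw [shift_zero] at h4
    have h5 : grad (φ a) (unit j) k - grad (φ a) 0 k =
        grad (φ a) (unit k) j - grad (φ a) 0 j := by
      simp only [grad_apply, zero_add, add_comm (unit k) (unit j)]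
      ring
    simp only [hζ, ← h1 (unit j), ← h1 (unit k)]
    linarith
  have hinv : ∀ j k, ∀ᵐ a ∂P, ζ j (shift (unit k) a) = ζ j a := by
    intro j k
    -- Since ζ is curl-free, the i-th difference of this χ = D_k*ζ_k is D_k*D_kζ_i. Orthogonality to
    -- its gradient therefore says ∑_i E|D_kζ_i|² = 0.
    set χ : CoeffField d lam → ℝ := fun a => ζ k (shift (-unit k) a) - ζ k a with hχ
    have h1 := horth χ (((hζm k).comp (measurable_shift _)).sub (hζm k))
      ((memLp_comp_shift hP (hζ2 k) _).sub (hζ2 k))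
    set q : Fin d → CoeffField d lam → ℝ := fun i a =>
      ζ i a * (2 * ζ i a - ζ i (shift (-unit k) a) - ζ i (shift (unit k) a)) with hq
    have h2 : ∫ a, ∑ i, q i a ∂P = 0 := by
      rw [← h1]
      refine integral_congr_ae ?_
      filter_upwards [hcurl, ae_shift hP hcurl] with a h3 h4
      rw [PiLp.inner_apply]
      refine Finset.sum_congr rfl fun i _ => ?_
      have h5 := h3 i k
      have h6 := h4 (-unit k) i k
      rw [shift_shift, shift_shift, add_neg_cancel, shift_zero] at h6
      simp only [hq, hχ, statGrad, PiLp.sub_apply, RCLike.inner_apply, conj_trivial, one_mul,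
        shift_shift]
      rw [add_comm (-unit k) (unit i)]
      have h7 : grad (φ a) 0 i - p a i = ζ i a := rfl
      rw [h7, mul_comm]
      congr 1
      linarith
    have hmul : ∀ {u v : CoeffField d lam → ℝ}, MemLp u 2 P → MemLp v 2 P →
        Integrable (fun a => u a * v a) P := fun hu hv => hu.integrable_mul hv
    have hqi : ∀ i, Integrable (q i) P := fun i =>
      hmul (hζ2 i) ((((hζ2 i).const_mul 2).sub (memLp_comp_shift hP (hζ2 i) _)).sub
        (memLp_comp_shift hP (hζ2 i) _))
    rw [integral_finsetSum _ fun i _ => hqi i] at h2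
    have h3 : ∀ i, ∫ a, q i a ∂P = ∫ a, (ζ i (shift (unit k) a) - ζ i a) ^ 2 ∂P := fun i =>
      integral_mul_second_difference hP (hζm i) (hζ2 i) (unit k)
    simp only [h3] at h2
    have h4 := (Finset.sum_eq_zero_iff_of_nonneg fun i _ =>
      integral_nonneg fun a => sq_nonneg _).1 h2 j (Finset.mem_univ j)
    have h5 := (integral_eq_zero_iff_of_nonneg (fun a => sq_nonneg _)
      ((memLp_comp_shift hP (hζ2 j) _).sub (hζ2 j)).integrable_sq).1 h4
    filter_upwards [h5] with a h6
    exact sub_eq_zero.1 (pow_eq_zero_iff two_ne_zero |>.1 h6)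
  have hmean : ∀ k, ∫ a, ζ k a ∂P = 0 := by
    intro k
    have h1 : ∫ a, grad (φ a) 0 k ∂P = 0 := by
      rw [← eval_integral_piLp fun k => (hφ.sq_integrable.eval_piLp k).integrable (by norm_num),
        hφ.mean_zero]
      rfl
    have h2 := hann (fun _ => EuclideanSpace.single k 1) (memLp_const _) fun χ hχ hχ2 => by
      simp only [EuclideanSpace.inner_single_left, statGrad, map_one, one_mul]
      rw [integral_sub ((memLp_comp_shift hP hχ2 _).integrable (by norm_num))
        (hχ2.integrable (by norm_num)), integral_shift hP _ _ hχ, sub_self]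
    simp only [EuclideanSpace.inner_single_left, map_one, one_mul] at h2
    simp only [hζ]
    rw [integral_sub ((hφ.sq_integrable.eval_piLp k).integrable (by norm_num))
      ((hp2.eval_piLp k).integrable (by norm_num)), h1, h2, sub_zero]
  have hzero : ∀ᵐ a ∂P, ∀ k, ζ k a = 0 := ae_all_iff.2 fun k =>
    ae_eq_zero_of_shift_invariant hP hE (hζm k) ((hζ2 k).integrable (by norm_num))
      (fun j => hinv k j) (hmean k)
  filter_upwards [hzero] with a ha
  congr 1
  ext k
  exact (sub_eq_zero.1 (ha k)).symm

end Weyl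

/-! ### Sublinearity of random fields with stationary gradient -/

section Sublinearity

variable {d : ℕ} {lam : ℝ} {P : Measure (CoeffField d lam)}

theorem lintegral_enorm_sq {Ω E : Type*} [MeasurableSpace Ω] [NormedAddCommGroup E]
    (μ : Measure Ω) (f : Ω → E) : ∫⁻ a, ‖f a‖ₑ ^ 2 ∂μ = eLpNorm f 2 μ ^ 2 := by
  have h := eLpNorm_nnreal_pow_eq_lintegral (f := f) (μ := μ) (p := 2) two_ne_zero
  simp only [NNReal.coe_ofNat, ENNReal.rpow_ofNat, ENNReal.coe_ofNat] at h
  exact h.symm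

theorem sum_enorm_sq {ι E : Type*} [NormedAddCommGroup E] (s : Finset ι) (f : ι → E) :
    ∑ y ∈ s, ‖f y‖ₑ ^ 2 = ENNReal.ofReal (∑ y ∈ s, ‖f y‖ ^ 2) := by
  rw [ENNReal.ofReal_sum_of_nonneg fun y _ => sq_nonneg _]
  refine Finset.sum_congr rfl fun y _ => ?_
  rw [ENNReal.ofReal_pow (norm_nonneg _), ofReal_norm]

theorem sum_norm_sq_le_of_not_exists {E : Type*} [NormedAddCommGroup E] {α : ℝ} (hα : 0 ≤ α)
    {f : Site d → E} (h : ¬∃ R : ℕ, ENNReal.ofReal α * (latticeCube d R).card ≤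
      ∑ y ∈ latticeCube d R, ‖f y‖ₑ ^ 2) (R : ℕ) :
    ∑ y ∈ latticeCube d R, ‖f y‖ ^ 2 ≤ α * (latticeCube d R).card := by
  by_contra hlt
  refine h ⟨R, ?_⟩
  rw [sum_enorm_sq, ← ENNReal.ofReal_natCast, ← ENNReal.ofReal_mul hα]
  exact ENNReal.ofReal_le_ofReal (not_le.1 hlt).le

/-- The maximal function of |ψ|² is finite almost surely: the maximal inequality at height n forces
the probability of exceeding every n to vanish. -/
theorem ae_exists_sum_sq_le (hP : IsStationaryMeasure P) {ψ : CoeffField d lam → ℝ}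
    (hψ : Measurable ψ) (hψ2 : MemLp ψ 2 P) :
    ∀ᵐ a ∂P, ∃ M : ℝ, 0 ≤ M ∧ ∀ R : ℕ,
      ∑ y ∈ latticeCube d R, ‖ψ (shift y a)‖ ^ 2 ≤ M * (latticeCube d R).card := by
  set B : ℕ → Set (CoeffField d lam) := fun n => {a | ∃ R : ℕ,
    (n : ENNReal) * (latticeCube d R).card ≤ ∑ y ∈ latticeCube d R, ‖ψ (shift y a)‖ₑ ^ 2} with hB
  have h0 : P (⋂ n, B n) = 0 := by
    by_contra hne
    have hfin : 10 ^ d * ∫⁻ a, ‖ψ a‖ₑ ^ 2 ∂P ≠ ⊤ := by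
      rw [lintegral_enorm_sq]
      exact ENNReal.mul_ne_top (by simp) (ENNReal.pow_ne_top hψ2.2.ne)
    obtain ⟨n, hn⟩ := ENNReal.exists_nat_mul_gt hne hfin
    refine hn.not_ge (le_trans ?_ (maximal_inequality hP (hψ.enorm.pow_const 2) (n : ENNReal)))
    gcongr
    exact Set.iInter_subset B n
  filter_upwards [measure_eq_zero_iff_ae_notMem.1 h0] with a ha
  obtain ⟨n, hn⟩ := not_forall.1 (fun h => ha (Set.mem_iInter.2 h))
  refine ⟨n, n.cast_nonneg, sum_norm_sq_le_of_not_exists n.cast_nonneg ?_⟩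
  rwa [ENNReal.ofReal_natCast]

/-- Split φ into a stationary field ψ_n and a remainder v whose gradient is small in L²(P). The
averages of ψ_n² stay bounded, so they vanish after division by R². The maximal inequality keeps all
cube averages of |∇v|² below δ outside an event of probability tending to 0 in n, and there
`exists_avg_sq_le` bounds v. -/
theorem MemH.ae_sublinear [IsProbabilityMeasure P] (hP : IsStationaryMeasure P)
    (hE : IsErgodicMeasure P) {φ : CoeffField d lam → Site d → ℝ} (hφ : MemH P φ) :
    ∀ᵐ a ∂P, Sublinear (φ a) := by
  obtain ⟨C, hC, hmain⟩ := exists_avg_sq_le d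
  obtain ⟨ψ, hψ, hlim⟩ := hφ.exists_statGrad_approx hP hE
  have hw : IsWeight (fun (_ : CoeffField d lam) (_ : Fin d) => (1 : ℝ)) 1 :=
    ⟨one_pos, fun _ => measurable_const, fun _ _ => le_rfl, fun _ _ => le_rfl⟩
  have hgm : Measurable fun a => grad (φ a) 0 :=
    (WithLp.measurable_toLp 2 _).comp (measurable_pi_lambda _ fun k =>
      (hφ.measurable _).sub (hφ.measurable _))
  set q : (Site d → ℝ) → ℕ → ℝ := fun u R => ((R : ℝ) ^ 2)⁻¹ *
    (((latticeCube d R).card : ℝ)⁻¹ * ∑ x ∈ latticeCube d R, u x ^ 2) with hq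
  set f : ℕ → CoeffField d lam → EuclideanSpace ℝ (Fin d) := fun n a =>
    statGrad (fun _ _ => 1) (ψ n) a - grad (φ a) 0 with hf
  have hfm : ∀ n, Measurable (f n) := fun n => (measurable_statGrad hw (hψ n).1).sub hgm
  have hbound : ∀ᵐ a ∂P, ∀ n, ∃ M : ℝ, 0 ≤ M ∧ ∀ R : ℕ,
      ∑ y ∈ latticeCube d R, ‖ψ n (shift y a)‖ ^ 2 ≤ M * (latticeCube d R).card :=
    ae_all_iff.2 fun n => ae_exists_sum_sq_le hP (hψ n).1 (hψ n).2
  have hδ : ∀ δ : ℝ, 0 < δ → ∀ᵐ a ∂P, ∀ᶠ R : ℕ in atTop, q (φ a) R ≤ (2 * C + 1) * δ := by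
    intro δ hδ
    set N : Set (CoeffField d lam) :=
      {a | ¬∀ᶠ R : ℕ in atTop, q (φ a) R ≤ (2 * C + 1) * δ} with hN
    -- The exceptional set N does not depend on n while the right side tends to 0, so N is a null
    -- set.
    have hle : ∀ n, ENNReal.ofReal δ * P N ≤ 10 ^ d * ∫⁻ a, ‖f n a‖ₑ ^ 2 ∂P := by
      intro n
      refine le_trans ?_ (maximal_inequality hP ((hfm n).enorm.pow_const 2) (ENNReal.ofReal δ))
      gcongr 1
      refine measure_mono_ae ?_
      filter_upwards [hbound, hφ.stationary] with a hb hst hNa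
      by_contra hnot
      refine hNa ?_
      obtain ⟨M, hM0, hM⟩ := hb n
      have hsum := sum_norm_sq_le_of_not_exists hδ.le hnot
      set v : Site d → ℝ := fun x => φ a x - ψ n (shift x a) with hv
      have hgrad : ∀ x, ‖grad v x‖ = ‖f n (shift x a)‖ := by
        intro x
        rw [← norm_neg]
        congr 1
        ext k
        have h1 := congrArg (fun F : EuclideanSpace ℝ (Fin d) => F k) (hst x)
        simp only [grad_apply] at h1
        simp only [hf, statGrad, PiLp.neg_apply, PiLp.sub_apply, grad_apply, hv, shift_shift,
          ← h1, one_mul, add_comm (unit k) x]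
        ring
      have h1 := hmain v δ hδ (Eventually.of_forall fun R => by
        simp only [hgrad]; exact hsum R)
      have h2 : ∀ᶠ R : ℕ in atTop, ((R : ℝ) ^ 2)⁻¹ * M ≤ δ / 2 := by
        have h3 : Tendsto (fun R : ℕ => ((R : ℝ) ^ 2)⁻¹ * M) atTop (𝓝 (0 * M)) :=
          (((tendsto_pow_atTop two_ne_zero).comp
            tendsto_natCast_atTop_atTop).inv_tendsto_atTop).mul_const M
        rw [zero_mul] at h3
        exact h3.eventually_le_const (by positivity)
      filter_upwards [h1, h2] with R h3 h4
      have hcard := card_latticeCube_pos d R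
      have h5 : ∑ x ∈ latticeCube d R, φ a x ^ 2 ≤
          2 * ∑ x ∈ latticeCube d R, v x ^ 2 + 2 * (M * (latticeCube d R).card) := by
        have h6 := hM R
        calc ∑ x ∈ latticeCube d R, φ a x ^ 2
            ≤ ∑ x ∈ latticeCube d R, (2 * v x ^ 2 + 2 * ‖ψ n (shift x a)‖ ^ 2) := by
              refine Finset.sum_le_sum fun x _ => ?_
              rw [Real.norm_eq_abs, sq_abs]
              nlinarith [sq_nonneg (v x - ψ n (shift x a)), show φ a x =
                v x + ψ n (shift x a) by simp [hv]]
          _ = 2 * ∑ x ∈ latticeCube d R, v x ^ 2 +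
              2 * ∑ x ∈ latticeCube d R, ‖ψ n (shift x a)‖ ^ 2 := by
              rw [Finset.sum_add_distrib, Finset.mul_sum, Finset.mul_sum]
          _ ≤ _ := by gcongr
      calc q (φ a) R ≤ ((R : ℝ) ^ 2)⁻¹ * (((latticeCube d R).card : ℝ)⁻¹ *
            (2 * ∑ x ∈ latticeCube d R, v x ^ 2 + 2 * (M * (latticeCube d R).card))) := by
            simp only [hq]
            gcongr
        _ = 2 * (((R : ℝ) ^ 2)⁻¹ * (((latticeCube d R).card : ℝ)⁻¹ *
            ∑ x ∈ latticeCube d R, v x ^ 2)) + 2 * (((R : ℝ) ^ 2)⁻¹ * M) := by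
            field_simp
        _ ≤ _ := by linarith
    have hlim2 : Tendsto (fun n => 10 ^ d * ∫⁻ a, ‖f n a‖ₑ ^ 2 ∂P) atTop (𝓝 0) := by
      simp only [lintegral_enorm_sq]
      have h1 : Tendsto (fun n => eLpNorm (f n) 2 P ^ 2) atTop (𝓝 (0 ^ 2)) :=
        ((ENNReal.continuous_pow 2).tendsto 0).comp hlim
      have h2 := ENNReal.Tendsto.const_mul (a := 10 ^ d) h1 (Or.inr (by simp))
      simpa using h2
    have h3 : ENNReal.ofReal δ * P N ≤ 0 := ge_of_tendsto' hlim2 hle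
    have h4 : P N = 0 := by
      rcases mul_eq_zero.1 (le_antisymm h3 zero_le) with h | h
      · exact absurd h (by simpa using hδ)
      · exact h
    filter_upwards [measure_eq_zero_iff_ae_notMem.1 h4] with a ha
    exact not_not.1 ha
  filter_upwards [ae_all_iff.2 fun n : ℕ => hδ (1 / (n + 1)) (by positivity)] with a ha
  refine tendsto_order.2 ⟨fun b hb => Eventually.of_forall fun R => ?_, fun b hb => ?_⟩
  · refine hb.trans_le (mul_nonneg (by positivity) (mul_nonneg (by positivity) ?_))
    exact Finset.sum_nonneg fun _ _ => by positivity
  · obtain ⟨n, hn⟩ := exists_nat_one_div_lt (show 0 < b / (2 * C + 1) by positivity)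
    filter_upwards [ha n] with R hR
    refine hR.trans_lt ?_
    rwa [lt_div_iff₀ (by positivity), mul_comm] at hn

end Sublinearity

/-! ### Correctors -/

theorem IsRandomCorrector.ae_isSublinearCorrector {d : ℕ} {lam : ℝ}
    {P : Measure (CoeffField d lam)} [IsProbabilityMeasure P] (hP : IsStationaryMeasure P)
    (hE : IsErgodicMeasure P) {i : Fin d} {φ : CoeffField d lam → Site d → ℝ}
    (hφ : IsRandomCorrector P i φ) : ∀ᵐ a ∂P, IsSublinearCorrector a i (φ a) := by
  filter_upwards [hφ.1.ae_sublinear hP hE, hφ.2] with a h1 h2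
  exact ⟨h2.1, h1, h2.2⟩

theorem lemma4 (d : ℕ) (hd : 2 ≤ d) (lam : ℝ) (hlam : lam ∈ Set.Ioo (0 : ℝ) 1) :
    ∃ C : ℝ, 0 < C ∧
      ∀ P : Measure (CoeffField d lam), IsProbabilityMeasure P → IsStationaryMeasure P → IsErgodicMeasure P →
        -- the random corrector exists, and `corrector` is its pointwise defined version
        (∀ i : Fin d, (∃ φ, IsRandomCorrector P i φ) ∧
          ∀ φ, IsRandomCorrector P i φ → ∀ᵐ a ∂P, φ a = corrector a i) ∧
        ∃ Ω' : Set (CoeffField d lam), MeasurableSet Ω' ∧ P Ω' = 1 ∧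
          ∀ a ∈ Ω',
            -- the corrector is well defined at `a` and at all one-site modifications of `a`
            (∀ (i : Fin d) (x : Site d) (a' : CoeffField d lam), AgreeOff x a a' →
              ∃! φ : Site d → ℝ, IsSublinearCorrector a' i φ) ∧
            -- the Green's function exists, and the sensitivity estimate holds
            (∃ G, IsGreenFunction a G) ∧
            ∀ G, IsGreenFunction a G → ∀ (i : Fin d) (x y : Site d),
              lipDeriv x (fun b => grad (corrector b i) y) a ≤
                ENNReal.ofReal (C * ‖mixedGrad G y x‖ *
                  ‖grad (corrector a i) x + EuclideanSpace.single i (1 : ℝ)‖) := by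
  have hl : 0 < lam := hlam.1
  have hd0 : 0 < d := by omega
  refine ⟨2 * (1 + 1 / lam), by positivity, fun P hprob hP hE => ?_⟩
  have hL := ae_liouvilleProperty hd hl hP
  refine ⟨fun i => ⟨exists_isRandomCorrector hl hP i, fun φ hφ => ?_⟩, ?_⟩
  · filter_upwards [hL, hφ.ae_isSublinearCorrector hP hE] with a h1 h2
    exact h1.eq_corrector h2
  have hex : ∀ᵐ a ∂P, ∀ i, ∃ φ, IsSublinearCorrector a i φ := by
    refine ae_all_iff.2 fun i => ?_
    obtain ⟨φ, hφ⟩ := exists_isRandomCorrector hl hP i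
    filter_upwards [hφ.ae_isSublinearCorrector hP hE] with a ha
    exact ⟨_, ha⟩
  -- Ω' is the complement of a measurable null set containing all bad `a`; measurability of the good
  -- set itself never has to be shown.
  obtain ⟨t, hsub, htm, ht⟩ := exists_measurable_superset_of_null (ae_iff.1 (hL.and hex))
  refine ⟨tᶜ, htm.compl, (prob_compl_eq_one_iff htm).2 ht, fun a ha => ?_⟩
  obtain ⟨hLa, hφa⟩ := not_not.1 fun h => ha (hsub h)
  refine ⟨fun i x a' h => ?_, exists_greenFunction hd hl a, fun G hG i x y =>
    hLa.lipDeriv_le hd hl (hφa i) hG x y⟩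
  obtain ⟨φ, hφ⟩ := hφa i
  obtain ⟨w, -, hw, -⟩ := hφ.exists_perturbation hd0 hl h
  exact (LiouvilleProperty.of_agreeOff hd0 hl h hLa).existsUnique hw
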